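/- Theorem. Let $X,Y,Z$ be the vertices of a non-degenerate triangle in the plane, let $F$ be a point of the triangle $XYZ$, and let $A$ be a finite set of points of the triangle $XYZ$, none of which is $X$, $Y$, $Z$ or $F$. Assume that $\{X,Y,Z,F\}\cup A$ is in general position, i.e. no three distinct points of it are collinear. Put $P_1=X$, $P_2=Y$, $P_3=Z$, with indices read cyclically, so that $P_4=P_1$. For $i=1,2,3$ let $c_i$ be the number of points of $A$ in the triangle $FP_iP_{i+1}$, and assume $c_1,c_2,c_3>0$. Then the points of $A$ can be listed, each exactly once, as $$(A_{1,1},\dots,A_{1,c_1},\,A_{2,1},\dots,A_{2,c_2},\,A_{3,1},\dots,A_{3,c_3})$$ such that, writing $L_i$ for the polyline $P_iA_{i,1}\cdots A_{i,c_i}P_{i+1}$: 1. for each $i$, the polyline $L_i$ is contained in the triangle $FP_iP_{i+1}$; 2. the concatenation $L_1L_2L_3$ is a closed polyline without self-intersections, i.e. a simple polygon; 3. the region bounded by this polygon has a triangulation (a decomposition into triangles that meet along common faces, whose vertices are exactly the vertices of the polygon) in which no diagonal, i.e. no edge of the triangulation that is not a side of the polygon, has both its endpoints among the vertices $P_i,A_{i,1},\dots,A_{i,c_i},P_{i+1}$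 of one and the same $L_i$. -/

import Mathlib

/-- The Euclidean plane. -/
abbrev Plane : Type := EuclideanSpace ℝ (Fin 2)

/-- A set of points of the plane is in general position if no three distinct points of it are
collinear. -/
def InGeneralPosition (S : Set Plane) : Prop :=
  ∀ p ∈ S, ∀ q ∈ S, ∀ r ∈ S, p ≠ q → q ≠ r → p ≠ r → ¬ Collinear ℝ {p, q, r}

/-- The point set covered by the polyline through the points of the list `l`, in the
given order: the union of the segments between consecutive entries of `l`. -/
def polylineCarrier (l : List Plane) : Set Plane :=
  {x | ∃ p q : Plane, [p, q] <:+: l ∧ x ∈ segment ℝ p q}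

/-- The closed polyline (polygon) whose cyclic sequence of vertices is the list `l`. -/
def closedPolyline (l : List Plane) : Polygon Plane l.length :=
  ⟨l.get⟩

namespace Polygon

variable {n : ℕ}

/-- A polygon is simple (non-self-intersecting) if walking once around it, each side being traversed
from its first endpoint (included) to its last endpoint (excluded), never visits a point twice. -/
def IsSimple (p : Polygon Plane n) : Prop :=
  ∀ i j : Fin n, ∀ s ∈ Set.Ico (0 : ℝ) 1, ∀ t ∈ Set.Ico (0 : ℝ) 1,
    p.edgePath ℝ i s = p.edgePath ℝ j t → i = j ∧ s = t

/-- The open region enclosed by a polygon: the points off its boundary that lie in a bounded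
connected component of the complement of the boundary. -/
def inside (p : Polygon Plane n) : Set Plane :=
  {x | x ∉ p.boundary ℝ ∧ Bornology.IsBounded (connectedComponentIn (p.boundary ℝ)ᶜ x)}

/-- The closed region bounded by a polygon. -/
def region (p : Polygon Plane n) : Set Plane :=
  p.boundary ℝ ∪ p.inside

/-- `K` is a triangulation of the region bounded by the polygon `p`: a geometric simplicial complex
whose vertices are exactly the vertices of `p` and which covers exactly the closed region. -/
def IsTriangulation (p : Polygon Plane n) (K : Geometry.SimplicialComplex ℝ Plane) : Prop :=
  K.vertices = Set.range p.vertices ∧ K.space = p.region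

/-- The segment between `a` and `b` is a side of the polygon `p`. -/
def IsSide (p : Polygon Plane n) (a b : Plane) : Prop :=
  ∃ i : Fin n, s(a, b) = s(p i, p (finRotate n i))

/-- The segment between `a` and `b` is a diagonal used in the triangulation `K` of `p`: an edge of
`K` that is not a side of `p`. -/
def IsDiagonalOf (p : Polygon Plane n) (K : Geometry.SimplicialComplex ℝ Plane)
    (a b : Plane) : Prop :=
  a ≠ b ∧ (∃ e ∈ K.faces, (e : Set Plane) = {a, b}) ∧ ¬ p.IsSide a b

end Polygon

/-! Write `A`, `B`, `C` for the given points in the triangles `F Y Z`, `F Z X`, `F X Y`. The three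
chains run from `X` through `C` to `Y`, from `Y` through `A` to `Z`, and from `Z` through `B` to
`X`. The polygon is grown from one triangle by gluing further triangles over sides, each with a new
third vertex. Only the glued sides become diagonals, so it suffices that every glued side joins two
points without a common chain (`SplitPair`).

The starting triangle is a `CentralTriangle` `a b c`. Up to cyclic renaming, `a` is in `A`, `b` in
`B ∪ {Z}` and `c` in `C ∪ {Y}`, but not both `b = Z` and `c = Y`. All other points lie beyond its
sides in three corner groups: points of `B` and `C` with `X` beyond `b c`, and similarly at `Y` and
`Z`. Each corner is a strip between two chains separated by the line from `F` to the corner.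
`exists_strip_tiling` fills it greedily: rotating a line about either end of the current side gives
a first point hit, and one of the two candidates can be glued on so that the next side again joins
the two chains.

A central triangle is found in one of two ways. A front (`IsFront`) is a segment from `C ∪ {Y}` to
`B ∪ {Z}` cutting `A` off from `F`. If one exists, for some cyclic naming, take one as far from `F`
as possible; rotating about its two ends hits a point of `A`, which completes the triangle
(`IsFront.exists_central`). If none exists, take an empty triangle around `F` with vertices among
all the points (`exists_empty_triangle`). The absence of fronts restricts its sides so much that its
vertices lie in `A`, `B` and `C`, one in each, and it is central
(`Config.exists_central_of_rainbow`).

The Jordan curve theorem is not needed. Gluing preserves three properties of the covered set: it is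
compact, its complement is connected, and its frontier lies in the polygon
(`IsTiling.insertTriangle`). By `eq_union_bounded_components` such a set is exactly the polygon
together with the bounded components of its complement. -/

/-- Twice the signed area of the triangle `a b c`, computed from the coordinates `i` and `i + 1`;
the choice of `i` selects the orientation of the plane. -/
def orient (i : Fin 2) (a b c : Plane) : ℝ :=
  (b i - a i) * (c (i + 1) - a (i + 1)) - (b (i + 1) - a (i + 1)) * (c i - a i)

/-! ### Signed areas, half-planes and convex hulls -/

section orient

variable {i : Fin 2} {a b c d u v w z F : Plane}

theorem Plane.ext_coord (i : Fin 2) (h0 : a i = b i) (h1 : a (i + 1) = b (i + 1)) : a = b := by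
  ext j
  fin_cases i <;> fin_cases j <;> simp_all

theorem orient_rotate (i : Fin 2) (a b c : Plane) : orient i a b c = orient i b c a := by
  unfold orient; ring

theorem orient_swap (i : Fin 2) (a b c : Plane) : orient i a b c = - orient i b a c := by
  unfold orient; ring

theorem orient_swap_right (i : Fin 2) (a b c : Plane) : orient i a b c = - orient i a c b := by
  unfold orient; ring

/-- Passing from `i` to `i + 1` reflects the plane, so a mirror-image argument is the same lemma
applied with `i + 1`. -/
theorem orient_flip (i : Fin 2) (a b c : Plane) : orient (i + 1) a b c = - orient i a b c := by
  have h : i + 1 + 1 = i := by fin_cases i <;> rfl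
  unfold orient; rw [h]; ring

@[simp] theorem orient_left (i : Fin 2) (a b : Plane) : orient i a b a = 0 := by
  unfold orient; ring

@[simp] theorem orient_right (i : Fin 2) (a b : Plane) : orient i a b b = 0 := by
  unfold orient; ring

@[simp] theorem orient_self (i : Fin 2) (a b : Plane) : orient i a a b = 0 := by
  unfold orient; ring

theorem orient_add_add (i : Fin 2) (a b c d : Plane) :
    orient i d a b + orient i d b c + orient i d c a = orient i a b c := by
  unfold orient; ring

/-- The three-term Grassmann–Plücker relation for the vectors from `F`. Comparing the signs of its
terms gives nearly all later facts about angular order around a point. -/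
theorem orient_plucker (i : Fin 2) (F u v w z : Plane) :
    orient i F u v * orient i F w z + orient i F v w * orient i F u z
      + orient i F w u * orient i F v z = 0 := by
  unfold orient; ring

theorem orient_combo (i : Fin 2) (a b x y : Plane) {s t : ℝ} (h : s + t = 1) :
    orient i a b (s • x + t • y) = s * orient i a b x + t * orient i a b y := by
  obtain rfl : s = 1 - t := by linarith
  simp [orient]; ring

theorem continuous_orient (i : Fin 2) (a b : Plane) : Continuous (orient i a b) := by
  unfold orient; fun_prop

theorem convex_orient_nonneg (i : Fin 2) (a b : Plane) : Convex ℝ {x | 0 ≤ orient i a b x} := by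
  intro x hx y hy s t hs ht h
  simp only [Set.mem_ofPred_eq] at *
  rw [orient_combo i a b x y h]; positivity

theorem convex_orient_neg (i : Fin 2) (a b : Plane) : Convex ℝ {x | orient i a b x < 0} := by
  intro x hx y hy s t hs ht h
  simp only [Set.mem_ofPred_eq] at *
  rw [orient_combo i a b x y h]
  rcases hs.eq_or_lt with rfl | hs
  · have : t = 1 := by linarith
    simp [this, hy]
  · nlinarith

theorem convex_orient_pos (i : Fin 2) (a b : Plane) : Convex ℝ {x | 0 < orient i a b x} := by
  have : {x | 0 < orient i a b x} = {x | orient i b a x < 0} := by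
    ext x; simp [orient_swap i a b x]
  rw [this]; exact convex_orient_neg i b a

theorem orient_eq_zero_of_mem_segment (h : z ∈ segment ℝ a b) : orient i a b z = 0 := by
  obtain ⟨s, t, hs, ht, hst, rfl⟩ := h
  rw [orient_combo i a b a b hst]; simp

theorem bary_eq (i : Fin 2) (a b c d : Plane) (h : orient i a b c ≠ 0) :
    d = (orient i b c d / orient i a b c) • a + (orient i c a d / orient i a b c) • b
      + (orient i a b d / orient i a b c) • c := by
  apply Plane.ext_coord i <;> simp <;> field_simp <;> unfold orient <;> ring

theorem bary_sum (i : Fin 2) (a b c d : Plane) (h : orient i a b c ≠ 0) :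
    orient i b c d / orient i a b c + orient i c a d / orient i a b c
      + orient i a b d / orient i a b c = 1 := by
  field_simp; unfold orient; ring

theorem mem_convexHull_triple {x a b c : Plane} :
    x ∈ convexHull ℝ {a, b, c} ↔ ∃ r s t : ℝ, 0 ≤ r ∧ 0 ≤ s ∧ 0 ≤ t ∧ r + s + t = 1 ∧
      x = r • a + s • b + t • c := by
  rw [convexHull_insert (by simp), convexHull_pair, mem_convexJoin]
  constructor
  · rintro ⟨y, rfl, z, ⟨s, t, hs, ht, hst, rfl⟩, ⟨k, l, hk, hl, hkl, rfl⟩⟩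
    refine ⟨k, l * s, l * t, hk, by positivity, by positivity, ?_, ?_⟩
    · rw [add_assoc, ← mul_add, hst]; simpa
    · rw [smul_add, smul_smul, smul_smul, add_assoc]
  · rintro ⟨r, s, t, hr, hs, ht, h, rfl⟩
    rcases (add_nonneg hs ht).eq_or_lt with h0 | h0
    · obtain rfl : s = 0 := by linarith
      obtain rfl : t = 0 := by linarith
      obtain rfl : r = 1 := by linarith
      exact ⟨a, rfl, b, left_mem_segment _ _ _, by simpa using left_mem_segment ℝ a b⟩
    · refine ⟨a, rfl, (s / (s + t)) • b + (t / (s + t)) • c,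
        ⟨_, _, by positivity, by positivity, by field_simp, rfl⟩, r, s + t, hr, h0.le,
        by linarith, ?_⟩
      rw [smul_add, smul_smul, smul_smul, mul_div_cancel₀ _ h0.ne', mul_div_cancel₀ _ h0.ne',
        add_assoc]

theorem mem_triangle_iff {x : Plane} (h : 0 < orient i a b c) :
    x ∈ convexHull ℝ {a, b, c} ↔
      0 ≤ orient i a b x ∧ 0 ≤ orient i b c x ∧ 0 ≤ orient i c a x := by
  constructor
  · intro hx
    have key : ∀ p q r : Plane, ({a, b, c} : Set Plane) = {p, q, r} → 0 < orient i p q r →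
        0 ≤ orient i p q x := by
      intro p q r he hp
      refine convexHull_min ?_ (convex_orient_nonneg i p q) hx
      rw [he]; rintro y (rfl | rfl | rfl)
      · simp
      · simp
      · exact hp.le
    refine ⟨key a b c rfl h, key b c a ?_ ?_, key c a b ?_ ?_⟩
    · ext; simp; tauto
    · rwa [← orient_rotate]
    · ext; simp; tauto
    · rwa [orient_rotate]
  · rintro ⟨h1, h2, h3⟩
    rw [mem_convexHull_triple]
    exact ⟨_, _, _, by positivity, by positivity, by positivity, bary_sum i a b c x h.ne',
      bary_eq i a b c x h.ne'⟩

theorem collinear_iff_orient (i : Fin 2) (a b c : Plane) :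
    Collinear ℝ {a, b, c} ↔ orient i a b c = 0 := by
  rw [collinear_iff_of_mem (p₀ := a) (by simp)]
  constructor
  · rintro ⟨v, hv⟩
    obtain ⟨r, hr⟩ := hv b (by simp)
    obtain ⟨s, hs⟩ := hv c (by simp)
    subst hr hs
    simp [orient]; ring
  · intro h
    rcases eq_or_ne b a with rfl | hab
    · refine ⟨c - b, ?_⟩
      rintro p (rfl | rfl | rfl)
      · exact ⟨0, by simp⟩
      · exact ⟨0, by simp⟩
      · exact ⟨1, by simp⟩
    · refine ⟨b - a, ?_⟩
      rintro p (rfl | rfl | rfl)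
      · exact ⟨0, by simp⟩
      · exact ⟨1, by simp⟩
      · unfold orient at h
        by_cases h0 : b i - a i = 0
        · have h1 : b (i + 1) - a (i + 1) ≠ 0 := fun h1 => hab <|
            Plane.ext_coord i (by linarith) (by linarith)
          have h2 : p i - a i = 0 := by
            rw [h0] at h
            have : (b (i + 1) - a (i + 1)) * (p i - a i) = 0 := by linarith
            exact (mul_eq_zero.1 this).resolve_left h1
          refine ⟨(p (i + 1) - a (i + 1)) / (b (i + 1) - a (i + 1)), ?_⟩
          apply Plane.ext_coord i
          · simp [h0]; linarith
          · simp; field_simp; ring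
        · refine ⟨(p i - a i) / (b i - a i), ?_⟩
          apply Plane.ext_coord i
          · simp; field_simp; ring
          · simp; field_simp; linarith

theorem affineIndependent_iff_orient (i : Fin 2) (a b c : Plane) :
    AffineIndependent ℝ ![a, b, c] ↔ orient i a b c ≠ 0 := by
  rw [affineIndependent_iff_not_collinear_set, collinear_iff_orient i]

/-- An inner point of a segment with one end in the open half-plane and the other in its closure
stays in the open half-plane; two ends on the line both lie in `S`. -/
theorem convex_pos_union (i : Fin 2) (g h : Plane) {S : Set Plane} (hS : Convex ℝ S)
    (h0 : ∀ z ∈ S, orient i g h z = 0) : Convex ℝ ({z | 0 < orient i g h z} ∪ S) := by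
  intro x hx y hy s t hs ht hst
  by_cases hx' : 0 < orient i g h x
  · rcases hs.eq_or_lt with rfl | hs
    · obtain rfl : t = 1 := by linarith
      simpa using hy
    · left
      simp only [Set.mem_ofPred_eq, orient_combo i g h x y hst]
      have : 0 ≤ orient i g h y := by
        rcases hy with hy | hy
        · exact le_of_lt hy
        · exact (h0 y hy).ge
      positivity
  · have hxS : x ∈ S := hx.resolve_left hx'
    by_cases hy' : 0 < orient i g h y
    · rcases ht.eq_or_lt with rfl | ht
      · obtain rfl : s = 1 := by linarith
        simpa using hx
      · left
        simp only [Set.mem_ofPred_eq, orient_combo i g h x y hst, h0 x hxS]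
        simp; positivity
    · exact Or.inr (hS hxS (hy.resolve_left hy') hs ht hst)

/-- A convex hull whose generators lie strictly on one side of a line, except for some that lie in
a convex subset `S` of the line, meets the other side only in `S`. -/
theorem mem_of_mem_convexHull_of_orient_nonpos {g h x : Plane} {G S : Set Plane}
    (hS : Convex ℝ S) (h0 : ∀ z ∈ S, orient i g h z = 0)
    (hG : ∀ z ∈ G, 0 < orient i g h z ∨ z ∈ S) (hx : x ∈ convexHull ℝ G)
    (hx0 : orient i g h x ≤ 0) : x ∈ S := by
  have := convexHull_min (t := {z | 0 < orient i g h z} ∪ S) hG (convex_pos_union i g h hS h0) hx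
  exact this.resolve_left (not_lt.2 hx0)

theorem orient_nonpos_of_mem_convexHull {g h x : Plane} {G : Set Plane}
    (hG : ∀ z ∈ G, orient i g h z ≤ 0) (hx : x ∈ convexHull ℝ G) : orient i g h x ≤ 0 := by
  have := convexHull_min (t := {z | 0 ≤ orient i h g z})
    (fun z hz => by have := hG z hz; rw [orient_swap] at this; simpa using this)
    (convex_orient_nonneg i h g) hx
  rw [orient_swap]; simpa using this

/-- Two segments that cross each other's lines have a common point. -/
theorem exists_mem_segments {p p' q r : Plane} (h1 : orient i q p r * orient i q p p' ≤ 0)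
    (h2 : orient i r p' q * orient i r p' p ≤ 0) (h3 : orient i q p r ≠ 0) :
    ∃ x, x ∈ segment ℝ q p ∧ x ∈ segment ℝ r p' := by
  have e1 : orient i r p' q - orient i r p' p = -(orient i q p r - orient i q p p') := by
    unfold orient; ring
  set A := orient i q p r with hA
  set B := orient i q p p' with hB
  set C := orient i r p' q with hC
  set E := orient i r p' p with hE
  have hAB : A - B ≠ 0 := by
    intro h; have : A = B := by linarith
    rw [← this] at h1; exact h3 (by nlinarith [sq_nonneg A])
  have key : ∀ A B : ℝ, A * B ≤ 0 → A - B ≠ 0 → 0 ≤ A / (A - B) ∧ 0 ≤ - B / (A - B) := by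
    intro A B h hAB
    have h2 : 0 < (A - B) * (A - B) := mul_self_pos.2 hAB
    constructor
    · rw [← mul_div_mul_right _ _ hAB]; apply div_nonneg _ h2.le; nlinarith [sq_nonneg A]
    · rw [← mul_div_mul_right _ _ hAB]; apply div_nonneg _ h2.le; nlinarith [sq_nonneg B]
  have k1 := key A B h1 hAB
  have k2 := key C E h2 (by rwa [e1, neg_ne_zero])
  -- By `e1`, `C - E = -(A - B)`. Divided by `A - B`, the two sides of this identity are the common
  -- point, written on `q p` and on `r p'`.
  have hv : E • q - C • p = A • p' - B • r := by
    apply Plane.ext_coord i <;> simp [hA, hB, hC, hE] <;> unfold orient <;> ring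
  refine ⟨(-E / (C - E)) • q + (C / (C - E)) • p, ⟨_, _, k2.2, k2.1, ?_, rfl⟩,
    (-B / (A - B)), (A / (A - B)), k1.2, k1.1, ?_, ?_⟩
  · rw [← add_div, div_eq_one_iff_eq (by rwa [e1, neg_ne_zero])]; ring
  · rw [← add_div, div_eq_one_iff_eq hAB]; ring
  · rw [e1, neg_div_neg_eq, div_neg]
    have := congrArg (fun z => (A - B)⁻¹ • z) hv
    simp only [smul_sub, smul_smul] at this
    simp only [div_eq_inv_mul, mul_neg, neg_smul]
    rw [← sub_eq_add_neg, this]; abel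

end orient

/-! ### Connected complements and frontiers under gluing of triangles -/

section topology

variable {i : Fin 2} {u v w p x : Plane} {M : Set Plane}

theorem isOpen_orient_pos (i : Fin 2) (a b : Plane) : IsOpen {x | 0 < orient i a b x} :=
  isOpen_lt continuous_const (continuous_orient i a b)

theorem isCompact_triangle (a b c : Plane) : IsCompact (convexHull ℝ {a, b, c}) :=
  (Set.toFinite {a, b, c}).isCompact_convexHull ℝ

theorem segment_subset_triangle (a b c : Plane) : segment ℝ a b ⊆ convexHull ℝ {a, b, c} := by
  rw [← convexHull_pair]; exact convexHull_mono (by grind)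

theorem mem_segment_of_mem_triangle (h : 0 < orient i u v p) (hx : x ∈ convexHull ℝ {u, v, p})
    (h0 : orient i u v x ≤ 0) : x ∈ segment ℝ u v := by
  refine mem_of_mem_convexHull_of_orient_nonpos (convex_segment u v)
    (fun z hz => orient_eq_zero_of_mem_segment hz) ?_ hx h0
  rintro z (rfl | rfl | rfl)
  · exact Or.inr (left_mem_segment _ _ _)
  · exact Or.inr (right_mem_segment _ _ _)
  · exact Or.inl h

theorem triangle_rotate (a b c : Plane) : ({a, b, c} : Set Plane) = {b, c, a} := by
  ext; simp; tauto

theorem frontier_triangle_subset (h : 0 < orient i u v p) :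
    frontier (convexHull ℝ {u, v, p}) ⊆ segment ℝ u v ∪ segment ℝ v p ∪ segment ℝ p u := by
  intro x hx
  by_contra hn
  simp only [Set.mem_union, not_or] at hn
  obtain ⟨⟨h1, h2⟩, h3⟩ := hn
  have hxT := (isCompact_triangle u v p).isClosed.frontier_subset hx
  have k1 : 0 < orient i u v x := not_le.1 fun hle => h1 (mem_segment_of_mem_triangle h hxT hle)
  have k2 : 0 < orient i v p x := not_le.1 fun hle => h2 (mem_segment_of_mem_triangle
    (by rwa [← orient_rotate]) (by rwa [← triangle_rotate]) hle)
  have k3 : 0 < orient i p u x := not_le.1 fun hle => h3 (mem_segment_of_mem_triangle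
    (by rwa [orient_rotate]) (by rwa [triangle_rotate]) hle)
  refine hx.2 (mem_interior.2 ⟨_, ?_, ((isOpen_orient_pos i u v).inter
    (isOpen_orient_pos i v p)).inter (isOpen_orient_pos i p u), ⟨⟨k1, k2⟩, k3⟩⟩)
  rintro y ⟨⟨y1, y2⟩, y3⟩
  exact (mem_triangle_iff h).2 ⟨le_of_lt y1, le_of_lt y2, le_of_lt y3⟩

theorem orient_pos_of_mem_openSegment (h : 0 < orient i u v p) (hx : x ∈ segment ℝ u v)
    (hu : x ≠ u) (hv : x ≠ v) : 0 < orient i v p x ∧ 0 < orient i p u x := by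
  obtain ⟨s, t, hs, ht, hst, rfl⟩ := hx
  have hs' : 0 < s := hs.lt_of_ne' (by rintro rfl; apply hv; simp at hst; simp [hst])
  have ht' : 0 < t := ht.lt_of_ne' (by rintro rfl; apply hu; simp at hst; simp [hst])
  rw [orient_combo _ _ _ _ _ hst, orient_combo _ _ _ _ _ hst, orient_left, orient_right,
    ← orient_rotate i u v p, orient_rotate i p u v]
  constructor <;> simp <;> positivity

/-- Near an inner point of the common side only the line `u v` matters among the lines bounding the
two triangles. This is why a glued side leaves the frontier. -/
theorem union_triangles_mem_nhds (hp : 0 < orient i u v p) (hw : orient i u v w < 0)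
    (hx : x ∈ segment ℝ u v) (hu : x ≠ u) (hv : x ≠ v) :
    convexHull ℝ {u, v, p} ∪ convexHull ℝ {u, v, w} ∈ nhds x := by
  have hw' : 0 < orient i v u w := by rw [orient_swap]; linarith
  obtain ⟨a1, a2⟩ := orient_pos_of_mem_openSegment hp hx hu hv
  obtain ⟨b1, b2⟩ := orient_pos_of_mem_openSegment hw' (by rwa [segment_symm]) hv hu
  refine Filter.mem_of_superset (IsOpen.mem_nhds (((isOpen_orient_pos i v p).inter
    (isOpen_orient_pos i p u)).inter ((isOpen_orient_pos i u w).inter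
    (isOpen_orient_pos i w v))) ⟨⟨a1, a2⟩, b1, b2⟩) ?_
  rintro z ⟨⟨z1, z2⟩, z3, z4⟩
  rcases le_total 0 (orient i u v z) with h | h
  · exact Or.inl ((mem_triangle_iff hp).2 ⟨h, le_of_lt z1, le_of_lt z2⟩)
  · right
    rw [Set.insert_comm]
    exact (mem_triangle_iff hw').2
      ⟨by rw [orient_swap]; linarith, le_of_lt z3, le_of_lt z4⟩

theorem compl_triangle_eq (h : 0 < orient i u v p) : (convexHull ℝ {u, v, p})ᶜ =
    {x | orient i u v x < 0} ∪ {x | orient i v p x < 0} ∪ {x | orient i p u x < 0} := by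
  ext x
  rw [Set.mem_compl_iff, mem_triangle_iff h]
  simp only [Set.mem_union, Set.mem_ofPred_eq]
  grind

theorem exists_orient_neg_neg (h : 0 < orient i u v p) :
    ∃ z, orient i u v z < 0 ∧ orient i v p z < 0 := by
  refine ⟨v + (v - u) + (v - p), ?_, ?_⟩
  · have : orient i u v (v + (v - u) + (v - p)) = - orient i u v p := by
      simp [orient]; ring
    linarith
  · have : orient i v p (v + (v - u) + (v - p)) = - orient i u v p := by
      simp [orient]; ring
    linarith

/-- The complement is a union of three half-planes, and the two that belong to adjacent sides
intersect. -/
theorem isPreconnected_compl_triangle (h : 0 < orient i u v p) :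
    IsPreconnected (convexHull ℝ {u, v, p})ᶜ := by
  rw [compl_triangle_eq h]
  obtain ⟨z1, a1, b1⟩ := exists_orient_neg_neg h
  obtain ⟨z2, a2, b2⟩ := exists_orient_neg_neg (h.trans_eq (orient_rotate i u v p))
  exact ((convex_orient_neg i u v).isPreconnected.union' ⟨z1, a1, b1⟩
    (convex_orient_neg i v p).isPreconnected).union' ⟨z2, Or.inr a2, b2⟩
    (convex_orient_neg i p u).isPreconnected

/-- Points of the apex corner of a triangle have small neighbourhoods whose part outside the
triangle is preconnected. -/
theorem exists_nhds_diff_triangle_preconnected (h : 0 < orient i u v p)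
    (hx : x ∈ convexHull ℝ {u, v, p}) (h0 : 0 < orient i u v x) {O : Set Plane} (hO : O ∈ nhds x) :
    ∃ W ∈ nhds x, W ⊆ O ∧ IsPreconnected (W \ convexHull ℝ {u, v, p}) := by
  obtain ⟨-, hx1, hx2⟩ := (mem_triangle_iff h).1 hx
  have hO' := Filter.inter_mem hO ((isOpen_orient_pos i u v).mem_nhds h0)
  have hconv : ∀ r a b, IsPreconnected (Metric.ball x r ∩ {z | orient i a b z < 0}) :=
    fun r a b => ((convex_ball x r).inter (convex_orient_neg i a b)).isPreconnected
  have hnot : ∀ z, 0 < orient i u v z → (z ∉ convexHull ℝ {u, v, p} ↔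
      orient i v p z < 0 ∨ orient i p u z < 0) := by
    intro z hz
    rw [mem_triangle_iff h]; grind
  rcases hx1.eq_or_lt with e1 | e1 <;> rcases hx2.eq_or_lt with e2 | e2
  · obtain ⟨r, hr, hsub⟩ := Metric.mem_nhds_iff.1 hO'
    refine ⟨_, Metric.ball_mem_nhds x hr, fun z hz => (hsub hz).1, ?_⟩
    have : Metric.ball x r \ convexHull ℝ {u, v, p} =
        (Metric.ball x r ∩ {z | orient i v p z < 0}) ∪
          (Metric.ball x r ∩ {z | orient i p u z < 0}) := by
      ext z
      by_cases hz : z ∈ Metric.ball x r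
      · simp [hz, hnot z (hsub hz).2]
      · simp [hz]
    rw [this]
    refine (hconv r v p).union' ?_ (hconv r p u)
    -- Here `x` is on both sides through the apex. A small move away from both `u` and `v` reaches a
    -- point common to the two convex pieces.
    have hcont : ContinuousAt (fun t : ℝ => x + t • (x - u + (x - v))) 0 := by fun_prop
    have hmem : Metric.ball x r ∈ nhds ((fun t : ℝ => x + t • (x - u + (x - v))) 0) := by
      simpa using Metric.ball_mem_nhds x hr
    obtain ⟨e, he, hb⟩ := Metric.eventually_nhds_iff.1 (hcont.eventually_mem hmem)
    have hb := hb (y := e / 2) (by rw [Real.dist_eq, sub_zero, abs_of_pos (by positivity)]; linarith)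
    refine ⟨_, ⟨hb, ?_⟩, hb, ?_⟩
    · have : orient i v p (x + (e / 2) • (x - u + (x - v))) =
          (1 + e) * orient i v p x - e / 2 * orient i u v p := by
        simp [orient]; ring
      simp only [Set.mem_ofPred_eq]; rw [this, ← e1]; nlinarith
    · have : orient i p u (x + (e / 2) • (x - u + (x - v))) =
          (1 + e) * orient i p u x - e / 2 * orient i u v p := by
        simp [orient]; ring
      simp only [Set.mem_ofPred_eq]; rw [this, ← e2]; nlinarith
  · obtain ⟨r, hr, hsub⟩ := Metric.mem_nhds_iff.1
      (Filter.inter_mem hO' ((isOpen_orient_pos i p u).mem_nhds e2))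
    refine ⟨_, Metric.ball_mem_nhds x hr, fun z hz => (hsub hz).1.1, ?_⟩
    convert hconv r v p using 1
    ext z
    by_cases hz : z ∈ Metric.ball x r
    · have := (hsub hz).2
      simp only [Set.mem_ofPred_eq] at this
      simp [hz, hnot z (hsub hz).1.2, this.le]
    · simp [hz]
  · obtain ⟨r, hr, hsub⟩ := Metric.mem_nhds_iff.1
      (Filter.inter_mem hO' ((isOpen_orient_pos i v p).mem_nhds e1))
    refine ⟨_, Metric.ball_mem_nhds x hr, fun z hz => (hsub hz).1.1, ?_⟩
    convert hconv r p u using 1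
    ext z
    by_cases hz : z ∈ Metric.ball x r
    · have := (hsub hz).2
      simp only [Set.mem_ofPred_eq] at this
      simp [hz, hnot z (hsub hz).1.2, this.le]
    · simp [hz]
  · obtain ⟨r, hr, hsub⟩ := Metric.mem_nhds_iff.1
      (Filter.inter_mem hO' (Filter.inter_mem ((isOpen_orient_pos i v p).mem_nhds e1)
        ((isOpen_orient_pos i p u).mem_nhds e2)))
    refine ⟨_, Metric.ball_mem_nhds x hr, fun z hz => (hsub hz).1.1, ?_⟩
    convert isPreconnected_empty
    ext z
    by_cases hz : z ∈ Metric.ball x r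
    · have h1 := (hsub hz).2.1
      have h2 := (hsub hz).2.2
      simp only [Set.mem_ofPred_eq] at h1 h2
      simp only [Set.mem_sdiff, hz, hnot z (hsub hz).1.2, true_and, Set.mem_empty_iff_false, iff_false]
      grind
    · simp [hz]

theorem mem_closure_orient_neg {g h y z : Plane} (hy : orient i g h y = 0)
    (hz : 0 < orient i g h z) : y ∈ closure {x | orient i g h x < 0} := by
  have hcont : Continuous (fun t : ℝ => y + t • (y - z)) := by fun_prop
  have h0 : (0 : ℝ) ∈ closure (Set.Ioi (0 : ℝ)) := by simp
  have := hcont.continuousAt.continuousWithinAt.mem_closure_image (s := Set.Ioi 0) h0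
  simp only [zero_smul, add_zero] at this
  refine closure_mono ?_ this
  rintro _ ⟨t, ht, rfl⟩
  have e : orient i g h (y + t • (y - z)) = (1 + t) * orient i g h y - t * orient i g h z := by
    simp [orient]; ring
  simp only [Set.mem_ofPred_eq, Set.mem_Ioi] at *
  rw [e, hy]; nlinarith

/-- Gluing a triangle along one of its sides keeps the complement connected. -/
theorem isPreconnected_compl_union_triangle (h : 0 < orient i u v p) (hM : IsClosed M)
    (hMc : IsPreconnected Mᶜ) (huv : segment ℝ u v ⊆ M)
    (hT : convexHull ℝ {u, v, p} ∩ M ⊆ segment ℝ u v) :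
    IsPreconnected (M ∪ convexHull ℝ {u, v, p})ᶜ := by
  set T := convexHull ℝ {u, v, p} with hTdef
  have hTc : IsClosed T := (isCompact_triangle u v p).isClosed
  have hpos : ∀ y ∈ T, y ∉ M → 0 < orient i u v y := fun y hy hyM =>
    not_le.1 fun hle => hyM (huv (mem_segment_of_mem_triangle h hy hle))
  have hposM : ∀ y ∈ T, 0 < orient i u v y → y ∉ M := fun y hy hy0 hyM => by
    rw [orient_eq_zero_of_mem_segment (hT ⟨hy, hyM⟩)] at hy0; exact lt_irrefl _ hy0
  -- `Γ₁` and `Γ₂` are the sides `v p` and `p u` without `v` and `u`. Together they form the part of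
  -- the boundary of `T` that is exposed to the complement of `M`, and it is connected through `p`.
  set Γ₁ : Set Plane := {y | 0 < orient i u v y} ∩ T ∩ {y | 0 ≤ orient i p v y}
  set Γ₂ : Set Plane := {y | 0 < orient i u v y} ∩ T ∩ {y | 0 ≤ orient i u p y}
  have hpT : p ∈ T := subset_convexHull ℝ _ (by simp)
  have hΓ : IsPreconnected (Γ₁ ∪ Γ₂) := by
    refine IsPreconnected.union' (s := Γ₁) (t := Γ₂) ⟨p, ⟨⟨h, hpT⟩, by simp⟩, ⟨⟨h, hpT⟩, by simp⟩⟩ ?_ ?_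
    · exact (((convex_orient_pos i u v).inter (convex_convexHull ℝ _)).inter
        (convex_orient_nonneg i p v)).isPreconnected
    · exact (((convex_orient_pos i u v).inter (convex_convexHull ℝ _)).inter
        (convex_orient_nonneg i u p)).isPreconnected
  have hΓT : ∀ y ∈ Γ₁ ∪ Γ₂, y ∈ T ∧ 0 < orient i u v y ∧ y ∈ closure Tᶜ := by
    have hsub1 : {x | orient i v p x < 0} ⊆ Tᶜ := by rw [compl_triangle_eq h]; grind
    have hsub2 : {x | orient i p u x < 0} ⊆ Tᶜ := by rw [compl_triangle_eq h]; grind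
    rintro y (⟨⟨y1, y2⟩, y3⟩ | ⟨⟨y1, y2⟩, y3⟩)
    · refine ⟨y2, y1, closure_mono hsub1 (mem_closure_orient_neg (z := u) ?_ ?_)⟩
      · have := ((mem_triangle_iff h).1 y2).2.1
        rw [Set.mem_ofPred_eq, orient_swap] at y3; linarith
      · rwa [← orient_rotate]
    · refine ⟨y2, y1, closure_mono hsub2 (mem_closure_orient_neg (z := v) ?_ ?_)⟩
      · have := ((mem_triangle_iff h).1 y2).2.2
        rw [Set.mem_ofPred_eq, orient_swap] at y3; linarith
      · rwa [orient_rotate]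
  have hcover : ∀ y ∈ T, y ∉ M → y ∉ Γ₁ ∪ Γ₂ → y ∈ interior T := by
    intro y hy hyM hyΓ
    have h0 := hpos y hy hyM
    obtain ⟨-, h1, h2⟩ := (mem_triangle_iff h).1 hy
    by_contra hint
    rcases frontier_triangle_subset h ⟨subset_closure hy, hint⟩ with (hs | hs) | hs
    · exact hyM (huv hs)
    · exact hyΓ (Or.inl ⟨⟨h0, hy⟩, by
        rw [Set.mem_ofPred_eq, orient_swap, orient_eq_zero_of_mem_segment hs]; simp⟩)
    · exact hyΓ (Or.inr ⟨⟨h0, hy⟩, by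
        rw [Set.mem_ofPred_eq, orient_swap, orient_eq_zero_of_mem_segment hs]; simp⟩)
  have hNo : IsOpen (M ∪ T)ᶜ := (hM.union hTc).isOpen_compl
  rw [isPreconnected_iff_subset_of_disjoint]
  intro U V hU hV hUV hdisj
  set A := (M ∪ T)ᶜ ∩ U
  set B := (M ∪ T)ᶜ ∩ V
  have hA : IsOpen A := hNo.inter hU
  have hB : IsOpen B := hNo.inter hV
  have hAB : Disjoint A B := by
    rw [Set.disjoint_left]; rintro z ⟨z1, z2⟩ ⟨-, z3⟩
    have : z ∈ (M ∪ T)ᶜ ∩ (U ∩ V) := ⟨z1, z2, z3⟩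
    rw [hdisj] at this; exact this
  have hcov : (M ∪ T)ᶜ ⊆ A ∪ B := fun z hz => (hUV hz).imp (fun k => ⟨hz, k⟩) (fun k => ⟨hz, k⟩)
  -- If `B` does not accumulate at the exposed sides, it is open and relatively closed in `Mᶜ`. It
  -- misses `p ∈ Mᶜ`, so connectedness of `Mᶜ` leaves nothing of the complement for `B`.
  have main : ∀ A B : Set Plane, IsOpen A → IsOpen B → Disjoint A B → B ⊆ (M ∪ T)ᶜ →
      (M ∪ T)ᶜ ⊆ A ∪ B → (Γ₁ ∪ Γ₂) ∩ closure B = ∅ → (M ∪ T)ᶜ ⊆ A := by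
    intro A B hA hB hAB hBN hcov hΓB
    have hsub : Mᶜ ⊆ B ∪ (closure B)ᶜ := by
      intro z hz
      by_cases hzB : z ∈ closure B
      · left
        by_cases hzT : z ∈ T
        · exfalso
          have hzΓ : z ∉ Γ₁ ∪ Γ₂ := fun k => by
            have : z ∈ (Γ₁ ∪ Γ₂) ∩ closure B := ⟨k, hzB⟩
            rw [hΓB] at this; exact this
          obtain ⟨y, y1, y2⟩ := mem_closure_iff.1 hzB _ isOpen_interior (hcover z hzT hz hzΓ)
          exact hBN y2 (Or.inr (interior_subset y1))
        · rcases hcov (show z ∈ (M ∪ T)ᶜ from fun k => k.elim hz hzT) with k | k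
          · obtain ⟨y, y1, y2⟩ := mem_closure_iff.1 hzB _ hA k
            exact absurd y2 (Set.disjoint_left.1 hAB y1)
          · exact k
      · exact Or.inr hzB
    rcases (isPreconnected_iff_subset_of_disjoint.1 hMc) B (closure B)ᶜ hB
      isClosed_closure.isOpen_compl hsub (by
        ext z; simp only [Set.mem_inter_iff, Set.mem_compl_iff, Set.mem_empty_iff_false, iff_false]
        rintro ⟨-, k1, k2⟩; exact k2 (subset_closure k1)) with k | k
    · exact absurd (Or.inr hpT) (hBN (k (hposM p hpT h)))
    · intro z hz
      refine (hcov hz).resolve_right fun hzB => ?_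
      exact k (fun hzM => hz (Or.inl hzM)) (subset_closure hzB)
  -- A point of the exposed sides has a small neighbourhood whose part outside `T` is connected, so
  -- it cannot be a limit of both parts of a separation. Since `Γ₁ ∪ Γ₂` is connected and covered by
  -- the two closures, only one part accumulates there.
  have hnone : ¬ ((Γ₁ ∪ Γ₂) ∩ (closure A ∩ closure B)).Nonempty := by
    rintro ⟨y, hy, hyA, hyB⟩
    obtain ⟨hyT, hy0, -⟩ := hΓT y hy
    obtain ⟨W, hW, hWM, hWc⟩ := exists_nhds_diff_triangle_preconnected h hyT hy0
      (hM.isOpen_compl.mem_nhds (hposM y hyT hy0))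
    have hWN : W \ T ⊆ A ∪ B := fun z hz => hcov fun k => k.elim (hWM hz.1) hz.2
    obtain ⟨a, haW, haA⟩ := mem_closure_iff_nhds.1 hyA W hW
    obtain ⟨b, hbW, hbB⟩ := mem_closure_iff_nhds.1 hyB W hW
    rcases (isPreconnected_iff_subset_of_disjoint.1 hWc) A B hA hB hWN (by
      rw [hAB.inter_eq, Set.inter_empty]) with k | k
    · exact Set.disjoint_left.1 hAB (k ⟨hbW, fun q => hbB.1 (Or.inr q)⟩) hbB
    · exact Set.disjoint_left.1 hAB haA (k ⟨haW, fun q => haA.1 (Or.inr q)⟩)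
  have hΓcov : Γ₁ ∪ Γ₂ ⊆ closure A ∪ closure B := by
    intro y hy
    obtain ⟨hyT, hy0, hyc⟩ := hΓT y hy
    rw [← closure_union, mem_closure_iff_nhds]
    intro O hO
    obtain ⟨z, ⟨z1, z2⟩, z3⟩ := mem_closure_iff_nhds.1 hyc _ (Filter.inter_mem hO
      (hM.isOpen_compl.mem_nhds (hposM y hyT hy0)))
    exact ⟨z, z1, hcov fun k => k.elim z2 z3⟩
  by_cases hΓA : ((Γ₁ ∪ Γ₂) ∩ closure A).Nonempty
  · have : (Γ₁ ∪ Γ₂) ∩ closure B = ∅ := by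
      by_contra hne
      exact hnone (isPreconnected_closed_iff.1 hΓ _ _ isClosed_closure isClosed_closure hΓcov hΓA
        (Set.nonempty_iff_ne_empty.2 hne))
    exact Or.inl fun z hz => (main A B hA hB hAB Set.inter_subset_left hcov this hz).2
  · rw [Set.not_nonempty_iff_eq_empty] at hΓA
    exact Or.inr fun z hz => (main B A hB hA hAB.symm Set.inter_subset_left
      (by rwa [Set.union_comm B]) hΓA hz).2

/-- A compact set with connected complement is its frontier filled in. -/
theorem eq_union_bounded_components {D : Set Plane} (hM : IsCompact M) (hDM : D ⊆ M)
    (hf : frontier M ⊆ D) (hc : IsPreconnected Mᶜ) :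
    M = D ∪ {x | x ∉ D ∧ Bornology.IsBounded (connectedComponentIn Dᶜ x)} := by
  ext x
  constructor
  · intro hx
    by_cases hxD : x ∈ D
    · exact Or.inl hxD
    · refine Or.inr ⟨hxD, hM.isBounded.subset ?_⟩
      -- The frontier of `M` lies in `D`, so a component of `Dᶜ` cannot pass from the interior of
      -- `M` to its complement.
      have hsub : connectedComponentIn Dᶜ x ⊆ interior M ∪ Mᶜ := by
        intro z hz
        have hzD := connectedComponentIn_subset _ _ hz
        by_cases hzM : z ∈ M
        · left
          by_contra hi
          exact hzD (hf ⟨subset_closure hzM, hi⟩)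
        · exact Or.inr hzM
      have hxi : x ∈ interior M := by
        by_contra hi
        exact hxD (hf ⟨subset_closure hx, hi⟩)
      rcases (isPreconnected_iff_subset_of_disjoint.1 isPreconnected_connectedComponentIn)
        (interior M) Mᶜ isOpen_interior hM.isClosed.isOpen_compl hsub (by
          ext z; simp only [Set.mem_inter_iff, Set.mem_compl_iff, Set.mem_empty_iff_false,
            iff_false]
          rintro ⟨-, k1, k2⟩; exact k2 (interior_subset k1)) with k | k
      · exact k.trans interior_subset
      · exact absurd hx (k (mem_connectedComponentIn hxD))
  · rintro (hx | ⟨hxD, hb⟩)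
    · exact hDM hx
    · by_contra hxM
      -- All of `Mᶜ` lies in one component of `Dᶜ`. If that were bounded, the plane would be
      -- bounded, as `M` is.
      have hsub : Mᶜ ⊆ connectedComponentIn Dᶜ x :=
        hc.subset_connectedComponentIn hxM (Set.compl_subset_compl.2 hDM)
      have := (hb.subset hsub).union hM.isBounded
      rw [Set.compl_union_self] at this
      exact NormedSpace.unbounded_univ ℝ Plane this

end topology

/-! ### Simplicial complexes built by gluing triangles -/

section tiling

open Geometry

variable {i : Fin 2} {u v w p x a b c : Plane}

theorem eq_of_mem_segments (h : orient i a b c ≠ 0) (h1 : x ∈ segment ℝ a b)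
    (h2 : x ∈ segment ℝ b c) : x = b := by
  have h0 := orient_eq_zero_of_mem_segment (i := i) h2
  obtain ⟨s, t, hs, ht, hst, rfl⟩ := h1
  rw [orient_combo _ _ _ _ _ hst, orient_left, ← orient_rotate] at h0
  have : s = 0 := by simpa [h] using h0
  subst this
  simp at hst; simp [hst]

theorem exists_finset_triple (h : orient i a b c ≠ 0) :
    ∃ t : Finset Plane, (t : Set Plane) = {a, b, c} ∧ AffineIndependent ℝ ((↑) : t → Plane) := by
  refine ⟨(Set.toFinite {a, b, c}).toFinset, by simp, ?_⟩
  have := ((affineIndependent_iff_orient i a b c).2 h).range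
  refine this.mono (fun x hx => ?_)
  rw [Matrix.range_cons, Matrix.range_cons, Matrix.range_cons, Matrix.range_empty]
  simp only [Set.union_empty, Set.mem_union, Set.mem_singleton_iff]
  simpa using hx

/-- Checking intersections with the full simplex `t` is enough: faces of one affinely independent
set meet in the hull of their common vertices, which passes the condition on to every face of `t`.
-/
theorem exists_complex_union (K : SimplicialComplex ℝ Plane) (t : Finset Plane)
    (ht : AffineIndependent ℝ ((↑) : t → Plane))
    (h : ∀ s ∈ K.faces, convexHull ℝ (s : Set Plane) ∩ convexHull ℝ t ⊆
      convexHull ℝ (s ∩ t : Set Plane)) :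
    ∃ K' : SimplicialComplex ℝ Plane, K'.faces = K.faces ∪ {s | s ⊆ t ∧ s.Nonempty} := by
  classical
  have key : ∀ s ∈ K.faces, ∀ s' ⊆ t, convexHull ℝ (s : Set Plane) ∩ convexHull ℝ s' ⊆
      convexHull ℝ (s ∩ s' : Set Plane) := by
    rintro s hs s' hs' x ⟨h1, h2⟩
    have h3 := h s hs ⟨h1, convexHull_mono hs' h2⟩
    have h4 := ht.convexHull_inter (t₁ := s ∩ t) Finset.inter_subset_right hs'
    have h5 : x ∈ convexHull ℝ (((s ∩ t : Finset Plane) : Set Plane) ∩ s') := by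
      rw [h4]; exact ⟨by simpa using h3, h2⟩
    refine convexHull_mono ?_ h5
    intro z hz; simp at hz ⊢; tauto
  refine ⟨{ faces := K.faces ∪ {s | s ⊆ t ∧ s.Nonempty}
            isRelLowerSet_faces := ?_
            indep := ?_
            inter_subset_convexHull := ?_ }, rfl⟩
  · rintro s (hs | ⟨hs, hn⟩)
    · exact ⟨K.nonempty_of_mem_faces hs, fun s' h1 h2 => Or.inl (K.down_closed hs h1 h2)⟩
    · exact ⟨hn, fun s' h1 h2 => Or.inr ⟨h1.trans hs, h2⟩⟩
  · rintro s (hs | ⟨hs, hn⟩)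
    · exact K.indep hs
    · exact AffineIndependent.mono ht (s := (s : Set Plane)) hs
  · rintro s s' (hs | ⟨hs, -⟩) (hs' | ⟨hs', -⟩)
    · exact K.inter_subset_convexHull hs hs'
    · exact key s hs s' hs'
    · rw [Set.inter_comm, Set.inter_comm (s : Set Plane)]
      exact key s' hs' s hs
    · rw [ht.convexHull_inter hs hs']

/-- `K` triangulates the region bounded by the closed curve with set of directed sides `E`, and all
edges of `K` which are not sides satisfy `Bi`. -/
structure IsTiling (Bi : Plane → Plane → Prop) (E : Set (Plane × Plane))
    (K : SimplicialComplex ℝ Plane) : Prop where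
  edge_face : ∀ a b, a ≠ b → (∃ s ∈ K.faces, (s : Set Plane) = {a, b}) →
    (a, b) ∈ E ∨ (b, a) ∈ E ∨ Bi a b
  side_face : ∀ a b, (a, b) ∈ E → ∃ s ∈ K.faces, ∃ w, (s : Set Plane) = {a, b, w} ∧
    ¬ Collinear ℝ {a, b, w}
  simple : ∀ a b a' b' x, (a, b) ∈ E → (a', b') ∈ E → x ∈ segment ℝ a b → x ≠ b →
    x ∈ segment ℝ a' b' → x ≠ b' → (a, b) = (a', b')
  compact : IsCompact K.space
  compl : IsPreconnected K.spaceᶜ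
  frontier_subset : frontier K.space ⊆ {x | ∃ a b, (a, b) ∈ E ∧ x ∈ segment ℝ a b}

theorem IsTiling.segment_subset {Bi : Plane → Plane → Prop} {E : Set (Plane × Plane)}
    {K : SimplicialComplex ℝ Plane} (hK : IsTiling Bi E K) (h : (a, b) ∈ E) :
    segment ℝ a b ⊆ K.space := by
  obtain ⟨s, hs, w, hsw, -⟩ := hK.side_face a b h
  refine (segment_subset_triangle a b w).trans ?_
  rw [← hsw]; exact SimplicialComplex.convexHull_subset_space hs

theorem space_of_faces_eq {K K' : SimplicialComplex ℝ Plane} {t : Finset Plane} (ht : t.Nonempty)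
    (h : K'.faces = K.faces ∪ {s | s ⊆ t ∧ s.Nonempty}) :
    K'.space = K.space ∪ convexHull ℝ t ∧ K'.vertices = K.vertices ∪ t := by
  constructor
  · ext x
    simp only [SimplicialComplex.mem_space_iff, h, Set.mem_union]
    constructor
    · rintro ⟨s, hs | ⟨hs, -⟩, hx⟩
      · exact Or.inl ⟨s, hs, hx⟩
      · exact Or.inr (convexHull_mono hs hx)
    · rintro (⟨s, hs, hx⟩ | hx)
      · exact ⟨s, Or.inl hs, hx⟩
      · exact ⟨t, Or.inr ⟨subset_rfl, ht⟩, hx⟩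
  · ext x
    simp [SimplicialComplex.mem_vertices, h]

theorem IsTiling.triangle {Bi : Plane → Plane → Prop} (h : 0 < orient i a b c) :
    ∃ K : SimplicialComplex ℝ Plane, K.vertices = {a, b, c} ∧ K.space = convexHull ℝ {a, b, c} ∧
      IsTiling Bi {(a, b), (b, c), (c, a)} K := by
  obtain ⟨t, ht, hti⟩ := exists_finset_triple h.ne'
  obtain ⟨K, hK⟩ := exists_complex_union ⊥ t hti (fun s hs => absurd hs (Set.notMem_empty _))
  have htn : t.Nonempty := by rw [← Finset.coe_nonempty, ht]; simp
  obtain ⟨hsp, hv⟩ := space_of_faces_eq htn hK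
  have hbot : (⊥ : SimplicialComplex ℝ Plane).faces = ∅ := rfl
  have h0 : (⊥ : SimplicialComplex ℝ Plane).space = ∅ := by
    ext x; simp [SimplicialComplex.mem_space_iff, hbot]
  have h1 : (⊥ : SimplicialComplex ℝ Plane).vertices = ∅ := by
    ext x; simp [SimplicialComplex.mem_vertices, hbot]
  rw [h0, Set.empty_union, ht] at hsp
  rw [h1, Set.empty_union, ht] at hv
  have htK : t ∈ K.faces := by rw [hK]; exact Or.inr ⟨subset_rfl, htn⟩
  have hbc : 0 < orient i b c a := by rwa [← orient_rotate]
  have hca : 0 < orient i c a b := by rwa [orient_rotate]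
  refine ⟨K, hv, hsp, ?_, ?_, ?_, ?_, ?_, ?_⟩
  · rintro x y hxy ⟨s, hs, hsxy⟩
    rw [hK, hbot, Set.empty_union] at hs
    have h2 : ({x, y} : Set Plane) ⊆ {a, b, c} := by rw [← hsxy, ← ht]; exact_mod_cast hs.1
    have hx : x ∈ ({a, b, c} : Set Plane) := h2 (by simp)
    have hy : y ∈ ({a, b, c} : Set Plane) := h2 (by simp)
    simp only [Set.mem_insert_iff, Set.mem_singleton_iff] at hx hy
    rcases hx with rfl | rfl | rfl <;> rcases hy with rfl | rfl | rfl <;>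
      first
        | exact absurd rfl hxy
        | exact Or.inl (Or.inl rfl)
        | exact Or.inl (Or.inr (Or.inl rfl))
        | exact Or.inl (Or.inr (Or.inr rfl))
        | exact Or.inr (Or.inl (Or.inl rfl))
        | exact Or.inr (Or.inl (Or.inr (Or.inl rfl)))
        | exact Or.inr (Or.inl (Or.inr (Or.inr rfl)))
  · intro x y hxy
    refine ⟨t, htK, ?_⟩
    have hnc : ¬ Collinear ℝ {a, b, c} := by rw [collinear_iff_orient i]; exact h.ne'
    rw [ht]
    simp only [Set.mem_insert_iff, Set.mem_singleton_iff, Prod.mk.injEq] at hxy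
    rcases hxy with ⟨rfl, rfl⟩ | ⟨rfl, rfl⟩ | ⟨rfl, rfl⟩
    · exact ⟨c, rfl, hnc⟩
    · exact ⟨a, triangle_rotate _ _ _, by rwa [← triangle_rotate]⟩
    · exact ⟨b, (triangle_rotate _ _ _).symm, by rwa [triangle_rotate]⟩
  · intro a₁ b₁ a₂ b₂ x h1 h2 hx1 hx1' hx2 hx2'
    simp only [Set.mem_insert_iff, Set.mem_singleton_iff, Prod.mk.injEq] at h1 h2
    rcases h1 with ⟨rfl, rfl⟩ | ⟨rfl, rfl⟩ | ⟨rfl, rfl⟩ <;>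
      rcases h2 with ⟨rfl, rfl⟩ | ⟨rfl, rfl⟩ | ⟨rfl, rfl⟩
    · rfl
    · exact absurd (eq_of_mem_segments h.ne' hx1 hx2) hx1'
    · exact absurd (eq_of_mem_segments hca.ne' hx2 hx1) hx2'
    · exact absurd (eq_of_mem_segments h.ne' hx2 hx1) hx2'
    · rfl
    · exact absurd (eq_of_mem_segments hbc.ne' hx1 hx2) hx1'
    · exact absurd (eq_of_mem_segments hca.ne' hx1 hx2) hx1'
    · exact absurd (eq_of_mem_segments hbc.ne' hx2 hx1) hx2'
    · rfl
  · rw [hsp]; exact isCompact_triangle a b c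
  · rw [hsp]; exact isPreconnected_compl_triangle h
  · rw [hsp]
    intro x hx
    rcases frontier_triangle_subset h hx with (h | h) | h
    · exact ⟨a, b, by simp, h⟩
    · exact ⟨b, c, by simp, h⟩
    · exact ⟨c, a, by simp, h⟩

/-- Gluing a triangle along a side of a triangulated region. -/
theorem IsTiling.insertTriangle {Bi : Plane → Plane → Prop} {E : Set (Plane × Plane)}
    {K : SimplicialComplex ℝ Plane} (hK : IsTiling Bi E K) (huv : (u, v) ∈ E)
    (h : 0 < orient i u v p) (hT : convexHull ℝ {u, v, p} ∩ K.space ⊆ segment ℝ u v)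
    (hBi : Bi u v) (hBi' : Bi v u) :
    ∃ K' : SimplicialComplex ℝ Plane, K'.vertices = insert p K.vertices ∧
      K'.space = K.space ∪ convexHull ℝ {u, v, p} ∧
      IsTiling Bi (insert (u, p) (insert (p, v) (E \ {(u, v)}))) K' := by
  classical
  obtain ⟨t, ht, hti⟩ := exists_finset_triple h.ne'
  obtain ⟨e, heK, w, he, hw⟩ := hK.side_face u v huv
  have hsub : segment ℝ u v ⊆ K.space := hK.segment_subset huv
  have hvp : 0 < orient i v p u := by rwa [← orient_rotate]
  have hpu : 0 < orient i p u v := by rwa [orient_rotate]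
  have hne : u ≠ v := by rintro rfl; simp at h
  have hup : u ≠ p := by rintro rfl; simp at h
  have hvp' : v ≠ p := by rintro rfl; simp at h
  have hf : ({u, v} : Finset Plane) ∈ K.faces :=
    K.down_closed heK (by rw [← Finset.coe_subset, he]; simp; grind) (by simp)
  have hglue : ∀ s ∈ K.faces, convexHull ℝ (s : Set Plane) ∩ convexHull ℝ t ⊆
      convexHull ℝ (s ∩ t : Set Plane) := by
    rintro s hs x ⟨hx1, hx2⟩
    rw [ht] at hx2
    have hx3 := hT ⟨hx2, SimplicialComplex.convexHull_subset_space hs hx1⟩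
    have := K.inter_subset_convexHull hs hf ⟨hx1, by simpa [convexHull_pair] using hx3⟩
    refine convexHull_mono ?_ this
    rw [ht]; simp; grind
  obtain ⟨K', hK'⟩ := exists_complex_union K t hti hglue
  have htn : t.Nonempty := by rw [← Finset.coe_nonempty, ht]; simp
  obtain ⟨hsp, hv⟩ := space_of_faces_eq htn hK'
  have htK : t ∈ K'.faces := by rw [hK']; exact Or.inr ⟨subset_rfl, htn⟩
  rw [ht] at hsp hv
  have huV : u ∈ K.vertices := K.down_closed hf (by simp) (by simp)
  have hvV : v ∈ K.vertices := K.down_closed hf (by simp) (by simp)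
  -- The new sides touch the old region only at `u` and at `v`. Hence they cannot cross old sides,
  -- `p` is new, and the polygon stays simple.
  have hup_inter : ∀ x ∈ segment ℝ u p, x ∈ K.space → x = u := fun x hx hxK =>
    eq_of_mem_segments hpu.ne' (by rwa [segment_symm]) (hT ⟨by
      rw [triangle_rotate, triangle_rotate]; exact segment_subset_triangle p u v
        (by rwa [segment_symm]), hxK⟩)
  have hpv_inter : ∀ x ∈ segment ℝ p v, x ∈ K.space → x = v := fun x hx hxK =>
    eq_of_mem_segments h.ne' (hT ⟨by
      rw [triangle_rotate]; exact segment_subset_triangle v p u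
        (by rwa [segment_symm]), hxK⟩) (by rwa [segment_symm])
  have hpK : p ∉ K.space := fun hk => hvp' (hpv_inter p (left_mem_segment _ _ _) hk).symm
  refine ⟨K', ?_, hsp, ?_, ?_, ?_, ?_, ?_, ?_⟩
  · rw [hv]; ext z; simp only [Set.mem_union, Set.mem_insert_iff, Set.mem_singleton_iff]
    constructor
    · rintro (k | rfl | rfl | rfl) <;> tauto
    · tauto
  · rintro x y hxy ⟨s, hs, hsxy⟩
    rw [hK'] at hs
    rcases hs with hs | ⟨hs, -⟩
    · rcases hK.edge_face x y hxy ⟨s, hs, hsxy⟩ with h1 | h1 | h1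
      · by_cases h2 : (x, y) = (u, v)
        · cases h2; exact Or.inr (Or.inr hBi)
        · exact Or.inl (Or.inr (Or.inr ⟨h1, h2⟩))
      · by_cases h2 : (y, x) = (u, v)
        · cases h2; exact Or.inr (Or.inr hBi')
        · exact Or.inr (Or.inl (Or.inr (Or.inr ⟨h1, h2⟩)))
      · exact Or.inr (Or.inr h1)
    · have h2 : ({x, y} : Set Plane) ⊆ {u, v, p} := by rw [← hsxy, ← ht]; exact_mod_cast hs
      have hx : x ∈ ({u, v, p} : Set Plane) := h2 (by simp)
      have hy : y ∈ ({u, v, p} : Set Plane) := h2 (by simp)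
      simp only [Set.mem_insert_iff, Set.mem_singleton_iff] at hx hy
      rcases hx with rfl | rfl | rfl <;> rcases hy with rfl | rfl | rfl <;>
        first
          | exact absurd rfl hxy
          | exact Or.inr (Or.inr hBi)
          | exact Or.inr (Or.inr hBi')
          | exact Or.inl (Or.inl rfl)
          | exact Or.inl (Or.inr (Or.inl rfl))
          | exact Or.inr (Or.inl (Or.inl rfl))
          | exact Or.inr (Or.inl (Or.inr (Or.inl rfl)))
  · have hnc : ¬ Collinear ℝ {u, v, p} := by rw [collinear_iff_orient i]; exact h.ne'
    intro x y hxy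
    rcases hxy with hxy | hxy | hxy
    · cases hxy
      refine ⟨t, htK, v, ?_, ?_⟩
      · rw [ht]; ext; simp; tauto
      · convert hnc using 2; ext; simp; tauto
    · cases hxy
      refine ⟨t, htK, u, ?_, ?_⟩
      · rw [ht]; ext; simp; tauto
      · convert hnc using 2; ext; simp; tauto
    · obtain ⟨s, hs, w', h1, h2⟩ := hK.side_face x y hxy.1
      exact ⟨s, by rw [hK']; exact Or.inl hs, w', h1, h2⟩
  · have hA : ∀ a b x, (a, b) ∈ E \ {(u, v)} → x ∈ segment ℝ u p → x ≠ p → x ∈ segment ℝ a b →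
        x = b := by
      intro a b x hab hx1 hx2 hx3
      by_contra hxb
      obtain rfl := hup_inter x hx1 (hK.segment_subset hab.1 hx3)
      exact hab.2 (hK.simple a b x v x hab.1 huv hx3 hxb (left_mem_segment _ _ _) hne)
    have hB : ∀ a b x, (a, b) ∈ E → x ∈ segment ℝ p v → x ≠ v → x ∉ segment ℝ a b := by
      intro a b x hab hx1 hx2 hx3
      exact hx2 (hpv_inter x hx1 (hK.segment_subset hab hx3))
    have hC : ∀ x, x ∈ segment ℝ u p → x ∈ segment ℝ p v → x = p := fun x h1 h2 =>
      eq_of_mem_segments (c := v) (i := i) (by rw [orient_swap]; linarith) h1 h2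
    intro a₁ b₁ a₂ b₂ x h1 h2 hx1 hx1' hx2 hx2'
    rcases h1 with h1 | h1 | h1 <;> rcases h2 with h2 | h2 | h2
    · rw [h1, h2]
    · cases h1; cases h2; exact absurd (hC x hx1 hx2) hx1'
    · cases h1; exact absurd (hA _ _ _ h2 hx1 hx1' hx2) hx2'
    · cases h1; cases h2; exact absurd (hC x hx2 hx1) hx2'
    · rw [h1, h2]
    · cases h1; exact absurd hx2 (hB _ _ _ h2.1 hx1 hx1')
    · cases h2; exact absurd (hA _ _ _ h1 hx2 hx2' hx1) hx1'
    · cases h2; exact absurd hx1 (hB _ _ _ h1.1 hx2 hx2')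
    · exact hK.simple a₁ b₁ a₂ b₂ x h1.1 h2.1 hx1 hx1' hx2 hx2'
  · rw [hsp]; exact hK.compact.union (isCompact_triangle u v p)
  · rw [hsp]
    exact isPreconnected_compl_union_triangle h hK.compact.isClosed hK.compl hsub hT
  · rw [hsp]
    intro x hx
    have hTc := (isCompact_triangle u v p).isClosed
    have hxMT := (hK.compact.isClosed.union hTc).frontier_subset hx
    by_contra hcon
    have hup' : x ∉ segment ℝ u p := fun k => hcon ⟨u, p, by simp, k⟩
    have hpv' : x ∉ segment ℝ p v := fun k => hcon ⟨p, v, by simp, k⟩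
    have hE' : ∀ a b, (a, b) ∈ E → (a, b) ≠ (u, v) → x ∉ segment ℝ a b := fun a b h1 h2 k =>
      hcon ⟨a, b, Or.inr (Or.inr ⟨h1, h2⟩), k⟩
    have hxu : x ≠ u := by rintro rfl; exact hup' (left_mem_segment _ _ _)
    have hxv : x ≠ v := by rintro rfl; exact hpv' (right_mem_segment _ _ _)
    apply hx.2
    rw [mem_interior_iff_mem_nhds]
    by_cases hxT : x ∈ convexHull ℝ {u, v, p}
    · by_cases hxM : x ∈ K.space
      · have hxs := hT ⟨hxT, hxM⟩
        -- The old triangle at the side `u v` lies across from `p`. Were its third vertex `w` on the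
        -- same side, both triangles would contain points near `x` off the line, contrary to `hT`.
        have hwn : orient i u v w < 0 := by
          rcases lt_trichotomy (orient i u v w) 0 with h1 | h1 | h1
          · exact h1
          · rw [← collinear_iff_orient] at h1; exact absurd h1 hw
          · exfalso
            obtain ⟨y1, y2⟩ := orient_pos_of_mem_openSegment h hxs hxu hxv
            obtain ⟨z1, z2⟩ := orient_pos_of_mem_openSegment h1 hxs hxu hxv
            have hO := (((isOpen_orient_pos i v p).inter (isOpen_orient_pos i p u)).inter
              ((isOpen_orient_pos i v w).inter (isOpen_orient_pos i w u))).mem_nhds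
              (show x ∈ _ from ⟨⟨y1, y2⟩, z1, z2⟩)
            have hcl : x ∈ closure {z | orient i v u z < 0} := mem_closure_orient_neg
              (by rw [orient_swap, orient_eq_zero_of_mem_segment hxs, neg_zero])
              (show 0 < orient i v u (v + u - p) by
                have : orient i v u (v + u - p) = orient i u v p := by simp [orient]; ring
                linarith)
            obtain ⟨z, ⟨⟨k1, k2⟩, k3, k4⟩, k5⟩ := mem_closure_iff_nhds.1 hcl _ hO
            simp only [Set.mem_ofPred_eq] at k1 k2 k3 k4 k5
            rw [orient_swap] at k5
            have hz1 : z ∈ convexHull ℝ {u, v, p} :=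
              (mem_triangle_iff h).2 ⟨by linarith, k1.le, k2.le⟩
            have hz2 : z ∈ K.space := by
              apply SimplicialComplex.convexHull_subset_space heK
              rw [he]
              exact (mem_triangle_iff h1).2 ⟨by linarith, k3.le, k4.le⟩
            have := orient_eq_zero_of_mem_segment (i := i) (hT ⟨hz1, hz2⟩)
            linarith
        refine Filter.mem_of_superset (union_triangles_mem_nhds h hwn hxs hxu hxv) ?_
        rw [Set.union_comm]
        refine Set.union_subset_union_left _ ?_
        rw [← he]; exact SimplicialComplex.convexHull_subset_space heK
      · have hxi : x ∈ interior (convexHull ℝ {u, v, p}) := by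
          by_contra hni
          rcases frontier_triangle_subset h ⟨subset_closure hxT, hni⟩ with (k | k) | k
          · exact hxM (hsub k)
          · exact hpv' (by rwa [segment_symm])
          · exact hup' (by rwa [segment_symm])
        exact Filter.mem_of_superset (mem_interior_iff_mem_nhds.1 hxi) Set.subset_union_right
    · have hxM : x ∈ K.space := hxMT.resolve_right hxT
      have hxi : x ∈ interior K.space := by
        by_contra hni
        obtain ⟨a, b, hab, hxab⟩ := hK.frontier_subset ⟨subset_closure hxM, hni⟩
        by_cases heq : (a, b) = (u, v)
        · cases heq; exact hxT (segment_subset_triangle u v p hxab)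
        · exact hE' a b hab heq hxab
      exact Filter.mem_of_superset (mem_interior_iff_mem_nhds.1 hxi) Set.subset_union_left

end tiling

/-! ### Polygons as cyclic lists of vertices -/

section lists

open Geometry

variable {i : Fin 2} {a b p q r x : Plane} {l l₁ l₂ t : List Plane} {Bi : Plane → Plane → Prop}

/-- The ordered pairs of consecutive entries of a list. -/
def links : List Plane → Set (Plane × Plane)
  | a :: b :: l => insert (a, b) (links (b :: l))
  | _ => ∅

/-- The ordered pairs of cyclically consecutive entries of a list. -/
def cycSides : List Plane → Set (Plane × Plane)
  | [] => ∅
  | a :: l => links (a :: l ++ [a])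

@[simp] theorem links_singleton : links [a] = ∅ := rfl

theorem links_cons_cons : links (a :: b :: l) = insert (a, b) (links (b :: l)) := rfl

theorem links_append (l₁ l₂ : List Plane) (x : Plane) :
    links (l₁ ++ x :: l₂) = links (l₁ ++ [x]) ∪ links (x :: l₂) := by
  induction l₁ with
  | nil => simp
  | cons a l₁ ih =>
    cases l₁ with
    | nil => simp [links_cons_cons]
    | cons b l₁ =>
      simp only [List.cons_append, links_cons_cons] at ih ⊢
      rw [ih, Set.insert_union]

theorem mem_of_mem_links (h : (a, b) ∈ links (x :: l)) : b ∈ l := by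
  induction l generalizing x with
  | nil => exact h.elim
  | cons y l ih =>
    rw [links_cons_cons] at h
    rcases h with h | h
    · cases h; simp
    · exact List.mem_cons_of_mem _ (ih h)

theorem cycSides_append_comm (l₁ l₂ : List Plane) :
    cycSides (l₁ ++ l₂) = cycSides (l₂ ++ l₁) := by
  cases l₁ with
  | nil => simp
  | cons a l₁ =>
    cases l₂ with
    | nil => simp
    | cons b l₂ =>
      have h1 := links_append (a :: l₁) (l₂ ++ [a]) b
      have h2 := links_append (b :: l₂) (l₁ ++ [b]) a
      simp only [cycSides, List.cons_append, List.append_assoc] at h1 h2 ⊢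
      rw [h1, h2, Set.union_comm]

theorem cycSides_closing (r q : Plane) (t : List Plane) :
    cycSides (r :: t ++ [q]) = insert (q, r) (links (r :: t ++ [q])) := by
  have := links_append (r :: t) [r] q
  simp only [cycSides, List.cons_append, List.append_assoc, List.nil_append] at this ⊢
  rw [this, links_cons_cons, links_singleton, Set.union_comm]
  simp

/-- Without repetitions the pair `(q, r)` occurs only as the closing side, so deleting it removes
that side alone. The remaining consecutive pairs are untouched. -/
theorem cycSides_append_singleton (hl : (r :: t ++ [q]).Nodup) (p : Plane) :
    cycSides (r :: t ++ [q, p]) =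
      insert (q, p) (insert (p, r) (cycSides (r :: t ++ [q]) \ {(q, r)})) := by
  have hn : (q, r) ∉ links (r :: t ++ [q]) := fun h => by
    have := mem_of_mem_links (l := t ++ [q]) (by simpa using h)
    simp only [List.cons_append, List.nodup_cons] at hl
    exact hl.1 this
  have h1 := cycSides_closing r p (t ++ [q])
  have h2 := links_append (r :: t) [p] q
  simp only [List.cons_append, List.append_assoc, List.nil_append] at h1 h2 hn ⊢
  have h3 := cycSides_closing r q t
  simp only [List.cons_append] at h3
  rw [h1, h2, h3, Set.insert_sdiff_of_mem _ (by simp), Set.sdiff_singleton_eq_self hn, links_cons_cons,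
    links_singleton]
  ext e; simp; tauto

/-- `K` triangulates the region bounded by the simple closed polygon with vertex list `l`, and all
edges of `K` which are not sides satisfy `Bi`. -/
structure IsPolygonTiling (Bi : Plane → Plane → Prop) (l : List Plane)
    (K : SimplicialComplex ℝ Plane) : Prop where
  nodup : l.Nodup
  vertices_eq : K.vertices = {x | x ∈ l}
  tiling : IsTiling Bi (cycSides l) K

theorem IsPolygonTiling.rotate {K : SimplicialComplex ℝ Plane}
    (h : IsPolygonTiling Bi (l₁ ++ l₂) K) : IsPolygonTiling Bi (l₂ ++ l₁) K where
  nodup := List.nodup_append_comm.1 h.nodup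
  vertices_eq := by rw [h.vertices_eq]; ext; simp [or_comm]
  tiling := by rw [cycSides_append_comm]; exact h.tiling

theorem IsPolygonTiling.triangle (h : 0 < orient i a b p) :
    ∃ K : SimplicialComplex ℝ Plane, IsPolygonTiling Bi [a, b, p] K ∧
      K.space = convexHull ℝ {a, b, p} := by
  obtain ⟨K, hv, hs, hK⟩ := IsTiling.triangle (Bi := Bi) h
  refine ⟨K, ⟨?_, ?_, ?_⟩, hs⟩
  · have h1 : a ≠ b := by rintro rfl; simp at h
    have h2 : a ≠ p := by rintro rfl; simp at h
    have h3 : b ≠ p := by rintro rfl; simp at h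
    simp [h1, h2, h3]
  · rw [hv]; ext; simp
  · convert hK using 1
    simp [cycSides, links_cons_cons]

/-- Gluing is only formulated at the closing side; `IsPolygonTiling.rotate` brings any other side
into this position. -/
theorem IsPolygonTiling.insertVertex {K : SimplicialComplex ℝ Plane}
    (hK : IsPolygonTiling Bi (r :: t ++ [q]) K) (h : 0 < orient i q r p)
    (hT : convexHull ℝ {q, r, p} ∩ K.space ⊆ segment ℝ q r) (hBi : Bi q r) (hBi' : Bi r q) :
    ∃ K' : SimplicialComplex ℝ Plane, IsPolygonTiling Bi (r :: t ++ [q, p]) K' ∧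
      K'.space = K.space ∪ convexHull ℝ {q, r, p} := by
  have hqr : (q, r) ∈ cycSides (r :: t ++ [q]) := by rw [cycSides_closing]; simp
  obtain ⟨K', hv, hs, hK'⟩ := hK.tiling.insertTriangle hqr h hT hBi hBi'
  have hpK : p ∉ r :: t ++ [q] := by
    intro hp
    have h1 : p ∈ K.vertices := by rw [hK.vertices_eq]; exact hp
    have h2 := hT ⟨subset_convexHull ℝ _ (by simp), SimplicialComplex.vertices_subset_space h1⟩
    rw [orient_eq_zero_of_mem_segment h2] at h
    exact lt_irrefl _ h
  refine ⟨K', ⟨?_, ?_, ?_⟩, hs⟩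
  · have : r :: t ++ [q, p] = (r :: t ++ [q]) ++ [p] := by simp
    rw [this]
    refine List.nodup_append_comm.1 ?_
    simpa using ⟨by simpa using hpK, by simpa using hK.nodup⟩
  · rw [hv, hK.vertices_eq]; ext; simp; tauto
  · rwa [cycSides_append_singleton hK.nodup]

theorem mem_links_iff : (a, b) ∈ links l ↔ ∃ k, ∃ h : k + 1 < l.length, l[k] = a ∧ l[k + 1] = b := by
  induction l with
  | nil => simp [links]
  | cons x l ih =>
    cases l with
    | nil => simp
    | cons y l =>
      rw [links_cons_cons, Set.mem_insert_iff, ih]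
      constructor
      · rintro (h | ⟨k, hk, h1, h2⟩)
        · cases h; exact ⟨0, by simp, by simp⟩
        · exact ⟨k + 1, by simpa using hk, by simpa using ⟨h1, h2⟩⟩
      · rintro ⟨k, hk, h1, h2⟩
        cases k with
        | zero => left; simp at h1 h2; simp [h1, h2]
        | succ k => exact Or.inr ⟨k, by simpa using hk, by simpa using h1, by simpa using h2⟩

theorem mem_cycSides_iff : (a, b) ∈ cycSides l ↔
    ∃ k : Fin l.length, closedPolyline l k = a ∧ closedPolyline l (finRotate _ k) = b := by
  cases l with
  | nil => simp [cycSides]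
  | cons x l =>
    have key : ∀ k : Fin (l.length + 1), ∀ h : (k : ℕ) + 1 < (x :: l ++ [x]).length,
        (x :: l ++ [x])[(k : ℕ)] = closedPolyline (x :: l) k ∧ (x :: l ++ [x])[(k : ℕ) + 1] =
          closedPolyline (x :: l) (finRotate (l.length + 1) k) := by
      intro k h
      refine ⟨?_, ?_⟩
      · rw [List.getElem_append_left (by simpa using Nat.le_of_lt_succ k.2)]; rfl
      · induction k using Fin.lastCases with
        | last =>
          rw [finRotate_last]
          rw [List.getElem_append_right (by simp)]
          simp [closedPolyline]
        | cast k =>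
          rw [finRotate_apply]
          rw [List.getElem_append_left (by simp)]
          simp only [closedPolyline, List.get_eq_getElem]
          congr 1
          simp
    rw [cycSides, mem_links_iff]
    constructor
    · rintro ⟨k, hk, h1, h2⟩
      have hk' : k < l.length + 1 := by simpa using hk
      obtain ⟨e1, e2⟩ := key ⟨k, hk'⟩ hk
      exact ⟨⟨k, hk'⟩, e1.symm.trans h1, e2.symm.trans h2⟩
    · rintro ⟨k, h1, h2⟩
      have hk : (k : ℕ) + 1 < (x :: l ++ [x]).length := by
        have := k.2; simp only [List.length_cons, List.length_append, List.length_nil] at this ⊢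
        omega
      obtain ⟨e1, e2⟩ := key k hk
      exact ⟨k, hk, e1.trans h1, e2.trans h2⟩

theorem boundary_closedPolyline (l : List Plane) : (closedPolyline l).boundary ℝ =
    {x | ∃ a b, (a, b) ∈ cycSides l ∧ x ∈ segment ℝ a b} := by
  ext x
  simp only [Polygon.boundary, Polygon.edgeSet, affineSegment_eq_segment, Set.mem_iUnion,
    Set.mem_ofPred_eq, mem_cycSides_iff]
  constructor
  · rintro ⟨k, hk⟩
    exact ⟨_, _, ⟨k, rfl, rfl⟩, hk⟩
  · rintro ⟨a, b, ⟨k, rfl, rfl⟩, hk⟩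
    exact ⟨k, hk⟩

theorem IsPolygonTiling.isSimple {K : SimplicialComplex ℝ Plane} (h : IsPolygonTiling Bi l K) :
    (closedPolyline l).IsSimple := by
  intro j k s hs t ht he
  have hmem : ∀ j : Fin l.length,
      (closedPolyline l j, closedPolyline l (finRotate _ j)) ∈ cycSides l :=
    fun j => mem_cycSides_iff.2 ⟨j, rfl, rfl⟩
  have hne : ∀ j : Fin l.length, closedPolyline l j ≠ closedPolyline l (finRotate _ j) := by
    intro j hj
    obtain ⟨_, _, w, _, hw⟩ := h.tiling.side_face _ _ (hmem j)
    rw [← hj] at hw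
    exact hw (by simpa using collinear_pair ℝ (closedPolyline l j) w)
  have hseg : ∀ j : Fin l.length, ∀ s ∈ Set.Ico (0 : ℝ) 1,
      (closedPolyline l).edgePath ℝ j s ∈
        segment ℝ (closedPolyline l j) (closedPolyline l (finRotate _ j)) ∧
      (closedPolyline l).edgePath ℝ j s ≠ closedPolyline l (finRotate _ j) := by
    intro j s hs
    constructor
    · rw [← affineSegment_eq_segment]; exact ⟨s, ⟨hs.1, hs.2.le⟩, rfl⟩
    · intro hc
      rw [Polygon.edgePath, AffineMap.lineMap_eq_right_iff] at hc
      rcases hc with hc | hc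
      · exact hne j hc
      · exact hs.2.ne hc
  obtain ⟨h1, h1'⟩ := hseg j s hs
  obtain ⟨h2, h2'⟩ := hseg k t ht
  rw [← he] at h2 h2'
  have := h.tiling.simple _ _ _ _ _ (hmem j) (hmem k) h1 h1' h2 h2'
  have hjk : j = k := List.nodup_iff_injective_get.1 h.nodup (Prod.ext_iff.1 this).1
  subst hjk
  exact ⟨rfl, AffineMap.lineMap_injective ℝ (hne j) he⟩

/-- The invariants of `IsTiling` are exactly what `eq_union_bounded_components` needs, with the
polygon as `D`. -/
theorem IsPolygonTiling.isTriangulation {K : SimplicialComplex ℝ Plane}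
    (h : IsPolygonTiling Bi l K) : (closedPolyline l).IsTriangulation K := by
  constructor
  · rw [h.vertices_eq]
    ext x
    exact List.mem_iff_get
  · have := h.tiling.frontier_subset
    rw [← boundary_closedPolyline] at this
    refine eq_union_bounded_components h.tiling.compact ?_ this h.tiling.compl
    rw [boundary_closedPolyline]
    rintro x ⟨a, b, hab, hx⟩
    exact h.tiling.segment_subset hab hx

theorem IsPolygonTiling.of_isDiagonalOf {K : SimplicialComplex ℝ Plane}
    (h : IsPolygonTiling Bi l K) (hd : (closedPolyline l).IsDiagonalOf K a b) : Bi a b := by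
  obtain ⟨hne, hf, hs⟩ := hd
  rcases h.tiling.edge_face a b hne hf with h1 | h1 | h1
  · obtain ⟨k, rfl, rfl⟩ := mem_cycSides_iff.1 h1
    exact absurd ⟨k, rfl⟩ hs
  · obtain ⟨k, rfl, rfl⟩ := mem_cycSides_iff.1 h1
    exact absurd ⟨k, Sym2.eq_swap⟩ hs
  · exact h1

end lists

/-! ### Filling a strip between two chains -/

section strip

open Geometry

variable {i : Fin 2} {F Q p q r x : Plane} {t : List Plane} {Bi : Plane → Plane → Prop}

/-- Rotating a line about `q`, there is a first point of `W` that it hits. -/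
theorem exists_first_hit {W : Finset Plane} (hW : W.Nonempty)
    (hpos : ∀ s ∈ W, 0 < orient i q r s)
    (hgen : ∀ s ∈ W, ∀ s' ∈ W, s ≠ s' → orient i q s s' ≠ 0) :
    ∃ p ∈ W, ∀ s ∈ W, s ≠ p → 0 < orient i q p s := by
  obtain ⟨e, he⟩ := hW
  -- On the half-plane beyond `q r` this ratio is monotone in the direction of `s` seen from `q`,
  -- whatever the reference point `e`. Its minimum is the first direction met.
  obtain ⟨p, hp, hmin⟩ := W.exists_min_image (fun s => orient i q e s / orient i q r s) ⟨e, he⟩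
  refine ⟨p, hp, fun s hs hsp => lt_of_le_of_ne ?_ (hgen p hp s hs hsp.symm).symm⟩
  have h1 := hmin s hs
  rw [div_le_div_iff₀ (hpos p hp) (hpos s hs)] at h1
  have h2 := orient_plucker i q e r s p
  have h3 := hpos e he
  rw [orient_swap_right] at h3
  have h4 := orient_swap_right i q s p
  have h5 := orient_swap_right i q s e
  have h6 : 0 ≤ orient i q p s * orient i q r e := by
    rw [orient_swap_right i q r e]; rw [h4, h5] at h2; nlinarith
  exact nonneg_of_mul_nonneg_left h6 (hpos e he)

theorem exists_first_hit' {W : Finset Plane} (hW : W.Nonempty)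
    (hpos : ∀ s ∈ W, 0 < orient i q r s)
    (hgen : ∀ s ∈ W, ∀ s' ∈ W, s ≠ s' → orient i r s s' ≠ 0) :
    ∃ p ∈ W, ∀ s ∈ W, s ≠ p → 0 < orient i p r s := by
  obtain ⟨p, hp, h⟩ := exists_first_hit (i := i + 1) (q := r) (r := q) hW
    (fun s hs => by rw [orient_flip, ← orient_swap]; exact hpos s hs)
    (fun s hs s' hs' hne => by rw [orient_flip]; exact neg_ne_zero.2 (hgen s hs s' hs' hne))
  refine ⟨p, hp, fun s hs hsp => ?_⟩
  have := h s hs hsp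
  rwa [orient_flip, ← orient_swap] at this

/-- Attaching a strip: if the points of `U ∪ V ∪ {Q}` lie beyond the side `q r` of a triangulated
polygon, those of `U` on the side of `q` and those of `V` on the side of `r` of a line through `Q`,
then these points can be inserted between `q` and `r`, first those of `U`, then `Q`, then those
of `V`, so that all new diagonals join the two groups. -/
theorem exists_strip_tiling {S : Set Plane}
    (hgen : ∀ a ∈ S, ∀ b ∈ S, ∀ c ∈ S, a ≠ b → b ≠ c → a ≠ c → orient i a b c ≠ 0)
    (hQS : Q ∈ S) (n : ℕ) :
    ∀ (U V : Finset Plane) (q r : Plane) (t : List Plane) (K : SimplicialComplex ℝ Plane),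
    U.card + V.card = n → q ∈ S → r ∈ S → (U : Set Plane) ⊆ S → (V : Set Plane) ⊆ S →
    IsPolygonTiling Bi (r :: t ++ [q]) K →
    (∀ p ∈ U, 0 < orient i q r p) → (∀ p ∈ V, 0 < orient i q r p) → 0 < orient i q r Q →
    (∀ x ∈ insert q U, 0 < orient i F Q x) → (∀ x ∈ insert r V, orient i F Q x < 0) →
    (∀ x ∈ insert q U, ∀ z ∈ insert r V, 0 < orient i x z Q) →
    (∀ x ∈ insert q U, ∀ z ∈ insert r V, Bi x z ∧ Bi z x) →
    K.space ∩ convexHull ℝ ({q, r, Q} ∪ (U ∪ V)) ⊆ segment ℝ q r →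
    ∃ (u v : List Plane) (K' : SimplicialComplex ℝ Plane), u.Perm U.toList ∧ v.Perm V.toList ∧
      IsPolygonTiling Bi (Q :: v ++ r :: t ++ q :: u) K' ∧
      K'.space ⊆ K.space ∪ convexHull ℝ ({q, r, Q} ∪ (U ∪ V)) := by
  induction n with
  | zero => ?_
  | succ n ih => ?_
  -- This set-up, including `hlast` for the case that only `Q` remains, serves both the base case
  -- and the inductive step.
  all_goals
    intro U V q r t K hn hqS hrS hUS hVS hK hU hV hQ hFU hFV hcor hBi hdisj
    set R := convexHull ℝ (({q, r, Q} : Set Plane) ∪ (U ∪ V)) with hR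
    have hmemR : ∀ p, p ∈ U ∨ p ∈ V ∨ p = Q ∨ p = q ∨ p = r → p ∈ R := by
      intro p hp
      refine subset_convexHull ℝ _ ?_
      rcases hp with h | h | h | h | h
      · exact Or.inr (Or.inl h)
      · exact Or.inr (Or.inr h)
      all_goals left; simp [h]
    have hTR : ∀ p, p ∈ U ∨ p ∈ V ∨ p = Q → convexHull ℝ {q, r, p} ⊆ R := by
      intro p hp
      refine convexHull_min ?_ (convex_convexHull ℝ _)
      rintro z (rfl | rfl | rfl)
      · exact hmemR _ (by simp)
      · exact hmemR _ (by simp)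
      · exact hmemR _ (by tauto)
    have hins : ∀ p, p ∈ U ∨ p ∈ V ∨ p = Q → 0 < orient i q r p →
        ∃ K' : SimplicialComplex ℝ Plane, IsPolygonTiling Bi (r :: t ++ [q, p]) K' ∧
          K'.space = K.space ∪ convexHull ℝ {q, r, p} := by
      intro p hp h
      have := hBi q (by simp) r (by simp)
      exact hK.insertVertex h (fun z hz => hdisj ⟨hz.2, hTR p hp hz.1⟩) this.1 this.2
    have hlast : U = ∅ → V = ∅ → ∃ (u v : List Plane) (K' : SimplicialComplex ℝ Plane),
        u.Perm U.toList ∧ v.Perm V.toList ∧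
        IsPolygonTiling Bi (Q :: v ++ r :: t ++ q :: u) K' ∧ K'.space ⊆ K.space ∪ R := by
      rintro rfl rfl
      obtain ⟨K', hK', hs⟩ := hins Q (by simp) hQ
      refine ⟨[], [], K', by simp, by simp, ?_, ?_⟩
      · exact IsPolygonTiling.rotate (l₁ := r :: t ++ [q]) (l₂ := [Q]) (by simpa using hK')
      · rw [hs]; exact Set.union_subset_union_right _ (hTR Q (by simp))
  · have h1 : U = ∅ := by rw [← Finset.card_eq_zero]; omega
    have h2 : V = ∅ := by rw [← Finset.card_eq_zero]; omega
    exact hlast h1 h2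
  have hne : ∀ p, 0 < orient i q r p → p ≠ q ∧ p ≠ r := by
    intro p hp; constructor <;> rintro rfl <;> simp at hp
  set W : Finset Plane := insert Q (U ∪ V) with hW
  have hWpos : ∀ s ∈ W, 0 < orient i q r s := by
    intro s hs
    simp only [hW, Finset.mem_insert, Finset.mem_union] at hs
    rcases hs with rfl | h | h
    · exact hQ
    · exact hU s h
    · exact hV s h
  have hWS : ∀ s ∈ W, s ∈ S := by
    intro s hs
    simp only [hW, Finset.mem_insert, Finset.mem_union] at hs
    rcases hs with rfl | h | h
    · exact hQS
    · exact hUS h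
    · exact hVS h
  have hWn : W.Nonempty := ⟨Q, by simp [hW]⟩
  -- `p` is hit first about `q`, and `p'` first about `r`. If `p ∈ V`, the triangle `q r p` is glued
  -- and `q p` is the next side; if `p' ∈ U`, the triangle `q r p'` with next side `p' r`. In both
  -- cases the next side again joins the two groups.
  obtain ⟨p, hpW, hp⟩ := exists_first_hit hWn hWpos (fun s hs s' hs' h =>
    hgen q hqS s (hWS s hs) s' (hWS s' hs') (hne s (hWpos s hs)).1.symm h
      (hne s' (hWpos s' hs')).1.symm)
  obtain ⟨p', hpW', hp'⟩ := exists_first_hit' hWn hWpos (fun s hs s' hs' h =>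
    hgen r hrS s (hWS s hs) s' (hWS s' hs') (hne s (hWpos s hs)).2.symm h
      (hne s' (hWpos s' hs')).2.symm)
  have hUW : ∀ z ∈ U, z ∈ W := fun z hz => by simp [hW, hz]
  have hVW : ∀ z ∈ V, z ∈ W := fun z hz => by simp [hW, hz]
  have hQW : Q ∈ W := by simp [hW]
  have hQU : ∀ z ∈ U, z ≠ Q := by
    rintro z hz rfl; simpa using hFU z (by simp [hz])
  have hQV : ∀ z ∈ V, z ≠ Q := by
    rintro z hz rfl; simpa using hFV z (by simp [hz])
  have hUV : ∀ z ∈ U, ∀ z' ∈ V, z ≠ z' := by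
    rintro z hz z' hz' rfl
    have h1 := hFU z (by simp [hz])
    have h2 := hFV z (by simp [hz'])
    linarith
  -- The corner condition `hcor` says that, seen from `q`, each point of `V` is hit before `Q`.
  have hpQ : p = Q → V = ∅ := by
    rintro rfl
    refine Finset.eq_empty_of_forall_notMem fun z hz => ?_
    have h1 := hp z (hVW z hz) (hQV z hz)
    have h2 := hcor q (by simp) z (by simp [hz])
    rw [orient_swap_right] at h2; linarith
  have hpQ' : p' = Q → U = ∅ := by
    rintro rfl
    refine Finset.eq_empty_of_forall_notMem fun z hz => ?_
    have h1 := hp' z (hUW z hz) (hQU z hz)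
    have h2 := hcor z (by simp [hz]) r (by simp)
    rw [← orient_rotate, orient_swap] at h1
    rw [orient_swap_right] at h2
    have h3 := orient_rotate i z p' r
    have h4 := orient_swap i p' z r
    linarith
  by_cases hpV : p ∈ V
  · obtain ⟨K₁, hK₁, hs₁⟩ := hins p (by simp [hpV]) (hV p hpV)
    have hK₂ : IsPolygonTiling Bi (p :: (r :: t) ++ [q]) K₁ :=
      IsPolygonTiling.rotate (l₁ := r :: t ++ [q]) (l₂ := [p]) (by simpa using hK₁)
    have hsub : convexHull ℝ (({q, p, Q} : Set Plane) ∪ (U ∪ (V.erase p : Finset Plane))) ⊆ R := by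
      refine convexHull_min ?_ (convex_convexHull ℝ _)
      rintro z ((rfl | rfl | rfl) | h | h)
      · exact hmemR _ (by simp)
      · exact hmemR _ (by simp [hpV])
      · exact hmemR _ (by simp)
      · exact hmemR _ (by have : z ∈ U := h; simp [this])
      · exact hmemR _ (by have := Finset.mem_of_mem_erase (Finset.mem_coe.1 h); simp [this])
    have hVe : ∀ z ∈ insert p (V.erase p), z ∈ V := by
      rw [Finset.insert_erase hpV]; exact fun z hz => hz
    obtain ⟨u, v, K', hu, hv, hK', hs'⟩ := ih U (V.erase p) q p (r :: t) K₁
      (by rw [Finset.card_erase_of_mem hpV]; have := Finset.card_pos.2 ⟨p, hpV⟩; omega)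
      hqS (hVS hpV) hUS (fun z hz => hVS (Finset.mem_of_mem_erase hz)) hK₂
      (fun z hz => hp z (hUW z hz) (hUV z hz p hpV))
      (fun z hz => hp z (hVW z (Finset.mem_of_mem_erase hz)) (Finset.ne_of_mem_erase hz))
      (hp Q hQW (hQV p hpV).symm) hFU
      (fun z hz => hFV z (Finset.mem_insert_of_mem (hVe z hz)))
      (fun x hx z hz => hcor x hx z (Finset.mem_insert_of_mem (hVe z hz)))
      (fun x hx z hz => hBi x hx z (Finset.mem_insert_of_mem (hVe z hz)))
      (by
        -- The hull of what remains lies beyond the line `q p` except along `q p`. The added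
        -- triangle, and the only part `q r` of the old region that the hull could meet, lie on the
        -- near side.
        rintro x ⟨hx1, hx2⟩
        refine mem_of_mem_convexHull_of_orient_nonpos (i := i) (g := q) (h := p)
          (convex_segment q p) (fun z hz => orient_eq_zero_of_mem_segment hz) ?_ hx2 ?_
        · rintro z ((rfl | rfl | rfl) | h | h)
          · exact Or.inr (left_mem_segment _ _ _)
          · exact Or.inr (right_mem_segment _ _ _)
          · exact Or.inl (hp z hQW (hQV p hpV).symm)
          · exact Or.inl (hp z (hUW z h) (hUV z h p hpV))
          · exact Or.inl (hp z (hVW z (Finset.mem_of_mem_erase h)) (Finset.ne_of_mem_erase h))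
        · have hr : orient i q p r ≤ 0 := by
            rw [orient_swap_right]; have := hV p hpV; linarith
          rw [hs₁] at hx1
          rcases hx1 with hx1 | hx1
          · have := hdisj ⟨hx1, hsub hx2⟩
            rw [← convexHull_pair] at this
            refine orient_nonpos_of_mem_convexHull ?_ this
            rintro z (rfl | rfl) <;> simp [hr]
          · refine orient_nonpos_of_mem_convexHull ?_ hx1
            rintro z (rfl | rfl | rfl) <;> simp [hr])
    refine ⟨u, v ++ [p], K', hu, ?_, by simpa using hK', ?_⟩
    · refine (List.perm_append_comm.trans ?_).trans (Finset.toList_insert (Finset.notMem_erase p V)).symm |>.trans ?_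
      · exact hv.cons p
      · rw [Finset.insert_erase hpV]
    · rw [hs₁] at hs'
      refine hs'.trans (Set.union_subset (Set.union_subset_union_right _ (hTR p (by simp [hpV]))) ?_)
      exact hsub.trans Set.subset_union_right
  by_cases hpU : p' ∈ U
  · obtain ⟨K₁, hK₁, hs₁⟩ := hins p' (by simp [hpU]) (hU p' hpU)
    have hK₂ : IsPolygonTiling Bi (r :: (t ++ [q]) ++ [p']) K₁ := by simpa using hK₁
    have hsub : convexHull ℝ (({p', r, Q} : Set Plane) ∪ ((U.erase p' : Finset Plane) ∪ V)) ⊆ R := by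
      refine convexHull_min ?_ (convex_convexHull ℝ _)
      rintro z ((rfl | rfl | rfl) | h | h)
      · exact hmemR _ (by simp [hpU])
      · exact hmemR _ (by simp)
      · exact hmemR _ (by simp)
      · exact hmemR _ (by have := Finset.mem_of_mem_erase (Finset.mem_coe.1 h); simp [this])
      · exact hmemR _ (by have : z ∈ V := h; simp [this])
    have hUe : ∀ z ∈ insert p' (U.erase p'), z ∈ U := by
      rw [Finset.insert_erase hpU]; exact fun z hz => hz
    obtain ⟨u, v, K', hu, hv, hK', hs'⟩ := ih (U.erase p') V p' r (t ++ [q]) K₁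
      (by rw [Finset.card_erase_of_mem hpU]; have := Finset.card_pos.2 ⟨p', hpU⟩; omega)
      (hUS hpU) hrS (fun z hz => hUS (Finset.mem_of_mem_erase hz)) hVS hK₂
      (fun z hz => hp' z (hUW z (Finset.mem_of_mem_erase hz)) (Finset.ne_of_mem_erase hz))
      (fun z hz => hp' z (hVW z hz) (hUV p' hpU z hz).symm)
      (hp' Q hQW (hQU p' hpU).symm)
      (fun z hz => hFU z (Finset.mem_insert_of_mem (hUe z hz))) hFV
      (fun x hx z hz => hcor x (Finset.mem_insert_of_mem (hUe x hx)) z hz)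
      (fun x hx z hz => hBi x (Finset.mem_insert_of_mem (hUe x hx)) z hz)
      (by
        rintro x ⟨hx1, hx2⟩
        refine mem_of_mem_convexHull_of_orient_nonpos (i := i) (g := p') (h := r)
          (convex_segment p' r) (fun z hz => orient_eq_zero_of_mem_segment hz) ?_ hx2 ?_
        · rintro z ((rfl | rfl | rfl) | h | h)
          · exact Or.inr (left_mem_segment _ _ _)
          · exact Or.inr (right_mem_segment _ _ _)
          · exact Or.inl (hp' z hQW (hQU p' hpU).symm)
          · exact Or.inl (hp' z (hUW z (Finset.mem_of_mem_erase h)) (Finset.ne_of_mem_erase h))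
          · exact Or.inl (hp' z (hVW z h) (hUV p' hpU z h).symm)
        · have hr : orient i p' r q ≤ 0 := by
            rw [orient_rotate, orient_swap]; have := hU p' hpU; linarith
          rw [hs₁] at hx1
          rcases hx1 with hx1 | hx1
          · have := hdisj ⟨hx1, hsub hx2⟩
            rw [← convexHull_pair] at this
            refine orient_nonpos_of_mem_convexHull ?_ this
            rintro z (rfl | rfl) <;> simp [hr]
          · refine orient_nonpos_of_mem_convexHull ?_ hx1
            rintro z (rfl | rfl | rfl) <;> simp [hr])
    refine ⟨p' :: u, v, K', ?_, hv, by simpa using hK', ?_⟩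
    · refine (List.Perm.trans ?_ (Finset.toList_insert (Finset.notMem_erase p' U)).symm).trans ?_
      · exact hu.cons p'
      · rw [Finset.insert_erase hpU]
    · rw [hs₁] at hs'
      refine hs'.trans (Set.union_subset (Set.union_subset_union_right _ (hTR p' (by simp [hpU]))) ?_)
      exact hsub.trans Set.subset_union_right
  have hpc : p = Q ∨ p ∈ U := by
    simp only [hW, Finset.mem_insert, Finset.mem_union] at hpW; tauto
  have hpc' : p' = Q ∨ p' ∈ V := by
    simp only [hW, Finset.mem_insert, Finset.mem_union] at hpW'; tauto
  rcases hpc with rfl | hpU1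
  · have hV0 := hpQ rfl
    have : p' = p := hpc'.resolve_right (by simp [hV0])
    exact hlast (hpQ' this) hV0
  rcases hpc' with rfl | hpV1
  · rw [hpQ' rfl] at hpU1; simp at hpU1
  -- Now `p ∈ U` and `p' ∈ V`. Being first hits, they make `q p` and `r p'` cross, although the line
  -- `F Q` separates these segments.
  exfalso
  have hpp := hUV p hpU1 p' hpV1
  have a1 : orient i q p r < 0 := by rw [orient_swap_right]; have := hU p hpU1; linarith
  have a2 := hp p' hpW' hpp.symm
  have a3 : 0 < orient i r p' q := by rw [← orient_rotate]; exact hV p' hpV1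
  have a4 : orient i r p' p < 0 := by rw [orient_swap]; have := hp' p hpW hpp; linarith
  obtain ⟨z, z1, z2⟩ := exists_mem_segments (i := i) (p := p) (p' := p') (q := q) (r := r)
    (by nlinarith) (by nlinarith) a1.ne
  have b1 := (convex_orient_pos i F Q).segment_subset (hFU q (by simp)) (hFU p (by simp [hpU1])) z1
  have b2 := (convex_orient_neg i F Q).segment_subset (hFV r (by simp)) (hFV p' (by simp [hpV1])) z2
  simp only [Set.mem_ofPred_eq] at b1 b2
  linarith

end strip

/-! ### Position of the points around `F`, and fronts -/

section config

variable {i : Fin 2} {F X Y Z a b c m s w : Plane} {A A' B C : Finset Plane}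

/-- An affine function of `d` is determined by its values at `a`, `b`, `c`. -/
theorem orient_bary (i : Fin 2) (g h a b c d : Plane) :
    orient i g h d * orient i a b c = orient i b c d * orient i g h a +
      orient i c a d * orient i g h b + orient i a b d * orient i g h c := by
  unfold orient; ring

/-- The position of the points relative to the triangle `X Y Z`, oriented counterclockwise, and
the subtriangles with apex `F`. -/
structure Config (i : Fin 2) (F X Y Z : Plane) (A B C : Finset Plane) : Prop where
  XY : 0 < orient i F X Y
  YZ : 0 < orient i F Y Z
  ZX : 0 < orient i F Z X
  hA : ∀ s ∈ A, 0 < orient i F Y s ∧ 0 < orient i F s Z ∧ 0 < orient i Y Z s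
  hB : ∀ s ∈ B, 0 < orient i F Z s ∧ 0 < orient i F s X ∧ 0 < orient i Z X s
  hC : ∀ s ∈ C, 0 < orient i F X s ∧ 0 < orient i F s Y ∧ 0 < orient i X Y s
  gen : ∀ a ∈ ({F, X, Y, Z} : Set Plane) ∪ (A ∪ B ∪ C),
    ∀ b ∈ ({F, X, Y, Z} : Set Plane) ∪ (A ∪ B ∪ C),
    ∀ c ∈ ({F, X, Y, Z} : Set Plane) ∪ (A ∪ B ∪ C), a ≠ b → b ≠ c → a ≠ c → orient i a b c ≠ 0

namespace Config

theorem rotate (h : Config i F X Y Z A B C) : Config i F Y Z X B C A where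
  XY := h.YZ
  YZ := h.ZX
  ZX := h.XY
  hA := h.hB
  hB := h.hC
  hC := h.hA
  gen := by
    have : ({F, Y, Z, X} : Set Plane) ∪ (B ∪ C ∪ A) =
        ({F, X, Y, Z} : Set Plane) ∪ (A ∪ B ∪ C) := by
      ext; simp; tauto
    rw [this]; exact h.gen

/-- The reflection fixing the roles of `X` and `A` and exchanging `Y` with `Z` and `B` with `C`.
With `rotate` it generates all symmetries of the situation. -/
theorem reflect (h : Config i F X Y Z A B C) : Config (i + 1) F X Z Y A C B where
  XY := by rw [orient_flip, ← orient_swap_right]; exact h.ZX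
  YZ := by rw [orient_flip, ← orient_swap_right]; exact h.YZ
  ZX := by rw [orient_flip, ← orient_swap_right]; exact h.XY
  hA := by
    intro s hs
    obtain ⟨h1, h2, h3⟩ := h.hA s hs
    simp only [orient_flip]
    rw [← orient_swap_right, ← orient_swap_right, ← orient_swap]
    exact ⟨h2, h1, h3⟩
  hB := by
    intro s hs
    obtain ⟨h1, h2, h3⟩ := h.hC s hs
    simp only [orient_flip]
    rw [← orient_swap_right, ← orient_swap_right, ← orient_swap]
    exact ⟨h2, h1, h3⟩
  hC := by
    intro s hs
    obtain ⟨h1, h2, h3⟩ := h.hB s hs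
    simp only [orient_flip]
    rw [← orient_swap_right, ← orient_swap_right, ← orient_swap]
    exact ⟨h2, h1, h3⟩
  gen := by
    have : ({F, X, Z, Y} : Set Plane) ∪ (A ∪ C ∪ B) =
        ({F, X, Y, Z} : Set Plane) ∪ (A ∪ B ∪ C) := by
      ext; simp; tauto
    rw [this]
    intro a ha b hb c hc h1 h2 h3
    rw [orient_flip]; exact neg_ne_zero.2 (h.gen a ha b hb c hc h1 h2 h3)

/-- Treats the corner `Y` as a limiting point of `C`; only the inequality towards `Y` becomes weak.
-/
theorem pos_of_C (h : Config i F X Y Z A B C) (hc : c ∈ C ∨ c = Y) :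
    0 < orient i F X c ∧ 0 ≤ orient i F c Y := by
  rcases hc with hc | rfl
  · exact ⟨(h.hC c hc).1, (h.hC c hc).2.1.le⟩
  · exact ⟨h.XY, by simp⟩

theorem pos_of_B (h : Config i F X Y Z A B C) (hb : b ∈ B ∨ b = Z) :
    0 < orient i F b X ∧ 0 ≤ orient i F Z b := by
  rcases hb with hb | rfl
  · exact ⟨(h.hB b hb).2.1, (h.hB b hb).1.le⟩
  · exact ⟨h.ZX, by simp⟩

/-- The angles at the vertex `X`. -/
theorem orient_corner (h : Config i F X Y Z A B C) (hc : c ∈ C ∨ c = Y) (hb : b ∈ B ∨ b = Z) :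
    0 < orient i X c b := by
  obtain ⟨c1, c2⟩ := h.pos_of_C hc
  obtain ⟨b1, b2⟩ := h.pos_of_B hb
  have hXYZ : 0 < orient i X Y Z := by
    have := orient_add_add i X Y Z F
    linarith [h.XY, h.YZ, h.ZX]
  have hXYc : 0 ≤ orient i X Y c := by
    rcases hc with hc | rfl
    · exact (h.hC c hc).2.2.le
    · simp
  have hXbZ : 0 ≤ orient i X b Z := by
    rcases hb with hb | rfl
    · have := (h.hB b hb).2.2
      rw [orient_rotate] at this
      exact this.le
    · simp
  have hXYF : 0 < orient i X Y F := by rw [← orient_rotate]; exact h.XY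
  have hXFZ : 0 < orient i X F Z := by rw [orient_rotate]; exact h.ZX
  have hXcF : 0 < orient i X c F := by rw [← orient_rotate]; exact c1
  have hXFb : 0 < orient i X F b := by rw [orient_rotate]; exact b1
  -- The angular order around `X` is `Y`, `c`, `F`, `b`, `Z`. The first relation compares `c` with
  -- `Z`, and the second then compares `c` with `b`.
  have p1 := orient_plucker i X Y F Z c
  have p2 := orient_plucker i X c F Z b
  have hXcZ : 0 < orient i X c Z := by
    rw [orient_swap_right i X F c, orient_swap_right i X Z Y] at p1
    have e := orient_swap_right i X Z c
    rw [e] at p1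
    by_contra hcon
    nlinarith [mul_pos hXcF hXYZ, mul_nonneg hXYc hXFZ.le]
  rw [orient_swap_right i X Z b, orient_swap_right i X Z c] at p2
  by_contra hcon
  nlinarith [mul_pos hXcZ hXFb, mul_nonneg hXcF.le hXbZ]

end Config

/-- A segment from a point of `C ∪ {Y}` to a point of `B ∪ {Z}` that separates `A` from `F`. -/
structure IsFront (i : Fin 2) (F Y Z : Plane) (A B C : Finset Plane) (c b : Plane) : Prop where
  hc : c ∈ C ∨ c = Y
  hb : b ∈ B ∨ b = Z
  pos : 0 < orient i F c b
  beyond : ∀ s ∈ A, orient i c b s < 0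

namespace IsFront

theorem reflect (hf : IsFront i F Y Z A B C c b) : IsFront (i + 1) F Z Y A C B b c where
  hc := hf.hb
  hb := hf.hc
  pos := by rw [orient_flip, ← orient_swap_right]; exact hf.pos
  beyond := fun s hs => by rw [orient_flip, ← orient_swap]; exact hf.beyond s hs

theorem pos_X (h : Config i F X Y Z A B C) (hf : IsFront i F Y Z A B C c b) :
    0 < orient i c b X := by
  have := orient_add_add i c b X F
  linarith [(h.pos_of_C hf.hc).1, (h.pos_of_B hf.hb).1, hf.pos]

/-- The point `c` is on the line and inside the triangle `F X Y`. As `F` and `X` are on the positive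
side, `Y` must be on the negative one. -/
theorem neg_Y (h : Config i F X Y Z A B C) (hf : IsFront i F Y Z A B C c b) (hc : c ≠ Y) :
    orient i c b Y < 0 := by
  obtain ⟨h1, h2, h3⟩ := h.hC c (hf.hc.resolve_right hc)
  have e := orient_bary i c b F X Y c
  rw [orient_left, zero_mul, ← orient_rotate i F c b] at e
  have h4 := hf.pos_X h
  have h5 := hf.pos
  have h6 := orient_rotate i F c Y
  have h7 := orient_rotate i c Y F
  rw [← h7, ← h6] at e
  by_contra hcon
  nlinarith [mul_pos h3 h5, mul_pos h2 h4]

theorem pos_of_mem_C (h : Config i F X Y Z A B C) (hf : IsFront i F Y Z A B C Y b) (hs : s ∈ C) :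
    0 < orient i Y b s := by
  obtain ⟨h1, h2, h3⟩ := h.hC s hs
  have e := orient_bary i Y b F X Y s
  rw [orient_left, ← orient_rotate i F Y b, ← orient_rotate i F s Y |>.trans (orient_rotate i s Y F)] at e
  have h4 := hf.pos_X h
  have h5 := hf.pos
  have h6 := h.XY
  by_contra hcon
  nlinarith [mul_pos h3 h5, mul_pos h2 h4]

/-- Around `F` the order is `c`, `Y`, `b`, and the angle from `c` to `b` is less than `π`. The set
`A'` is arbitrary because only the positions of `c` and `b` count; this allows the use with `A' = ∅`
before a front is known to exist. -/
theorem Y_b (h : Config i F X Y Z A B C) (hf : IsFront i F Y Z A' B C c b) : 0 < orient i F Y b := by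
  obtain ⟨c1, c2⟩ := h.pos_of_C hf.hc
  obtain ⟨b1, b2⟩ := h.pos_of_B hf.hb
  have := orient_plucker i F c b X Y
  have e := orient_swap_right i F b Y
  rw [e] at this
  by_contra hcon
  nlinarith [mul_pos hf.pos h.XY, mul_nonneg b1.le c2]

/-- Continues the angular order: `s` lies between `Y` and `Z`, and `Z` does not come after `b`. -/
theorem A_b (h : Config i F X Y Z A B C) (hf : IsFront i F Y Z A' B C c b) (hs : s ∈ A) :
    0 < orient i F s b := by
  obtain ⟨h1, h2, h3⟩ := h.hA s hs
  obtain ⟨b1, b2⟩ := h.pos_of_B hf.hb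
  have h4 := hf.Y_b h
  have e := orient_plucker i F Y s Z b
  rw [orient_swap_right i F Z Y] at e
  have h5 := h.YZ
  by_contra hcon
  nlinarith [mul_pos h2 h4, mul_nonneg h1.le b2]

theorem c_A (h : Config i F X Y Z A B C) (hf : IsFront i F Y Z A' B C c b) (hs : s ∈ A) :
    0 < orient i F c s := by
  have := hf.reflect.A_b h.reflect hs
  rwa [orient_flip, ← orient_swap_right] at this

/-- Makes `s` admissible as the new first end of a front. If it failed, `e` would put `s` after `c`,
and then the terms of `e2` could not sum to zero. -/
theorem C_b (h : Config i F X Y Z A B C) (hf : IsFront i F Y Z A B C c b) (hs : s ∈ C ∨ s = Y)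
    (hbs : orient i c b s < 0) : 0 < orient i F s b := by
  obtain ⟨c1, c2⟩ := h.pos_of_C hf.hc
  obtain ⟨s1, s2⟩ := h.pos_of_C hs
  obtain ⟨b1, b2⟩ := h.pos_of_B hf.hb
  have e := orient_add_add i c b s F
  rw [orient_swap_right i F b s, orient_swap_right i F s c] at e
  have h5 := hf.pos
  have e2 := orient_plucker i F c b X s
  rw [orient_swap_right i F b s] at e2
  by_contra hcon
  have h6 : 0 < orient i F c s := by linarith
  nlinarith [mul_pos h5 s1, mul_pos b1 h6]

/-- Points of `C` beyond a front precede the points of `A` in the angular order around `F`. -/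
theorem C_A (h : Config i F X Y Z A B C) (hf : IsFront i F Y Z A B C c b) (hs : s ∈ C)
    (hbs : orient i c b s < 0) (hw : w ∈ A) : 0 < orient i F s w := by
  obtain ⟨w1, w2, w3⟩ := h.hA w hw
  obtain ⟨s1, s2, s3⟩ := h.hC s hs
  obtain ⟨b1, b2⟩ := h.pos_of_B hf.hb
  have h1 := hf.C_b h (Or.inl hs) hbs
  have e := orient_plucker i F s b X Z
  have hsZ : 0 < orient i F s Z := by
    rw [orient_swap_right i F X Z, orient_swap_right i F b Z] at e
    have := h.ZX
    have e1 := orient_swap_right i F X Z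
    by_contra hcon
    nlinarith [mul_pos h1 this, mul_nonneg s1.le b2]
  have e2 := orient_plucker i F Y s Z w
  have e3 := h.YZ
  rw [orient_swap_right i F Y s, orient_swap_right i F Z w, orient_swap_right i F Z Y] at e2
  by_contra hcon
  nlinarith [mul_pos s2 w2, mul_pos hsZ w1]

theorem A_B (h : Config i F X Y Z A B C) (hf : IsFront i F Y Z A B C c b) (hs : s ∈ B)
    (hbs : orient i c b s < 0) (hw : w ∈ A) : 0 < orient i F w s := by
  have := hf.reflect.C_A h.reflect hs (by rw [orient_flip, ← orient_swap]; exact hbs) hw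
  rwa [orient_flip, ← orient_swap_right] at this

/-- Moving the endpoint `c` of a front to a point `w` beyond it increases the fraction at which the
front crosses the ray from `F` through `m`. -/
theorem advance (h : Config i F X Y Z A B C) (hf : IsFront i F Y Z A B C c b) (hm : m ∈ A)
    (hw : w ∈ C ∨ w = Y) (hbw : orient i c b w < 0) (hA : ∀ s ∈ A, 0 < orient i b w s) :
    IsFront i F Y Z A B C w b ∧ orient i F c b * (orient i F w m + orient i F m b) <
      orient i F w b * (orient i F c m + orient i F m b) := by
  refine ⟨⟨hw, hf.hb, hf.C_b h hw hbw, fun s hs => ?_⟩, ?_⟩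
  · rw [orient_swap]; linarith [hA s hs]
  · have h1 := hf.A_b h hm
    have e := orient_plucker i F c w b m
    rw [orient_swap_right i F b c, orient_swap_right i F b m] at e
    have e2 := orient_add_add i c b w F
    rw [orient_swap_right i F b w, orient_swap_right i F w c] at e2
    nlinarith [mul_pos h1 (neg_pos.2 hbw)]

/-- There is a front which cannot be moved away from `F`. -/
theorem exists_maximal (hf : IsFront i F Y Z A B C c b) (hm : m ∈ A) :
    ∃ c b, IsFront i F Y Z A B C c b ∧ ∀ c' b', IsFront i F Y Z A B C c' b' →
      orient i F c' b' * (orient i F c m + orient i F m b) ≤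
        orient i F c b * (orient i F c' m + orient i F m b') := by
  classical
  have hpos : ∀ c b, IsFront i F Y Z A B C c b → 0 < orient i F c m + orient i F m b := by
    intro c b hf
    have e := orient_add_add i c b m F
    rw [orient_swap_right i F b m, orient_swap_right i F m c] at e
    linarith [hf.beyond m hm, hf.pos]
  -- The quotient is the parameter at which the line `c b` meets the ray from `F` to `m`, with value
  -- 0 at `F` and 1 at `m`. There are finitely many fronts, so it has a maximum.
  obtain ⟨⟨c₀, b₀⟩, h0, hmax⟩ := ((insert Y C ×ˢ insert Z B).filter
    (fun e => IsFront i F Y Z A B C e.1 e.2)).exists_max_image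
    (fun e => orient i F e.1 e.2 / (orient i F e.1 m + orient i F m e.2))
    ⟨(c, b), by simpa using ⟨⟨hf.hc.symm, hf.hb.symm⟩, hf⟩⟩
  have h0' := (Finset.mem_filter.1 h0).2
  refine ⟨c₀, b₀, h0', fun c' b' hf' => ?_⟩
  have := hmax (c', b') (by simpa using ⟨⟨hf'.hc.symm, hf'.hb.symm⟩, hf'⟩)
  exact (div_le_div_iff₀ (hpos _ _ hf') (hpos _ _ h0')).1 this

end IsFront

end config

/-! ### A central triangle from a maximal front -/

section central

variable {i : Fin 2} {F X Y Z a b c m s w x : Plane} {A B C AY AZ BZ BX CX CY : Finset Plane}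

/-- The convex hull of the strip attached to the edge `q r` at the corner `Q`. -/
abbrev cornerHull (q r Q : Plane) (U V : Finset Plane) : Set Plane :=
  convexHull ℝ (({q, r, Q} : Set Plane) ∪ (U ∪ V))

theorem cornerHull_comm (q r Q : Plane) (U V : Finset Plane) :
    cornerHull q r Q U V = cornerHull r q Q V U := by
  unfold cornerHull
  rw [Set.insert_comm, Set.union_comm (U : Set Plane)]

theorem forall_mem_corner {q r Q : Plane} {U V : Finset Plane} {P : Plane → Prop} (hq : P q)
    (hr : P r) (h : ∀ s, s ∈ U ∨ s ∈ V ∨ s = Q → P s) :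
    ∀ s ∈ (({q, r, Q} : Set Plane) ∪ (U ∪ V)), P s := by
  rintro s ((rfl | rfl | rfl) | hs | hs)
  · exact hq
  · exact hr
  · exact h _ (by simp)
  · exact h _ (Or.inl hs)
  · exact h _ (Or.inr (Or.inl hs))

/-- Two convex hulls separated by a line through `x` which the first one meets only in `x`. -/
theorem inter_convexHull_subset_singleton {g h x : Plane} {G H : Set Plane}
    (hx : orient i g h x = 0) (hG : ∀ z ∈ G, 0 < orient i g h z ∨ z = x)
    (hH : ∀ z ∈ H, orient i g h z ≤ 0) : convexHull ℝ G ∩ convexHull ℝ H ⊆ {x} :=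
  fun _ hz => mem_of_mem_convexHull_of_orient_nonpos (convex_singleton x)
    (by rintro z rfl; exact hx) hG hz.1 (orient_nonpos_of_mem_convexHull hH hz.2)

/-- A triangle `a b c` around which all other points fall into three corner regions. -/
structure CentralTriangle (i : Fin 2) (X Y Z : Plane) (A B C : Finset Plane) (a b c : Plane)
    (AY AZ BZ BX CX CY : Finset Plane) : Prop where
  ha : a ∈ A
  hb : b ∈ B ∨ b = Z
  hc : c ∈ C ∨ c = Y
  ne : ¬ (b = Z ∧ c = Y)
  tri : 0 < orient i c a b
  memA : ∀ s, s ∈ A ↔ s = a ∨ s ∈ AY ∨ s ∈ AZ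
  memB : ∀ s, s ∈ B ↔ (s = b ∧ b ≠ Z) ∨ s ∈ BZ ∨ s ∈ BX
  memC : ∀ s, s ∈ C ↔ (s = c ∧ c ≠ Y) ∨ s ∈ CX ∨ s ∈ CY
  degY : c = Y → CY = ∅ ∧ AY = ∅
  degZ : b = Z → AZ = ∅ ∧ BZ = ∅
  cornerX : ∀ s, s ∈ BX ∨ s ∈ CX ∨ s = X → 0 < orient i c b s
  cornerY : c ≠ Y → ∀ s, s ∈ CY ∨ s ∈ AY ∨ s = Y → 0 < orient i a c s
  cornerZ : b ≠ Z → ∀ s, s ∈ AZ ∨ s ∈ BZ ∨ s = Z → 0 < orient i b a s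
  interXY : cornerHull b c X BX CX ∩ cornerHull c a Y CY AY ⊆ {c}
  interYZ : cornerHull c a Y CY AY ∩ cornerHull a b Z AZ BZ ⊆ {a}
  interZX : cornerHull a b Z AZ BZ ∩ cornerHull b c X BX CX ⊆ {b}

theorem CentralTriangle.reflect
    (h : CentralTriangle (i + 1) X Z Y A C B a c b AZ AY CY CX BX BZ) :
    CentralTriangle i X Y Z A B C a b c AY AZ BZ BX CX CY where
  ha := h.ha
  hb := h.hc
  hc := h.hb
  ne := fun k => h.ne k.symm
  tri := by
    have := h.tri
    rwa [orient_flip, ← orient_swap, orient_rotate, orient_rotate] at this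
  memA := fun s => by rw [h.memA s, or_comm (a := s ∈ AY)]
  memB := fun s => by rw [h.memC s, or_comm (a := s ∈ BX)]
  memC := fun s => by rw [h.memB s, or_comm (a := s ∈ CX)]
  degY := fun k => (h.degZ k).symm
  degZ := fun k => (h.degY k).symm
  cornerX := fun s hs => by
    have := h.cornerX s (by tauto)
    rwa [orient_flip, ← orient_swap] at this
  cornerY := fun k s hs => by
    have := h.cornerZ k s (by tauto)
    rwa [orient_flip, ← orient_swap] at this
  cornerZ := fun k s hs => by
    have := h.cornerY k s (by tauto)
    rwa [orient_flip, ← orient_swap] at this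
  interXY := by
    rw [cornerHull_comm b c, cornerHull_comm c a, Set.inter_comm]; exact h.interZX
  interYZ := by
    rw [cornerHull_comm c a, cornerHull_comm a b, Set.inter_comm]; exact h.interYZ
  interZX := by
    rw [cornerHull_comm a b, cornerHull_comm b c, Set.inter_comm]; exact h.interXY

/-- An affine identity comparing the three lines through `w`. -/
theorem orient_three_lines (i : Fin 2) (F b c s w : Plane) :
    orient i w b s * orient i F c w =
      orient i w b c * orient i F s w + orient i F w b * orient i c w s := by
  unfold orient; ring

namespace IsFront

/-- `w` is a point of `A` beyond the front such that no points beyond the front lie in the triangle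
`c b w`. -/
theorem central (h : Config i F X Y Z A B C) (hf : IsFront i F Y Z A B C c b) (hcY : c ≠ Y)
    (hbZ : b ≠ Z) (hw : w ∈ A)
    (hempty : ∀ s, s ∈ A ∨ s ∈ B ∨ s ∈ C ∨ s = Y ∨ s = Z → orient i c b s < 0 → s ≠ w →
      0 < orient i b w s ∨ 0 < orient i w c s) :
    ∃ AY AZ BZ BX CX CY, CentralTriangle i X Y Z A B C w b c AY AZ BZ BX CX CY := by
  classical
  have hbw := hf.beyond w hw
  have hcC := hf.hc.resolve_right hcY
  have hbB := hf.hb.resolve_right hbZ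
  have hcw := hf.c_A h hw
  have hwb := hf.A_b h hw
  have hYw := (h.hA w hw).1
  have hwZ := (h.hA w hw).2.1
  have hnY := hf.neg_Y h hcY
  have hnZ : orient i c b Z < 0 := by
    have := hf.reflect.neg_Y h.reflect hbZ
    rwa [orient_flip, ← orient_swap] at this
  have htri : 0 < orient i w b c := by
    rw [orient_rotate, orient_swap]; linarith
  have hwY : Y ≠ w := by rintro rfl; simp at hYw
  have hwZ' : Z ≠ w := by rintro rfl; simp at hwZ
  -- By `orient_three_lines`, a point on the side of `c` of the ray `F w` that is beyond the line `b
  -- w` is also beyond `w c`. So the alternative left open by `hempty` is decided by the angular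
  -- order around `F`.
  have left : ∀ s, s ∈ A ∨ s ∈ B ∨ s ∈ C ∨ s = Y ∨ s = Z → orient i c b s < 0 →
      0 < orient i F s w → 0 < orient i w c s := by
    intro s hs h1 h2
    have hsw : s ≠ w := by rintro rfl; simp at h2
    rcases hempty s hs h1 hsw with h3 | h3
    · by_contra h4
      have e := orient_three_lines i F b c s w
      rw [orient_swap i w b s, orient_swap i c w s] at e
      nlinarith [mul_pos htri h2, mul_pos h3 hcw]
    · exact h3
  have right : ∀ s, s ∈ A ∨ s ∈ B ∨ s ∈ C ∨ s = Y ∨ s = Z → orient i c b s < 0 →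
      0 < orient i F w s → 0 < orient i b w s := by
    intro s hs h1 h2
    have hsw : s ≠ w := by rintro rfl; simp at h2
    rcases hempty s hs h1 hsw with h3 | h3
    · exact h3
    · by_contra h4
      have e := orient_three_lines i F c b s w
      have e1 := orient_rotate i w b c
      rw [orient_swap_right i w c b, orient_swap_right i F s w, orient_swap_right i F w c,
        orient_swap_right i F b w] at e
      nlinarith [mul_pos htri h2, mul_pos h3 hwb]
  have genA : ∀ s ∈ A, s ≠ w → orient i F s w ≠ 0 := by
    intro s hs hsw
    have h1 := h.hA s hs
    refine h.gen F (by simp) s (by simp [hs]) w (by simp [hw]) ?_ hsw ?_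
    · rintro rfl; simp at h1
    · rintro rfl; simp at hwZ
  have genX : ∀ s, s ∈ B ∨ s ∈ C → s ≠ b → s ≠ c → orient i c b s ≠ 0 := by
    intro s hs hsb hsc
    refine h.gen c (by simp [hcC]) b (by simp [hbB]) s (by simp; tauto) ?_ hsb.symm hsc.symm
    rintro rfl; simpa using hf.pos
  have hcb : c ≠ b := by rintro rfl; simpa using hf.pos
  have hBC : ∀ s ∈ B, s ∉ C := fun s h1 h2 => by
    have h3 := (h.hB s h1).2.1
    have h4 := (h.hC s h2).1
    rw [orient_swap_right] at h4; linarith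
  -- `A` is divided by the ray through `w`, while `B` and `C` are divided by the line of the front.
  refine ⟨A.filter (fun s => 0 < orient i F s w), A.filter (fun s => 0 < orient i F w s),
    B.filter (fun s => orient i c b s < 0), B.filter (fun s => 0 < orient i c b s),
    C.filter (fun s => 0 < orient i c b s), C.filter (fun s => orient i c b s < 0), ?_⟩
  have memY : ∀ s, s ∈ C.filter (fun s => orient i c b s < 0) ∨
      s ∈ A.filter (fun s => 0 < orient i F s w) ∨ s = Y →
      orient i c b s < 0 ∧ 0 < orient i F s w ∧ 0 < orient i w c s := by
    intro s hs
    simp only [Finset.mem_filter] at hs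
    rcases hs with ⟨h1, h2⟩ | ⟨h1, h2⟩ | rfl
    · have := hf.C_A h h1 h2 hw
      exact ⟨h2, this, left s (by tauto) h2 this⟩
    · exact ⟨hf.beyond s h1, h2, left s (by tauto) (hf.beyond s h1) h2⟩
    · exact ⟨hnY, hYw, left s (by tauto) hnY hYw⟩
  have memZ : ∀ s, s ∈ A.filter (fun s => 0 < orient i F w s) ∨
      s ∈ B.filter (fun s => orient i c b s < 0) ∨ s = Z →
      orient i c b s < 0 ∧ 0 < orient i F w s ∧ 0 < orient i b w s := by
    intro s hs
    simp only [Finset.mem_filter] at hs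
    rcases hs with ⟨h1, h2⟩ | ⟨h1, h2⟩ | rfl
    · exact ⟨hf.beyond s h1, h2, right s (by tauto) (hf.beyond s h1) h2⟩
    · have := hf.A_B h h1 h2 hw
      exact ⟨h2, this, right s (by tauto) h2 this⟩
    · exact ⟨hnZ, hwZ, right s (by tauto) hnZ hwZ⟩
  have memX : ∀ s, s ∈ B.filter (fun s => 0 < orient i c b s) ∨
      s ∈ C.filter (fun s => 0 < orient i c b s) ∨ s = X → 0 < orient i c b s := by
    intro s hs
    simp only [Finset.mem_filter] at hs
    rcases hs with ⟨h1, h2⟩ | ⟨h1, h2⟩ | rfl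
    · exact h2
    · exact h2
    · exact hf.pos_X h
  refine ⟨hw, hf.hb, hf.hc, fun k => hcY k.2, ?_, ?_, ?_, ?_, fun k => absurd k hcY,
    fun k => absurd k hbZ, memX, fun _ s hs => (memY s hs).2.2, fun _ s hs => (memZ s hs).2.2,
    ?_, ?_, ?_⟩
  · rwa [orient_rotate]
  · intro s
    simp only [Finset.mem_filter]
    constructor
    · intro hs
      by_cases hsw : s = w
      · exact Or.inl hsw
      · rcases (genA s hs hsw).lt_or_gt with h1 | h1
        · refine Or.inr (Or.inr ⟨hs, ?_⟩)
          rw [orient_swap_right]; linarith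
        · exact Or.inr (Or.inl ⟨hs, h1⟩)
    · rintro (rfl | h1 | h1)
      · exact hw
      · exact h1.1
      · exact h1.1
  · intro s
    simp only [Finset.mem_filter]
    constructor
    · intro hs
      by_cases hsb : s = b
      · exact Or.inl ⟨hsb, hbZ⟩
      · rcases (genX s (Or.inl hs) hsb (fun k => hBC s hs (k ▸ hcC))).lt_or_gt with h1 | h1
        · exact Or.inr (Or.inl ⟨hs, h1⟩)
        · exact Or.inr (Or.inr ⟨hs, h1⟩)
    · rintro (⟨rfl, -⟩ | h1 | h1)
      · exact hbB
      · exact h1.1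
      · exact h1.1
  · intro s
    simp only [Finset.mem_filter]
    constructor
    · intro hs
      by_cases hsc : s = c
      · exact Or.inl ⟨hsc, hcY⟩
      · rcases (genX s (Or.inr hs) (fun k => hBC s (k ▸ hbB) hs) hsc).lt_or_gt with h1 | h1
        · exact Or.inr (Or.inr ⟨hs, h1⟩)
        · exact Or.inr (Or.inl ⟨hs, h1⟩)
    · rintro (⟨rfl, -⟩ | h1 | h1)
      · exact hcC
      · exact h1.1
      · exact h1.1
  -- The line `c b` separates the corner at `X` from the other two, and the line `F w` separates the
  -- corners at `Y` and `Z` from each other.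
  · rw [Set.inter_comm]
    refine inter_convexHull_subset_singleton (i := i) (g := b) (h := c) (by simp)
      (forall_mem_corner (by simp) (Or.inl ?_) ?_) (forall_mem_corner (by simp) (by simp) ?_)
    · rwa [orient_rotate, orient_rotate]
    · intro s hs; left; rw [orient_swap]; linarith [(memY s hs).1]
    · intro s hs; rw [orient_swap]; linarith [memX s hs]
  · refine inter_convexHull_subset_singleton (i := i) (g := w) (h := F) (by simp)
      (forall_mem_corner (Or.inl ?_) (by simp) ?_) (forall_mem_corner (by simp) ?_ ?_)
    · rwa [orient_rotate]
    · intro s hs; left; rw [orient_rotate]; exact (memY s hs).2.1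
    · rw [orient_swap]; linarith
    · intro s hs; rw [orient_swap]; linarith [(memZ s hs).2.1]
  · refine inter_convexHull_subset_singleton (i := i) (g := b) (h := c) (by simp)
      (forall_mem_corner (Or.inl ?_) (by simp) ?_) (forall_mem_corner (by simp) (by simp) ?_)
    · rwa [orient_rotate, orient_rotate]
    · intro s hs; left; rw [orient_swap]; linarith [(memZ s hs).1]
    · intro s hs; rw [orient_swap]; linarith [memX s hs]

/-- The case of a front ending in the vertex `Y`. -/
theorem central_of_eq (h : Config i F X Y Z A B C) (hf : IsFront i F Y Z A B C Y b)
    (hbZ : b ≠ Z) (hw : w ∈ A)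
    (hempty : ∀ s, s ∈ A ∨ s ∈ B ∨ s = Z → orient i Y b s < 0 → s ≠ w → 0 < orient i b w s) :
    ∃ AY AZ BZ BX CX CY, CentralTriangle i X Y Z A B C w b Y AY AZ BZ BX CX CY := by
  classical
  have hbw := hf.beyond w hw
  have hbB := hf.hb.resolve_right hbZ
  have hwb := hf.A_b h hw
  have hwZ := (h.hA w hw).2.1
  have hnZ : orient i Y b Z < 0 := by
    have := hf.reflect.neg_Y h.reflect hbZ
    rwa [orient_flip, ← orient_swap] at this
  have htri : 0 < orient i w b Y := by
    rw [orient_rotate, orient_swap]; linarith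
  have hwZ' : Z ≠ w := by rintro rfl; simp at hwZ
  have hYb : Y ≠ b := by rintro rfl; simpa using hf.pos
  have genX : ∀ s, s ∈ B → s ≠ b → orient i Y b s ≠ 0 := by
    intro s hs hsb
    refine h.gen Y (by simp) b (by simp [hbB]) s (by simp [hs]) hYb hsb.symm ?_
    rintro rfl
    have h1 := h.XY
    rw [orient_swap_right] at h1
    linarith [(h.hB _ hs).2.1]
  -- The corner at `Y` degenerates to the side `Y w`: the rest of `A` goes to the corner at `Z`, and
  -- all of `C` to the corner at `X`.
  refine ⟨∅, A.erase w,
    B.filter (fun s => orient i Y b s < 0), B.filter (fun s => 0 < orient i Y b s),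
    C, ∅, ?_⟩
  have memZ : ∀ s, s ∈ A.erase w ∨ s ∈ B.filter (fun s => orient i Y b s < 0) ∨ s = Z →
      orient i Y b s < 0 ∧ 0 < orient i b w s := by
    intro s hs
    simp only [Finset.mem_filter, Finset.mem_erase] at hs
    rcases hs with ⟨h1, h2⟩ | ⟨h1, h2⟩ | rfl
    · exact ⟨hf.beyond s h2, hempty s (by tauto) (hf.beyond s h2) h1⟩
    · refine ⟨h2, hempty s (by tauto) h2 ?_⟩
      rintro rfl
      linarith [(h.hA s hw).2.1, (h.hB s h1).1, orient_swap_right i F s Z]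
    · exact ⟨hnZ, hempty s (by tauto) hnZ hwZ'⟩
  have memX : ∀ s, s ∈ B.filter (fun s => 0 < orient i Y b s) ∨ s ∈ C ∨ s = X →
      0 < orient i Y b s := by
    intro s hs
    simp only [Finset.mem_filter] at hs
    rcases hs with ⟨h1, h2⟩ | h1 | rfl
    · exact h2
    · exact hf.pos_of_mem_C h h1
    · exact hf.pos_X h
  refine ⟨hw, hf.hb, hf.hc, fun k => hbZ k.1, ?_, ?_, ?_, ?_, fun _ => ⟨rfl, rfl⟩,
    fun k => absurd k hbZ, memX, fun k => absurd rfl k, fun _ s hs => (memZ s hs).2,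
    ?_, ?_, ?_⟩
  · rwa [orient_rotate]
  · intro s
    simp only [Finset.mem_erase, Finset.notMem_empty, false_or]
    constructor
    · intro hs
      by_cases hsw : s = w
      · exact Or.inl hsw
      · exact Or.inr ⟨hsw, hs⟩
    · rintro (rfl | h1)
      · exact hw
      · exact h1.2
  · intro s
    simp only [Finset.mem_filter]
    constructor
    · intro hs
      by_cases hsb : s = b
      · exact Or.inl ⟨hsb, hbZ⟩
      · rcases (genX s hs hsb).lt_or_gt with h1 | h1
        · exact Or.inr (Or.inl ⟨hs, h1⟩)
        · exact Or.inr (Or.inr ⟨hs, h1⟩)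
    · rintro (⟨rfl, -⟩ | h1 | h1)
      · exact hbB
      · exact h1.1
      · exact h1.1
  · intro s; simp
  · rw [Set.inter_comm]
    refine inter_convexHull_subset_singleton (i := i) (g := b) (h := Y) (by simp)
      (forall_mem_corner (by simp) (Or.inl ?_) ?_) (forall_mem_corner (by simp) (by simp) ?_)
    · rwa [orient_rotate, orient_rotate]
    · intro s hs; right; simpa using hs
    · intro s hs; rw [orient_swap]; linarith [memX s hs]
  · refine inter_convexHull_subset_singleton (i := i) (g := w) (h := b) (by simp)
      (forall_mem_corner (Or.inl htri) (by simp) ?_) (forall_mem_corner (by simp) (by simp) ?_)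
    · intro s hs; left
      obtain rfl : s = Y := by simpa using hs
      exact htri
    · intro s hs; rw [orient_swap]; linarith [(memZ s hs).2]
  · refine inter_convexHull_subset_singleton (i := i) (g := b) (h := Y) (by simp)
      (forall_mem_corner (Or.inl ?_) (by simp) ?_) (forall_mem_corner (by simp) (by simp) ?_)
    · rwa [orient_rotate, orient_rotate]
    · intro s hs; left; rw [orient_swap]; linarith [(memZ s hs).1]
    · intro s hs; rw [orient_swap]; linarith [memX s hs]

-- Take a maximal front and the first points `w₁` and `w₂` beyond it that are hit on rotating about
-- `b` and about `c`. Maximality and crossing arguments show that one of them lies in `A`; with `b`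
-- and `c` it spans a triangle with no further points beyond the front inside.
set_option maxHeartbeats 1000000 in
theorem exists_central (h : Config i F X Y Z A B C) (hf : IsFront i F Y Z A B C c b)
    (hA : A.Nonempty) : ∃ a b c AY AZ BZ BX CX CY,
      CentralTriangle i X Y Z A B C a b c AY AZ BZ BX CX CY := by
  classical
  obtain ⟨m, hm⟩ := hA
  obtain ⟨c, b, hf, hmax⟩ := hf.exists_maximal hm
  set W : Finset Plane := (insert Y (insert Z (A ∪ B ∪ C))).filter (fun s => orient i c b s < 0)
    with hW
  have memW : ∀ s, s ∈ W ↔ (s ∈ A ∨ s ∈ B ∨ s ∈ C ∨ s = Y ∨ s = Z) ∧ orient i c b s < 0 := by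
    intro s; simp only [hW, Finset.mem_filter, Finset.mem_insert, Finset.mem_union]; tauto
  have hAW : ∀ s ∈ A, s ∈ W := fun s hs => (memW s).2 ⟨Or.inl hs, hf.beyond s hs⟩
  have hWpos : ∀ s ∈ W, 0 < orient i b c s := fun s hs => by
    rw [orient_swap]; linarith [((memW s).1 hs).2]
  have hWS : ∀ s ∈ W, s ∈ ({F, X, Y, Z} : Set Plane) ∪ (A ∪ B ∪ C) := by
    intro s hs; have := ((memW s).1 hs).1; simp; tauto
  have hne : ∀ s ∈ W, s ≠ b ∧ s ≠ c := by
    intro s hs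
    have := hWpos s hs
    constructor <;> rintro rfl <;> simp at this
  have hbS : b ∈ ({F, X, Y, Z} : Set Plane) ∪ (A ∪ B ∪ C) := by have := hf.hb; simp; tauto
  have hcS : c ∈ ({F, X, Y, Z} : Set Plane) ∪ (A ∪ B ∪ C) := by have := hf.hc; simp; tauto
  obtain ⟨w₁, hw₁, hfirst₁⟩ := exists_first_hit ⟨m, hAW m hm⟩ hWpos (fun s hs s' hs' hss =>
    h.gen b hbS s (hWS s hs) s' (hWS s' hs') (hne s hs).1.symm hss (hne s' hs').1.symm)
  obtain ⟨w₂, hw₂, hfirst₂⟩ := exists_first_hit' ⟨m, hAW m hm⟩ hWpos (fun s hs s' hs' hss =>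
    h.gen c hcS s (hWS s hs) s' (hWS s' hs') (hne s hs).2.symm hss (hne s' hs').2.symm)
  have hAC : ∀ s ∈ A, ¬ (s ∈ C ∨ s = Y) := by
    rintro s h1 h2
    have h3 := (h.hA s h1).1
    have h4 := (h.pos_of_C h2).2
    rw [orient_swap_right] at h4
    linarith
  have hAB : ∀ s ∈ A, ¬ (s ∈ B ∨ s = Z) := by
    rintro s h1 h2
    have h3 := (h.hA s h1).2.1
    have h4 := (h.pos_of_B h2).2
    rw [orient_swap_right] at h4
    linarith
  have hBC : ∀ s, (s ∈ B ∨ s = Z) → ¬ (s ∈ C ∨ s = Y) := by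
    rintro s h1 h2
    have h3 := (h.pos_of_C h2).1
    have h4 := (h.pos_of_B h1).1
    rw [orient_swap_right] at h4
    linarith
  -- Otherwise `w₁ b` would be a front farther from `F`; the mirror image excludes `w₂` from `B ∪
  -- {Z}`.
  have hw₁C : ¬ (w₁ ∈ C ∨ w₁ = Y) := by
    intro k
    obtain ⟨hf', hlt⟩ := hf.advance h hm k ((memW w₁).1 hw₁).2
      (fun s hs => hfirst₁ s (hAW s hs) (by rintro rfl; exact hAC s hs k))
    exact absurd (hmax _ _ hf') (not_le.2 hlt)
  have hw₂B : ¬ (w₂ ∈ B ∨ w₂ = Z) := by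
    intro k
    obtain ⟨hf', hlt⟩ := hf.reflect.advance h.reflect hm k
      (by rw [orient_flip, ← orient_swap]; exact ((memW w₂).1 hw₂).2)
      (fun s hs => by
        rw [orient_flip, ← orient_swap]
        exact hfirst₂ s (hAW s hs) (by rintro rfl; exact hAB s hs k))
    have hf'' : IsFront i F Y Z A B C c w₂ := by
      have := hf'.reflect
      refine ⟨this.hc, this.hb, ?_, fun s hs => ?_⟩
      · have := hf'.pos; rwa [orient_flip, ← orient_swap_right] at this
      · have := hf'.beyond s hs; rwa [orient_flip, ← orient_swap] at this
    have := hmax _ _ hf''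
    simp only [orient_flip] at hlt
    rw [← orient_swap_right, ← orient_swap_right, ← orient_swap_right, ← orient_swap_right,
      ← orient_swap_right] at hlt
    linarith
  have cross : w₁ ≠ w₂ → ∃ x, x ∈ segment ℝ b w₁ ∧ x ∈ segment ℝ c w₂ := by
    intro hne12
    have a1 : orient i b w₁ c < 0 := by rw [orient_swap_right]; linarith [hWpos w₁ hw₁]
    have a2 := hfirst₁ w₂ hw₂ hne12.symm
    have a3 : 0 < orient i c w₂ b := by rw [← orient_rotate]; exact hWpos w₂ hw₂
    have a4 : orient i c w₂ w₁ < 0 := by rw [orient_swap]; linarith [hfirst₂ w₁ hw₁ hne12]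
    exact exists_mem_segments (i := i) (by nlinarith) (by nlinarith) a1.ne
  -- The segments `b w₁` and `c w₂` would cross, although the line `F X` separates them.
  have crossX : ¬ ((w₁ ∈ B ∨ w₁ = Z) ∧ (w₂ ∈ C ∨ w₂ = Y)) := by
    rintro ⟨k1, k2⟩
    obtain ⟨z, z1, z2⟩ := cross (by rintro k; rw [k] at k1; exact hBC _ k1 k2)
    have hbX : ∀ s, s ∈ B ∨ s = Z → orient i F X s < 0 := fun s hs => by
      rw [orient_swap_right]; linarith [(h.pos_of_B hs).1]
    have b1 := (convex_orient_neg i F X).segment_subset (hbX b hf.hb) (hbX w₁ k1) z1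
    have b2 := (convex_orient_pos i F X).segment_subset (h.pos_of_C hf.hc).1 (h.pos_of_C k2).1 z2
    simp only [Set.mem_ofPred_eq] at b1 b2
    linarith
  -- With `c = Y` the hit has to be the one about `b`, as required by `central_of_eq`. If `w₁` were
  -- in `B ∪ {Z}`, then `w₂` would be in `A`, and the crossing segments would be separated by the
  -- line `F Z`. The segment `Y Z` itself cuts off no point of `A`.
  have deg : c = Y → w₁ ∈ A ∧ b ≠ Z := by
    rintro rfl
    constructor
    · by_contra k
      have k1 : w₁ ∈ B ∨ w₁ = Z := by have := ((memW w₁).1 hw₁).1; tauto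
      have k2 : w₂ ∈ A := by have := ((memW w₂).1 hw₂).1; tauto
      obtain ⟨z, z1, z2⟩ := cross (by rintro e; rw [e] at k1; exact hAB _ k2 k1)
      have b1 := (convex_orient_nonneg i F Z).segment_subset (h.pos_of_B hf.hb).2
        (h.pos_of_B k1).2 z1
      have b2 := (convex_orient_neg i F Z).segment_subset
        (show orient i F Z c < 0 by rw [orient_swap_right]; linarith [h.YZ])
        (show orient i F Z w₂ < 0 by rw [orient_swap_right]; linarith [(h.hA _ k2).2.1]) z2
      simp only [Set.mem_ofPred_eq] at b1 b2
      linarith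
    · rintro rfl
      linarith [hf.beyond m hm, (h.hA m hm).2.2]
  have deg' : b = Z → w₂ ∈ A ∧ c ≠ Y := by
    rintro rfl
    constructor
    · by_contra k
      have k1 : w₂ ∈ C ∨ w₂ = Y := by have := ((memW w₂).1 hw₂).1; tauto
      have k2 : w₁ ∈ A := by have := ((memW w₁).1 hw₁).1; tauto
      obtain ⟨z, z1, z2⟩ := cross (by rintro e; rw [← e] at k1; exact hAC _ k2 k1)
      have hcY : ∀ s, s ∈ C ∨ s = Y → 0 ≤ orient i Y F s := fun s hs => by
        rw [orient_rotate]; exact (h.pos_of_C hs).2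
      have b1 := (convex_orient_neg i Y F).segment_subset
        (show orient i Y F b < 0 by rw [orient_swap]; linarith [h.YZ])
        (show orient i Y F w₁ < 0 by rw [orient_swap]; linarith [(h.hA _ k2).1]) z1
      have b2 := (convex_orient_nonneg i Y F).segment_subset (hcY c hf.hc) (hcY w₂ k1) z2
      simp only [Set.mem_ofPred_eq] at b1 b2
      linarith
    · rintro rfl
      linarith [hf.beyond m hm, (h.hA m hm).2.2]
  by_cases hcY : c = Y
  · obtain ⟨k1, k2⟩ := deg hcY
    subst hcY
    exact ⟨w₁, b, c, hf.central_of_eq h k2 k1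
      (fun s hs h1 h2 => hfirst₁ s ((memW s).2 ⟨by tauto, h1⟩) h2)⟩
  by_cases hbZ : b = Z
  · obtain ⟨k1, k2⟩ := deg' hbZ
    subst hbZ
    obtain ⟨AY, AZ, BZ, BX, CX, CY, hcen⟩ := hf.reflect.central_of_eq h.reflect k2 k1
      (fun s hs h1 h2 => by
        rw [orient_flip, ← orient_swap] at h1 ⊢
        exact hfirst₂ s ((memW s).2 ⟨by tauto, h1⟩) h2)
    exact ⟨w₂, b, c, _, _, _, _, _, _, hcen.reflect⟩
  have : w₁ ∈ A ∨ w₂ ∈ A := by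
    have k1 := ((memW w₁).1 hw₁).1
    have k2 := ((memW w₂).1 hw₂).1
    tauto
  rcases this with k | k
  · exact ⟨w₁, b, c, hf.central h hcY hbZ k
      (fun s hs h1 h2 => Or.inl (hfirst₁ s ((memW s).2 ⟨hs, h1⟩) h2))⟩
  · exact ⟨w₂, b, c, hf.central h hcY hbZ k
      (fun s hs h1 h2 => Or.inr (hfirst₂ s ((memW s).2 ⟨hs, h1⟩) h2))⟩

end IsFront

end central

/-! ### A central triangle with one vertex in each of `A`, `B`, `C` -/

section rainbow

variable {i : Fin 2} {F X Y Z a b c s : Plane} {A B C : Finset Plane}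

namespace Config

/-- The points in the sector between `c` and `a`. -/
theorem sector (h : Config i F X Y Z A B C) (hc : c ∈ C) (ha : a ∈ A) (hca : 0 < orient i F c a)
    (hs : (s ∈ C ∧ 0 < orient i F c s) ∨ (s ∈ A ∧ 0 < orient i F s a) ∨ s = Y) :
    0 < orient i F c s ∧ 0 < orient i F s a := by
  have hcY := (h.hC c hc).2.1
  have hYa := (h.hA a ha).1
  rcases hs with ⟨hs, h1⟩ | ⟨hs, h1⟩ | rfl
  · refine ⟨h1, ?_⟩
    have hsY := (h.hC s hs).2.1
    have e := orient_plucker i F s Y a c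
    rw [orient_swap_right i F a c, orient_swap_right i F s c, orient_swap_right i F a s,
      orient_swap_right i F Y c] at e
    by_contra hcon
    nlinarith [mul_pos hsY hca, mul_pos hYa h1]
  · refine ⟨?_, h1⟩
    have hYs := (h.hA s hs).1
    have e := orient_plucker i F c Y s a
    rw [orient_swap_right i F s c] at e
    by_contra hcon
    nlinarith [mul_pos hcY h1, mul_pos hYs hca]
  · exact ⟨hcY, hYa⟩

theorem mem_iff_split (h : Config i F X Y Z A B C) (ha : a ∈ A) (s : Plane) :
    s ∈ A ↔ s = a ∨ s ∈ A.filter (fun s => 0 < orient i F s a) ∨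
      s ∈ A.filter (fun s => 0 < orient i F a s) := by
  simp only [Finset.mem_filter]
  constructor
  · intro hs
    by_cases hsa : s = a
    · exact Or.inl hsa
    have hF : ∀ s ∈ A, F ≠ s := by rintro _ h1 rfl; simpa using h.hA _ h1
    have := h.gen F (by simp) s (by simp [hs]) a (by simp [ha]) (hF s hs) hsa (hF a ha)
    rcases this.lt_or_gt with h1 | h1
    · exact Or.inr (Or.inr ⟨hs, by rw [orient_swap_right]; linarith⟩)
    · exact Or.inr (Or.inl ⟨hs, h1⟩)
  · rintro (rfl | h1 | h1)
    · exact ha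
    · exact h1.1
    · exact h1.1

end Config

/-- A point of the sector between `c` and `a` lies beyond the side `c a` of an empty triangle. -/
theorem pos_of_sector (hca : 0 < orient i F c a) (hab : 0 < orient i F a b)
    (hbc : 0 < orient i F b c) (hs : 0 < orient i F c s ∧ 0 < orient i F s a)
    (hempty : orient i c a s < 0 ∨ orient i a b s < 0 ∨ orient i b c s < 0) :
    0 < orient i a c s := by
  have htri : 0 < orient i a b c := by
    rw [← orient_add_add i a b c F]; linarith
  have e1 := orient_bary i a b F c a s
  have e2 := orient_bary i b c F c a s
  have htri' : 0 < orient i b c a := by rwa [← orient_rotate]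
  have hab' : 0 < orient i a b F := by rwa [← orient_rotate]
  have hbc' : 0 < orient i b c F := by rwa [← orient_rotate]
  rw [orient_left, mul_zero, add_zero, ← orient_rotate i s a F |>.trans rfl,
    ← orient_rotate i F s a] at e1
  rw [orient_right, mul_zero, add_zero] at e2
  rw [orient_swap]
  by_contra hcon
  have h0 : 0 ≤ orient i c a s := by linarith
  rcases hempty with h1 | h1 | h1
  · linarith
  · nlinarith [mul_nonneg h0 hab'.le, mul_pos hs.2 htri]
  · nlinarith [mul_nonneg h0 hbc'.le, mul_pos hs.1 htri']

/-- The line `F q` separates the corners sharing the vertex `q`, and the second corner meets it only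
in `q`. -/
theorem inter_cornerHull_of_rays {q r q' Q R : Plane} {U V U' V' : Finset Plane}
    (hr : 0 < orient i F q r) (hr' : 0 < orient i F q' q)
    (hU : ∀ s, s ∈ U ∨ s ∈ V ∨ s = Q → 0 < orient i F q s)
    (hU' : ∀ s, s ∈ U' ∨ s ∈ V' ∨ s = R → 0 < orient i F s q) :
    cornerHull q' q R U' V' ∩ cornerHull q r Q U V ⊆ {q} := by
  rw [Set.inter_comm]
  refine inter_convexHull_subset_singleton (i := i) (g := F) (h := q) (by simp)
    (forall_mem_corner (by simp) (Or.inl hr) fun s hs => Or.inl (hU s hs))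
    (forall_mem_corner ?_ (by simp) fun s hs => ?_)
  · rw [orient_swap_right]; linarith
  · rw [orient_swap_right]; linarith [hU' s hs]

/-- An empty triangle around `F` with vertices in `A`, `B`, `C`. -/
theorem Config.exists_central_of_rainbow (h : Config i F X Y Z A B C) (ha : a ∈ A) (hb : b ∈ B)
    (hc : c ∈ C) (hca : 0 < orient i F c a) (hab : 0 < orient i F a b) (hbc : 0 < orient i F b c)
    (hempty : ∀ s, s ∈ A ∨ s ∈ B ∨ s ∈ C ∨ s = X ∨ s = Y ∨ s = Z → s ≠ a → s ≠ b → s ≠ c →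
      orient i c a s < 0 ∨ orient i a b s < 0 ∨ orient i b c s < 0) :
    ∃ AY AZ BZ BX CX CY, CentralTriangle i X Y Z A B C a b c AY AZ BZ BX CX CY := by
  have secY := fun s hs => h.sector (s := s) hc ha hca hs
  have secZ := fun s hs => h.rotate.sector (s := s) ha hb hab hs
  have secX := fun s hs => h.rotate.rotate.sector (s := s) hb hc hbc hs
  have hnb : b ≠ Z := by rintro rfl; simpa using h.hB _ hb
  have hnc : c ≠ Y := by rintro rfl; simpa using h.hC _ hc
  have hne : ∀ s q r : Plane, 0 < orient i F q s ∧ 0 < orient i F s r → s ≠ q ∧ s ≠ r := by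
    rintro s q r ⟨h1, h2⟩
    constructor <;> rintro rfl <;> simp_all
  refine ⟨A.filter (fun s => 0 < orient i F s a), A.filter (fun s => 0 < orient i F a s),
    B.filter (fun s => 0 < orient i F s b), B.filter (fun s => 0 < orient i F b s),
    C.filter (fun s => 0 < orient i F s c), C.filter (fun s => 0 < orient i F c s), ?_⟩
  have memY : ∀ s, s ∈ C.filter (fun s => 0 < orient i F c s) ∨
      s ∈ A.filter (fun s => 0 < orient i F s a) ∨ s = Y →
      0 < orient i F c s ∧ 0 < orient i F s a := by
    intro s hs
    simp only [Finset.mem_filter] at hs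
    exact secY s hs
  have memZ : ∀ s, s ∈ A.filter (fun s => 0 < orient i F a s) ∨
      s ∈ B.filter (fun s => 0 < orient i F s b) ∨ s = Z →
      0 < orient i F a s ∧ 0 < orient i F s b := by
    intro s hs
    simp only [Finset.mem_filter] at hs
    exact secZ s hs
  have memX : ∀ s, s ∈ B.filter (fun s => 0 < orient i F b s) ∨
      s ∈ C.filter (fun s => 0 < orient i F s c) ∨ s = X →
      0 < orient i F b s ∧ 0 < orient i F s c := by
    intro s hs
    simp only [Finset.mem_filter] at hs
    exact secX s hs
  refine ⟨ha, Or.inl hb, Or.inl hc, fun k => hnb k.1, ?_, h.mem_iff_split ha, fun s => ?_,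
    fun s => ?_, fun k => absurd k hnc, fun k => absurd k hnb,
    fun s hs => ?_, fun _ s hs => ?_, fun _ s hs => ?_, ?_, ?_, ?_⟩
  · rw [← orient_add_add i c a b F]; linarith
  · rw [h.rotate.mem_iff_split hb s]; simp [hnb]
  · rw [h.rotate.rotate.mem_iff_split hc s]; simp [hnc]
  · have h1 := memX s hs
    refine pos_of_sector hbc hca hab h1 ?_
    have h2 := hempty s (by simp only [Finset.mem_filter] at hs; tauto)
      (by rintro rfl; linarith [orient_swap_right i F s b, h1.1]) (hne s b c h1).1 (hne s b c h1).2
    tauto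
  · have h1 := memY s hs
    refine pos_of_sector hca hab hbc h1 ?_
    have h2 := hempty s (by simp only [Finset.mem_filter] at hs; tauto)
      (hne s c a h1).2 (by rintro rfl; linarith [orient_swap_right i F s c, h1.1]) (hne s c a h1).1
    tauto
  · have h1 := memZ s hs
    refine pos_of_sector hab hbc hca h1 ?_
    have h2 := hempty s (by simp only [Finset.mem_filter] at hs; tauto)
      (hne s a b h1).1 (hne s a b h1).2 (by rintro rfl; linarith [orient_swap_right i F s a, h1.1])
    tauto
  · exact inter_cornerHull_of_rays hca hbc (fun s hs => (memY s hs).1) fun s hs => (memX s hs).2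
  · exact inter_cornerHull_of_rays hab hca (fun s hs => (memZ s hs).1) fun s hs => (memY s hs).2
  · exact inter_cornerHull_of_rays hbc hab (fun s hs => (memX s hs).1) fun s hs => (memZ s hs).2

end rainbow

/-! ### Assembling the polygon from a central triangle -/

section tiling

open Geometry

variable {i : Fin 2} {F X Y Z a b c : Plane} {A B C AY AZ BZ BX CX CY : Finset Plane}
  {Bi : Plane → Plane → Prop}

/-- Filling the corner at `X` with triangles. -/
theorem Config.exists_corner_tiling (h : Config i F X Y Z A B C) {t : List Plane}
    {K : SimplicialComplex ℝ Plane} (hb : b ∈ B ∨ b = Z) (hc : c ∈ C ∨ c = Y) (hBX : BX ⊆ B)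
    (hCX : CX ⊆ C) (hX : ∀ s, s ∈ BX ∨ s ∈ CX ∨ s = X → 0 < orient i c b s)
    (hBi : ∀ x ∈ insert b BX, ∀ z ∈ insert c CX, Bi x z ∧ Bi z x)
    (hK : IsPolygonTiling Bi (c :: t ++ [b]) K)
    (hdisj : K.space ∩ cornerHull b c X BX CX ⊆ segment ℝ b c) :
    ∃ (u v : List Plane) (K' : SimplicialComplex ℝ Plane),
      (∀ s, s ∈ u ↔ s ∈ BX) ∧ (∀ s, s ∈ v ↔ s ∈ CX) ∧
      IsPolygonTiling Bi (X :: v ++ c :: t ++ b :: u) K' ∧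
      K'.space ⊆ K.space ∪ cornerHull b c X BX CX := by
  have hX' : ∀ s, s ∈ BX ∨ s ∈ CX ∨ s = X → 0 < orient (i + 1) b c s := by
    intro s hs
    rw [orient_flip, ← orient_swap]; exact hX s hs
  have hBmem : ∀ x ∈ insert b BX, x ∈ B ∨ x = Z := by
    intro x hx
    rcases Finset.mem_insert.1 hx with rfl | hx
    · exact hb
    · exact Or.inl (hBX hx)
  have hCmem : ∀ x ∈ insert c CX, x ∈ C ∨ x = Y := by
    intro x hx
    rcases Finset.mem_insert.1 hx with rfl | hx
    · exact hc
    · exact Or.inl (hCX hx)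
  -- The polygon runs counterclockwise for `i`, so its exterior is to the right of the side `b c`.
  -- The strip lemma adds points on the left, hence the orientation `i + 1`.
  obtain ⟨u, v, K', hu, hv, hK', hs⟩ := exists_strip_tiling (i := i + 1) (F := F)
    (S := ({F, X, Y, Z} : Set Plane) ∪ (A ∪ B ∪ C)) (Q := X)
    (fun x hx y hy z hz h1 h2 h3 => by
      rw [orient_flip]; exact neg_ne_zero.2 (h.gen x hx y hy z hz h1 h2 h3))
    (by simp) (BX.card + CX.card) BX CX b c t K rfl (by simp; tauto) (by simp; tauto)
    (fun s hs => by have := hBX hs; simp [this]) (fun s hs => by have := hCX hs; simp [this]) hK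
    (fun s hs => hX' s (Or.inl hs)) (fun s hs => hX' s (Or.inr (Or.inl hs)))
    (hX' X (Or.inr (Or.inr rfl)))
    (fun x hx => by
      rw [orient_flip, ← orient_swap_right]; exact (h.pos_of_B (hBmem x hx)).1)
    (fun x hx => by
      rw [orient_flip]; linarith [(h.pos_of_C (hCmem x hx)).1])
    (fun x hx z hz => by
      rw [orient_flip, ← orient_swap, ← orient_rotate]
      exact h.orient_corner (hCmem z hz) (hBmem x hx))
    hBi hdisj
  exact ⟨u, v, K', fun s => by rw [hu.mem_iff, Finset.mem_toList],
    fun s => by rw [hv.mem_iff, Finset.mem_toList], hK', hs⟩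

theorem triangle_inter_cornerHull {q r p Q : Plane} {U V : Finset Plane} (h : 0 < orient i q r p)
    (hU : ∀ s, s ∈ U ∨ s ∈ V ∨ s = Q → 0 < orient i r q s) :
    convexHull ℝ {q, r, p} ∩ cornerHull q r Q U V ⊆ segment ℝ q r := by
  rintro x ⟨hx, hx'⟩
  refine mem_of_mem_convexHull_of_orient_nonpos (i := i) (g := r) (h := q)
    (convex_segment q r) (fun z hz => ?_) ?_ hx' (orient_nonpos_of_mem_convexHull ?_ hx)
  · rw [orient_swap, orient_eq_zero_of_mem_segment hz, neg_zero]
  · exact forall_mem_corner (Or.inr (left_mem_segment _ _ _)) (Or.inr (right_mem_segment _ _ _))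
      fun s hs => Or.inl (hU s hs)
  · rintro z (rfl | rfl | rfl)
    · simp
    · simp
    · rw [orient_swap]; linarith

theorem convexHull_triple_rotate (a b c : Plane) :
    convexHull ℝ ({a, b, c} : Set Plane) = convexHull ℝ {b, c, a} := by
  congr 1; ext; simp; tauto

theorem perm_toList {l : List Plane} {S : Finset Plane} (hl : l.Nodup) (h : ∀ s, s ∈ l ↔ s ∈ S) :
    l.Perm S.toList :=
  (List.perm_ext_iff_of_nodup hl S.nodup_toList).2 fun s => by rw [h, Finset.mem_toList]

theorem IsPolygonTiling.exists_perm {K : SimplicialComplex ℝ Plane} {lA lB lC : List Plane}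
    (hK : IsPolygonTiling Bi (X :: lC ++ Y :: lA ++ Z :: lB) K) (hA : ∀ s, s ∈ A ↔ s ∈ lA)
    (hB : ∀ s, s ∈ B ↔ s ∈ lB) (hC : ∀ s, s ∈ C ↔ s ∈ lC) :
    ∃ (lA lB lC : List Plane) (K : SimplicialComplex ℝ Plane), lA.Perm A.toList ∧
      lB.Perm B.toList ∧ lC.Perm C.toList ∧
      IsPolygonTiling Bi (X :: lC ++ Y :: lA ++ Z :: lB) K := by
  have := hK.nodup
  simp only [List.cons_append, List.nodup_cons, List.nodup_append] at this
  exact ⟨lA, lB, lC, K, perm_toList (by tauto) fun s => (hA s).symm,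
    perm_toList (by tauto) fun s => (hB s).symm, perm_toList (by tauto) fun s => (hC s).symm, hK⟩

/-- The corners at `Y`, `Z` and `X` are filled one after another, with the list rotated so that the
side in question is the closing one. The pairwise intersections in `CentralTriangle` keep a new
corner away from the earlier ones. If `c = Y` or `b = Z`, the corresponding corner is empty and is
skipped; this is why `hX` must also cover `Y` and `Z`. -/
theorem CentralTriangle.exists_tiling (h : Config i F X Y Z A B C)
    (hT : CentralTriangle i X Y Z A B C a b c AY AZ BZ BX CX CY)
    (hX : ∀ x, x ∈ B ∨ x = Z → ∀ z, z ∈ C ∨ z = Y → ¬ (x = Z ∧ z = Y) → Bi x z ∧ Bi z x)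
    (hY : ∀ x ∈ C, ∀ z ∈ A, Bi x z ∧ Bi z x) (hZ : ∀ x ∈ A, ∀ z ∈ B, Bi x z ∧ Bi z x) :
    ∃ (lA lB lC : List Plane) (K : SimplicialComplex ℝ Plane), lA.Perm A.toList ∧
      lB.Perm B.toList ∧ lC.Perm C.toList ∧
      IsPolygonTiling Bi (X :: lC ++ Y :: lA ++ Z :: lB) K := by
  obtain ⟨K₀, hK₀, hs₀⟩ := IsPolygonTiling.triangle (Bi := Bi) hT.tri
  have hY0 : Y ∉ C := fun k => by simpa using h.hC _ k
  have hZ0 : Z ∉ B := fun k => by simpa using h.hB _ k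
  have sA := fun s hs => (hT.memA s).2 (Or.inr hs)
  have sB := fun s hs => (hT.memB s).2 (Or.inr hs)
  have sC := fun s hs => (hT.memC s).2 (Or.inr hs)
  have biX : ∀ x ∈ insert b BX, ∀ z ∈ insert c CX, Bi x z ∧ Bi z x := by
    intro x hx z hz
    have hx' : x = b ∨ x ∈ B := by
      rcases Finset.mem_insert.1 hx with h1 | h1
      · exact Or.inl h1
      · exact Or.inr (sB x (Or.inr h1))
    have hz' : z = c ∨ z ∈ C := by
      rcases Finset.mem_insert.1 hz with h1 | h1
      · exact Or.inl h1
      · exact Or.inr (sC z (Or.inl h1))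
    refine hX x ?_ z ?_ ?_
    · rcases hx' with rfl | h1
      · exact hT.hb
      · exact Or.inl h1
    · rcases hz' with rfl | h1
      · exact hT.hc
      · exact Or.inl h1
    · rintro ⟨rfl, rfl⟩
      rcases hx' with h1 | h1
      · rcases hz' with h2 | h2
        · exact hT.ne ⟨h1.symm, h2.symm⟩
        · exact hY0 h2
      · exact hZ0 h1
  have d0X : K₀.space ∩ cornerHull b c X BX CX ⊆ segment ℝ b c := by
    rw [hs₀, convexHull_triple_rotate, convexHull_triple_rotate]
    exact triangle_inter_cornerHull (by rw [← orient_rotate, ← orient_rotate]; exact hT.tri)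
      hT.cornerX
  have stepX := fun t K => h.exists_corner_tiling (t := t) (K := K) hT.hb hT.hc
    (fun s hs => sB s (Or.inr hs)) (fun s hs => sC s (Or.inl hs)) hT.cornerX biX
  have stepY : c ≠ Y → ∃ (u v : List Plane) (K : SimplicialComplex ℝ Plane),
      (∀ s, s ∈ u ↔ s ∈ CY) ∧ (∀ s, s ∈ v ↔ s ∈ AY) ∧
      IsPolygonTiling Bi (Y :: v ++ a :: [b] ++ c :: u) K ∧
      K.space ⊆ K₀.space ∪ cornerHull c a Y CY AY := by
    intro hcY
    have hc := hT.hc.resolve_right hcY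
    refine h.rotate.exists_corner_tiling (Or.inl hc) (Or.inl hT.ha)
      (fun s hs => sC s (Or.inr hs)) (fun s hs => sA s (Or.inl hs)) (hT.cornerY hcY) ?_
      (IsPolygonTiling.rotate (l₁ := [c]) (l₂ := [a, b]) hK₀) ?_
    · intro x hx z hz
      refine hY x ?_ z ?_
      · rcases Finset.mem_insert.1 hx with rfl | h1
        · exact hc
        · exact sC x (Or.inr h1)
      · rcases Finset.mem_insert.1 hz with rfl | h1
        · exact hT.ha
        · exact sA z (Or.inl h1)
    · rw [hs₀]; exact triangle_inter_cornerHull hT.tri (hT.cornerY hcY)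
  have stepZ : b ≠ Z → ∀ t K, IsPolygonTiling Bi (b :: t ++ [a]) K →
      K.space ⊆ K₀.space ∪ cornerHull c a Y CY AY →
      ∃ (u v : List Plane) (K' : SimplicialComplex ℝ Plane),
      (∀ s, s ∈ u ↔ s ∈ AZ) ∧ (∀ s, s ∈ v ↔ s ∈ BZ) ∧
      IsPolygonTiling Bi (Z :: v ++ b :: t ++ a :: u) K' ∧
      K'.space ⊆ K.space ∪ cornerHull a b Z AZ BZ := by
    intro hbZ t K hK hs
    have hb := hT.hb.resolve_right hbZ
    refine h.rotate.rotate.exists_corner_tiling (Or.inl hT.ha) (Or.inl hb)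
      (fun s hs => sA s (Or.inr hs)) (fun s hs => sB s (Or.inl hs)) (hT.cornerZ hbZ) ?_ hK ?_
    · intro x hx z hz
      refine hZ x ?_ z ?_
      · rcases Finset.mem_insert.1 hx with rfl | h1
        · exact hT.ha
        · exact sA x (Or.inr h1)
      · rcases Finset.mem_insert.1 hz with rfl | h1
        · exact hb
        · exact sB z (Or.inl h1)
    · rintro x ⟨hx, hx'⟩
      rcases hs hx with h1 | h1
      · rw [hs₀, convexHull_triple_rotate] at h1
        exact triangle_inter_cornerHull (by rw [← orient_rotate]; exact hT.tri)
          (hT.cornerZ hbZ) ⟨h1, hx'⟩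
      · rw [hT.interYZ ⟨h1, hx'⟩]; exact left_mem_segment _ _ _
  have dX : ∀ K : SimplicialComplex ℝ Plane, K.space ⊆ K₀.space ∪ cornerHull c a Y CY AY ∪
      cornerHull a b Z AZ BZ → K.space ∩ cornerHull b c X BX CX ⊆ segment ℝ b c := by
    rintro K hK x ⟨hx, hx'⟩
    rcases hK hx with (h1 | h1) | h1
    · exact d0X ⟨h1, hx'⟩
    · rw [hT.interXY ⟨hx', h1⟩]; exact right_mem_segment _ _ _
    · rw [hT.interZX ⟨h1, hx'⟩]; exact left_mem_segment _ _ _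
  by_cases hcY : c = Y
  · obtain ⟨rfl, rfl⟩ := hT.degY hcY
    subst hcY
    have hbZ : b ≠ Z := fun k => hT.ne ⟨k, rfl⟩
    obtain ⟨uZ, vZ, K₂, huZ, hvZ, hK₂, hs₂⟩ := stepZ hbZ [c] K₀
      (IsPolygonTiling.rotate (l₁ := [c, a]) (l₂ := [b]) hK₀) Set.subset_union_left
    have hK₂' := IsPolygonTiling.rotate (l₁ := Z :: vZ ++ [b]) (l₂ := c :: a :: uZ) (K := K₂) (Bi := Bi)
      (by simpa using hK₂)
    obtain ⟨uX, vX, K₃, huX, hvX, hK₃, -⟩ := stepX (a :: uZ ++ Z :: vZ) K₂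
      (by simpa using hK₂')
      (dX K₂ (hs₂.trans (Set.union_subset_union_left _ Set.subset_union_left)))
    refine IsPolygonTiling.exists_perm (lA := a :: uZ) (lB := vZ ++ b :: uX) (lC := vX)
      (K := K₃) (by simpa using hK₃) (fun s => ?_) (fun s => ?_) fun s => ?_
    · rw [hT.memA]; simp [huZ]
    · rw [hT.memB]; simp [hvZ, huX, hbZ]; tauto
    · rw [hT.memC]; simp [hvX]
  obtain ⟨uY, vY, K₁, huY, hvY, hK₁, hs₁⟩ := stepY hcY
  by_cases hbZ : b = Z
  · obtain ⟨rfl, rfl⟩ := hT.degZ hbZ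
    subst hbZ
    have hK₁' := IsPolygonTiling.rotate (l₁ := Y :: vY ++ [a, b]) (l₂ := c :: uY) (K := K₁) (Bi := Bi)
      (by simpa using hK₁)
    obtain ⟨uX, vX, K₃, huX, hvX, hK₃, -⟩ := stepX (uY ++ Y :: vY ++ [a]) K₁
      (by simpa using hK₁')
      (dX K₁ (hs₁.trans Set.subset_union_left))
    refine IsPolygonTiling.exists_perm (lA := vY ++ [a]) (lB := uX) (lC := vX ++ c :: uY)
      (K := K₃) (by simpa using hK₃) (fun s => ?_) (fun s => ?_) fun s => ?_
    · rw [hT.memA]; simp [hvY]; tauto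
    · rw [hT.memB]; simp [huX]
    · rw [hT.memC]; simp [hvX, huY, hcY]; tauto
  · have hK₁' := IsPolygonTiling.rotate (l₁ := Y :: vY ++ [a]) (l₂ := b :: c :: uY) (K := K₁) (Bi := Bi)
      (by simpa using hK₁)
    obtain ⟨uZ, vZ, K₂, huZ, hvZ, hK₂, hs₂⟩ := stepZ hbZ (c :: uY ++ Y :: vY) K₁
      (by simpa using hK₁') hs₁
    have hK₂' := IsPolygonTiling.rotate (l₁ := Z :: vZ ++ [b]) (l₂ := c :: uY ++ Y :: vY ++ a :: uZ) (K := K₂) (Bi := Bi)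
      (by simpa using hK₂)
    obtain ⟨uX, vX, K₃, huX, hvX, hK₃, -⟩ := stepX (uY ++ Y :: vY ++ a :: uZ ++ Z :: vZ) K₂
      (by simpa using hK₂')
      (dX K₂ (hs₂.trans (Set.union_subset_union_left _ hs₁)))
    refine IsPolygonTiling.exists_perm (lA := vY ++ a :: uZ) (lB := vZ ++ b :: uX)
      (lC := vX ++ c :: uY) (K := K₃) (by simpa using hK₃) (fun s => ?_) (fun s => ?_) fun s => ?_
    · rw [hT.memA]; simp [hvY, huZ]; tauto
    · rw [hT.memB]; simp [hvZ, huX, hbZ]; tauto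
    · rw [hT.memC]; simp [hvX, huY, hcY]; tauto

end tiling

/-! ### An empty triangle around `F` -/

section empty

variable {i : Fin 2} {F x y z : Plane}

/-- Among the triangles around `F` with vertices in `S` there is one without further points
of `S`. -/
theorem exists_empty_triangle {S : Finset Plane} (hF : F ∉ S)
    (hgen : ∀ a ∈ insert F (S : Set Plane), ∀ b ∈ insert F (S : Set Plane),
      ∀ c ∈ insert F (S : Set Plane), a ≠ b → b ≠ c → a ≠ c → orient i a b c ≠ 0)
    (hx : x ∈ S) (hy : y ∈ S) (hz : z ∈ S) (hxy : 0 < orient i F x y) (hyz : 0 < orient i F y z)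
    (hzx : 0 < orient i F z x) :
    ∃ p ∈ S, ∃ q ∈ S, ∃ r ∈ S, 0 < orient i F p q ∧ 0 < orient i F q r ∧ 0 < orient i F r p ∧
      ∀ s ∈ S, s ≠ p → s ≠ q → s ≠ r →
        orient i p q s < 0 ∨ orient i q r s < 0 ∨ orient i r p s < 0 := by
  classical
  let N : Plane → Plane → Plane → Finset Plane := fun p q r =>
    S.filter (· ∈ convexHull ℝ {p, q, r})
  let T := (S ×ˢ S ×ˢ S).filter fun e => 0 < orient i F e.1 e.2.1 ∧ 0 < orient i F e.2.1 e.2.2 ∧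
    0 < orient i F e.2.2 e.1
  have memT : ∀ p q r, (p, q, r) ∈ T ↔ (p ∈ S ∧ q ∈ S ∧ r ∈ S) ∧ 0 < orient i F p q ∧
      0 < orient i F q r ∧ 0 < orient i F r p := by
    intro p q r; simp [T]
  -- Among the triangles around `F`, one containing the fewest points of `S` is chosen.
  obtain ⟨⟨p, q, r⟩, hT, hmin⟩ := T.exists_min_image (fun e => (N e.1 e.2.1 e.2.2).card)
    ⟨(x, y, z), (memT _ _ _).2 ⟨⟨hx, hy, hz⟩, hxy, hyz, hzx⟩⟩
  obtain ⟨⟨hp, hq, hr⟩, hpq, hqr, hrp⟩ := (memT _ _ _).1 hT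
  refine ⟨p, hp, q, hq, r, hr, hpq, hqr, hrp, fun s hs hsp hsq hsr => ?_⟩
  by_contra! hcon
  have htri : 0 < orient i p q r := by rw [← orient_add_add i p q r F]; linarith
  have hsN : s ∈ N p q r := Finset.mem_filter.2 ⟨hs, (mem_triangle_iff htri).2 hcon⟩
  have hne : ∀ u ∈ S, F ≠ u := by rintro u hu rfl; exact hF hu
  have genF : ∀ u ∈ S, u ≠ s → orient i F u s ≠ 0 := fun u hu hus =>
    hgen F (by simp) u (by simp [hu]) s (by simp [hs]) (hne u hu) hus (hne s hs)
  -- Under these signs `F` is also surrounded by the triangle with `r'` replaced by `s`. It is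
  -- contained in the old one and no longer contains `r'`, contrary to minimality.
  have key : ∀ p' q' r', (p', q', r') ∈ T → N p' q' r' = N p q r → s ≠ q' → s ≠ r' →
      orient i F p' s < 0 → 0 < orient i F q' s → False := by
    intro p q r hT hN hsq hsr hps hqs
    have hs' := (Finset.mem_filter.1 (hN ▸ hsN)).2
    obtain ⟨⟨hp, hq, hr⟩, hpq, hqr, hrp⟩ := (memT _ _ _).1 hT
    have hsp : 0 < orient i F s p := by rw [orient_swap_right]; linarith
    have htri : 0 < orient i p q r := by rw [← orient_add_add i p q r F]; linarith
    have htri' : 0 < orient i p q s := by rw [← orient_add_add i p q s F]; linarith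
    refine absurd (hmin (p, q, s) ((memT _ _ _).2 ⟨⟨hp, hq, hs⟩, hpq, hqs, hsp⟩)) (not_le.2 ?_)
    rw [← hN]
    refine Finset.card_lt_card ?_
    refine (Finset.ssubset_iff_of_subset ?_).2 ⟨r, ?_, ?_⟩
    · intro u hu
      simp only [N, Finset.mem_filter] at hu ⊢
      refine ⟨hu.1, convexHull_min ?_ (convex_convexHull ℝ _) hu.2⟩
      rintro w (rfl | rfl | rfl)
      · exact subset_convexHull ℝ _ (by simp)
      · exact subset_convexHull ℝ _ (by simp)
      · exact hs'
    · simp only [N, Finset.mem_filter]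
      exact ⟨hr, subset_convexHull ℝ _ (by simp)⟩
    · simp only [N, Finset.mem_filter, mem_triangle_iff htri', not_and]
      intro _ _ h2
      have h1 := ((mem_triangle_iff htri).1 hs').2.1
      rw [orient_swap_right] at h2
      have hqr : q ≠ r := by rintro rfl; simp at hqr
      exact absurd (by linarith) (hgen q (by simp [hq]) r (by simp [hr]) s (by simp [hs]) hqr
        hsr.symm hsq.symm)
  have e := orient_plucker i F p q r s
  have n1 := key p q r hT rfl hsq hsr
  have n2 := key q r p ((memT _ _ _).2 ⟨⟨hq, hr, hp⟩, hqr, hrp, hpq⟩)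
    (by simp only [N, convexHull_triple_rotate p q r]) hsr hsp
  have n3 := key r p q ((memT _ _ _).2 ⟨⟨hr, hp, hq⟩, hrp, hpq, hqr⟩)
    (by simp only [N, convexHull_triple_rotate r p q]) hsp hsq
  -- The Plücker relation `e` excludes three equal signs. Every other pattern has a negative sign
  -- followed cyclically by a positive one, so `key` applies after a rotation.
  rcases (genF p hp hsp.symm).lt_or_gt with h1 | h1 <;>
    rcases (genF q hq hsq.symm).lt_or_gt with h2 | h2 <;>
    rcases (genF r hr hsr.symm).lt_or_gt with h3 | h3
  · nlinarith [mul_pos hpq (neg_pos.2 h3), mul_pos hqr (neg_pos.2 h1), mul_pos hrp (neg_pos.2 h2)]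
  · exact n2 h2 h3
  · exact n1 h1 h2
  · exact n1 h1 h2
  · exact n3 h3 h1
  · exact n2 h2 h3
  · exact n3 h3 h1
  · nlinarith [mul_pos hpq h3, mul_pos hqr h1, mul_pos hrp h2]

end empty

/-! ### Which empty triangles occur when there is no front -/

section classification

open Geometry

variable {i : Fin 2} {F X Y Z a b c p q r s : Plane} {A B C : Finset Plane}
  {Bi : Plane → Plane → Prop}

/-- The six groups of points, in their cyclic order along the boundary of the triangle. -/
def pointGroup (X Y Z : Plane) (A B C : Finset Plane) : Fin 6 → Set Plane :=
  ![{X}, C, {Y}, A, {Z}, B]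

theorem pointGroup_rotate (X Y Z : Plane) (A B C : Finset Plane) (k : Fin 6) :
    pointGroup Y Z X B C A k = pointGroup X Y Z A B C (k + 2) := by
  fin_cases k <;> rfl

/-- The possible groups of the endpoints of a side of a triangle around `F`. -/
def GroupStep (k l : Fin 6) : Prop :=
  l = k + 1 ∨ (k.val % 2 = 1 ∧ (l = k ∨ l = k + 2))

instance : DecidableRel GroupStep := fun k l => by unfold GroupStep; infer_instance

theorem groupStep_add_two : ∀ k l : Fin 6, GroupStep (k + 2) (l + 2) → GroupStep k l := by decide

theorem groupStep_add_four : ∀ k l : Fin 6, GroupStep (k + 4) (l + 4) → GroupStep k l := by decide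

/-- Each step advances by 0, 1 or 2 modulo 6, so a closed triple of steps advances by 0 or 6 in
total. In the first case all groups coincide. In the second all steps are 2, which is only possible
from odd groups. -/
theorem groupStep_cycle : ∀ k l m : Fin 6, GroupStep k l → GroupStep l m → GroupStep m k →
    (k = l ∧ l = m) ∨ (k = 1 ∧ l = 3 ∧ m = 5) ∨ (k = 3 ∧ l = 5 ∧ m = 1) ∨
      (k = 5 ∧ l = 1 ∧ m = 3) := by decide

namespace Config

/-- All of `A` lies in the sector between `c` and `b`, and a point of that sector outside the
triangle is beyond the side `c b` by `pos_of_sector`. -/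
theorem isFront_of_empty (h : Config i F X Y Z A B C) (hc : c ∈ C ∨ c = Y) (hb : b ∈ B ∨ b = Z)
    (hcb : 0 < orient i F c b) (hbr : 0 < orient i F b r) (hrc : 0 < orient i F r c)
    (hempty : ∀ s ∈ A, s ≠ c → s ≠ b → s ≠ r →
      orient i c b s < 0 ∨ orient i b r s < 0 ∨ orient i r c s < 0) :
    IsFront i F Y Z A B C c b := by
  refine ⟨hc, hb, hcb, fun s hs => ?_⟩
  have hf : IsFront i F Y Z ∅ B C c b := ⟨hc, hb, hcb, by simp⟩
  have hcs := hf.c_A h hs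
  have hsb := hf.A_b h hs
  have h0 := pos_of_sector hcb hbr hrc ⟨hcs, hsb⟩ (hempty s hs (by rintro rfl; simp at hcs)
    (by rintro rfl; simp at hsb) (by rintro rfl; linarith [orient_swap_right i F s c]))
  rw [orient_swap]; linarith

/-- The second and third alternatives are the end positions of a front opposite `X` and of one
opposite `Z`. Every remaining pair is a permitted step or contradicts the angular order. -/
theorem groupStep_of_zero_or_one (h : Config i F X Y Z A B C) {k l : Fin 6} (hk : k = 0 ∨ k = 1)
    (hp : p ∈ pointGroup X Y Z A B C k) (hq : q ∈ pointGroup X Y Z A B C l)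
    (hpq : 0 < orient i F p q) :
    GroupStep k l ∨ ((p ∈ C ∨ p = Y) ∧ (q ∈ B ∨ q = Z)) ∨ ((p ∈ B ∨ p = X) ∧ (q ∈ A ∨ q = Y)) := by
  have hB : ∀ s, s ∈ B ∨ s = Z → orient i F X s < 0 := fun s hs => by
    rw [orient_swap_right]; linarith [(h.pos_of_B hs).1]
  rcases hk with rfl | rfl
  · obtain rfl : p = X := hp
    fin_cases l
    · obtain rfl : q = p := hq
      simp at hpq
    · left; decide
    · exact Or.inr (Or.inr ⟨Or.inr rfl, Or.inr hq⟩)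
    · exact Or.inr (Or.inr ⟨Or.inr rfl, Or.inl hq⟩)
    · linarith [hB q (Or.inr hq)]
    · linarith [hB q (Or.inl hq)]
  · have hp : p ∈ C := hp
    fin_cases l
    · obtain rfl : q = X := hq
      linarith [(h.hC p hp).1, orient_swap_right i F p q]
    · left; decide
    · left; decide
    · left; decide
    · exact Or.inr (Or.inl ⟨Or.inl hp, Or.inr hq⟩)
    · exact Or.inr (Or.inl ⟨Or.inl hp, Or.inl hq⟩)

/-- Renaming the corners cyclically shifts the groups by two, which brings the starting group to 0
or 1. -/
theorem groupStep (h : Config i F X Y Z A B C) {side : Plane → Plane → Prop}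
    (hpos : ∀ p q, side p q → 0 < orient i F p q)
    (nX : ∀ p q, p ∈ C ∨ p = Y → q ∈ B ∨ q = Z → ¬ side p q)
    (nY : ∀ p q, p ∈ A ∨ p = Z → q ∈ C ∨ q = X → ¬ side p q)
    (nZ : ∀ p q, p ∈ B ∨ p = X → q ∈ A ∨ q = Y → ¬ side p q) {k l : Fin 6}
    (hp : p ∈ pointGroup X Y Z A B C k) (hq : q ∈ pointGroup X Y Z A B C l) (hpq : side p q) :
    GroupStep k l := by
  have hk : ∀ k : Fin 6, (k = 0 ∨ k = 1) ∨ (k + 4 = 0 ∨ k + 4 = 1) ∨ (k + 2 = 0 ∨ k + 2 = 1) := by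
    decide
  have hk2 : ∀ k : Fin 6, k + 4 + 2 = k := by decide
  have hk4 : ∀ k : Fin 6, k + 2 + 2 + 2 = k := by decide
  rcases hk k with h0 | h0 | h0
  · rcases h.groupStep_of_zero_or_one h0 hp hq (hpos p q hpq) with h1 | h1 | h1
    · exact h1
    · exact absurd hpq (nX p q h1.1 h1.2)
    · exact absurd hpq (nZ p q h1.1 h1.2)
  · rcases h.rotate.groupStep_of_zero_or_one (p := p) (q := q) (l := l + 4) h0
      (by rwa [pointGroup_rotate, hk2]) (by rwa [pointGroup_rotate, hk2]) (hpos p q hpq)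
      with h1 | h1 | h1
    · exact groupStep_add_four _ _ h1
    · exact absurd hpq (nY p q h1.1 h1.2)
    · exact absurd hpq (nX p q h1.1 h1.2)
  · rcases h.rotate.rotate.groupStep_of_zero_or_one (p := p) (q := q) (l := l + 2) h0
      (by rwa [pointGroup_rotate, pointGroup_rotate, hk4])
      (by rwa [pointGroup_rotate, pointGroup_rotate, hk4]) (hpos p q hpq)
      with h1 | h1 | h1
    · exact groupStep_add_two _ _ h1
    · exact absurd hpq (nZ p q h1.1 h1.2)
    · exact absurd hpq (nY p q h1.1 h1.2)

/-- The vertices of a triangle around `F` do not belong to the same group. -/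
theorem not_subset_pointGroup (h : Config i F X Y Z A B C) (k : Fin 6)
    (hpq : 0 < orient i F p q) (hqr : 0 < orient i F q r) (hrp : 0 < orient i F r p)
    (hp : p ∈ pointGroup X Y Z A B C k) (hq : q ∈ pointGroup X Y Z A B C k)
    (hr : r ∈ pointGroup X Y Z A B C k) : False := by
  have key : ∀ Q, 0 < orient i F Q p → 0 < orient i F Q q → 0 < orient i F Q r → False := by
    intro Q h1 h2 h3
    have e := orient_plucker i F p q Q r
    rw [orient_swap_right i F q Q, orient_swap_right i F p r] at e
    nlinarith [mul_pos hpq h3, mul_pos h2 hrp, mul_pos h1 hqr]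
  have key' : p = q → False := by rintro rfl; simp at hpq
  fin_cases k
  · exact key' (hp.trans hq.symm)
  · exact key X (h.hC p hp).1 (h.hC q hq).1 (h.hC r hr).1
  · exact key' (hp.trans hq.symm)
  · exact key Y (h.hA p hp).1 (h.hA q hq).1 (h.hA r hr).1
  · exact key' (hp.trans hq.symm)
  · exact key Z (h.hB p hp).1 (h.hB q hq).1 (h.hB r hr).1

/-- If a front exists for one of the three corners, it gives a central triangle. If there is none,
an empty triangle around `F` has to be a rainbow triangle. -/
theorem exists_tiling (h : Config i F X Y Z A B C) (hA : A.Nonempty) (hB : B.Nonempty)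
    (hC : C.Nonempty)
    (hX : ∀ x, x ∈ B ∨ x = Z → ∀ z, z ∈ C ∨ z = Y → ¬ (x = Z ∧ z = Y) → Bi x z ∧ Bi z x)
    (hY : ∀ x, x ∈ C ∨ x = X → ∀ z, z ∈ A ∨ z = Z → ¬ (x = X ∧ z = Z) → Bi x z ∧ Bi z x)
    (hZ : ∀ x, x ∈ A ∨ x = Y → ∀ z, z ∈ B ∨ z = X → ¬ (x = Y ∧ z = X) → Bi x z ∧ Bi z x) :
    ∃ (lA lB lC : List Plane) (K : SimplicialComplex ℝ Plane), lA.Perm A.toList ∧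
      lB.Perm B.toList ∧ lC.Perm C.toList ∧
      IsPolygonTiling Bi (X :: lC ++ Y :: lA ++ Z :: lB) K := by
  classical
  have hFX : F ≠ X := by rintro rfl; simpa using h.XY
  have hFY : F ≠ Y := by rintro rfl; simpa using h.YZ
  have hFZ : F ≠ Z := by rintro rfl; simpa using h.ZX
  have hAX : ∀ s ∈ A, s ≠ Y ∧ s ≠ Z := by
    intro s hs; have := h.hA s hs; constructor <;> rintro rfl <;> simp at this
  have hBX : ∀ s ∈ B, s ≠ Z ∧ s ≠ X := by
    intro s hs; have := h.hB s hs; constructor <;> rintro rfl <;> simp at this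
  have hCX : ∀ s ∈ C, s ≠ X ∧ s ≠ Y := by
    intro s hs; have := h.hC s hs; constructor <;> rintro rfl <;> simp at this
  by_cases fX : ∃ c b, IsFront i F Y Z A B C c b
  · obtain ⟨c, b, hf⟩ := fX
    obtain ⟨a, b, c, AY, AZ, BZ, BX, CX, CY, hT⟩ := hf.exists_central h hA
    exact hT.exists_tiling h hX
      (fun x hx z hz => hY x (Or.inl hx) z (Or.inl hz) fun k => (hCX x hx).1 k.1)
      (fun x hx z hz => hZ x (Or.inl hx) z (Or.inl hz) fun k => (hAX x hx).1 k.1)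
  by_cases fY : ∃ c b, IsFront i F Z X B C A c b
  · obtain ⟨c, b, hf⟩ := fY
    obtain ⟨a, b, c, AY, AZ, BZ, BX, CX, CY, hT⟩ := hf.exists_central h.rotate hB
    obtain ⟨lB, lC, lA, K, h1, h2, h3, hK⟩ := hT.exists_tiling h.rotate hY
      (fun x hx z hz => hZ x (Or.inl hx) z (Or.inl hz) fun k => (hAX x hx).1 k.1)
      (fun x hx z hz => hX x (Or.inl hx) z (Or.inl hz) fun k => (hBX x hx).1 k.1)
    exact ⟨lA, lB, lC, K, h3, h1, h2, by
      simpa using IsPolygonTiling.rotate (l₁ := Y :: lA ++ Z :: lB) (l₂ := X :: lC) hK⟩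
  by_cases fZ : ∃ c b, IsFront i F X Y C A B c b
  · obtain ⟨c, b, hf⟩ := fZ
    obtain ⟨a, b, c, AY, AZ, BZ, BX, CX, CY, hT⟩ := hf.exists_central h.rotate.rotate hC
    obtain ⟨lC, lA, lB, K, h1, h2, h3, hK⟩ := hT.exists_tiling h.rotate.rotate hZ
      (fun x hx z hz => hX x (Or.inl hx) z (Or.inl hz) fun k => (hBX x hx).1 k.1)
      (fun x hx z hz => hY x (Or.inl hx) z (Or.inl hz) fun k => (hCX x hx).1 k.1)
    exact ⟨lA, lB, lC, K, h2, h3, h1, by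
      simpa using IsPolygonTiling.rotate (l₁ := Z :: lB) (l₂ := X :: lC ++ Y :: lA)
        (by simpa using hK)⟩
  -- The corners are included in `S`: the triangle `X Y Z` shows that some triangle surrounds `F`,
  -- and emptiness then also excludes corners, as `exists_central_of_rainbow` requires.
  obtain ⟨p, hp, q, hq, r, hr, hpq, hqr, hrp, hempty⟩ :=
    exists_empty_triangle (i := i) (F := F) (S := {X, Y, Z} ∪ (A ∪ B ∪ C)) (x := X) (y := Y)
      (z := Z)
      (by
        have h1 : F ∉ A := fun k => by simpa using h.hA F k
        have h2 : F ∉ B := fun k => by simpa using h.hB F k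
        have h3 : F ∉ C := fun k => by simpa using h.hC F k
        simp [hFX, hFY, hFZ, h1, h2, h3])
      (by
        have : insert F (({X, Y, Z} ∪ (A ∪ B ∪ C) : Finset Plane) : Set Plane) =
            ({F, X, Y, Z} : Set Plane) ∪ (A ∪ B ∪ C) := by
          ext; simp; tauto
        rw [this]; exact h.gen)
      (by simp) (by simp) (by simp) h.XY h.YZ h.ZX
  have mem : ∀ s ∈ ({X, Y, Z} ∪ (A ∪ B ∪ C) : Finset Plane), ∃ k, s ∈ pointGroup X Y Z A B C k := by
    intro s hs
    simp only [Finset.mem_union, Finset.mem_insert, Finset.mem_singleton] at hs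
    rcases hs with (hs | hs | hs) | (hs | hs) | hs
    exacts [⟨0, hs⟩, ⟨2, hs⟩, ⟨4, hs⟩, ⟨3, hs⟩, ⟨5, hs⟩, ⟨1, hs⟩]
  let S : Finset Plane := {X, Y, Z} ∪ (A ∪ B ∪ C)
  have memS : ∀ s, s ∈ A ∨ s ∈ B ∨ s ∈ C ∨ s = X ∨ s = Y ∨ s = Z → s ∈ S := by
    intro s hs; simp only [S, Finset.mem_union, Finset.mem_insert, Finset.mem_singleton]; tauto
  let empty : Plane → Plane → Plane → Prop := fun p q r =>
    (0 < orient i F p q ∧ 0 < orient i F q r ∧ 0 < orient i F r p) ∧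
    ∀ s ∈ S, s ≠ p → s ≠ q → s ≠ r → orient i p q s < 0 ∨ orient i q r s < 0 ∨ orient i r p s < 0
  have empty_rotate : ∀ p q r, empty p q r → empty q r p := fun p q r ⟨h1, h2⟩ =>
    ⟨⟨h1.2.1, h1.2.2, h1.1⟩, fun s hs k1 k2 k3 => by have := h2 s hs k3 k1 k2; tauto⟩
  have h0 : empty p q r := ⟨⟨hpq, hqr, hrp⟩, hempty⟩
  have step : ∀ {p q k l}, p ∈ pointGroup X Y Z A B C k → q ∈ pointGroup X Y Z A B C l →
      (∃ r, empty p q r) → GroupStep k l := by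
    intro p q k l hp hq hpq
    refine h.groupStep (side := fun p q => ∃ r, empty p q r) ?_ ?_ ?_ ?_ hp hq hpq
    · rintro p q ⟨r, h1, -⟩; exact h1.1
    · rintro p q hp hq ⟨r, h1, h2⟩
      exact fX ⟨p, q, h.isFront_of_empty hp hq h1.1 h1.2.1 h1.2.2
        fun s hs => h2 s (memS s (by tauto))⟩
    · rintro p q hp hq ⟨r, h1, h2⟩
      exact fY ⟨p, q, h.rotate.isFront_of_empty hp hq h1.1 h1.2.1 h1.2.2
        fun s hs => h2 s (memS s (by tauto))⟩
    · rintro p q hp hq ⟨r, h1, h2⟩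
      exact fZ ⟨p, q, h.rotate.rotate.isFront_of_empty hp hq h1.1 h1.2.1 h1.2.2
        fun s hs => h2 s (memS s (by tauto))⟩
  have rainbow : ∀ c a b, c ∈ C → a ∈ A → b ∈ B → empty c a b →
      ∃ (lA lB lC : List Plane) (K : SimplicialComplex ℝ Plane), lA.Perm A.toList ∧
        lB.Perm B.toList ∧ lC.Perm C.toList ∧
        IsPolygonTiling Bi (X :: lC ++ Y :: lA ++ Z :: lB) K := by
    rintro c a b hc ha hb ⟨h1, h2⟩
    obtain ⟨AY, AZ, BZ, BX, CX, CY, hT⟩ := h.exists_central_of_rainbow ha hb hc h1.1 h1.2.1 h1.2.2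
      fun s hs k1 k2 k3 => h2 s (memS s hs) k3 k1 k2
    exact hT.exists_tiling h hX
      (fun x hx z hz => hY x (Or.inl hx) z (Or.inl hz) fun k => (hCX x hx).1 k.1)
      (fun x hx z hz => hZ x (Or.inl hx) z (Or.inl hz) fun k => (hAX x hx).1 k.1)
  obtain ⟨k, hk⟩ := mem p hp
  obtain ⟨l, hl⟩ := mem q hq
  obtain ⟨m, hm⟩ := mem r hr
  have h1 := empty_rotate _ _ _ h0
  have h2 := empty_rotate _ _ _ h1
  rcases groupStep_cycle k l m (step hk hl ⟨r, h0⟩) (step hl hm ⟨p, h1⟩) (step hm hk ⟨q, h2⟩)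
    with ⟨rfl, rfl⟩ | ⟨rfl, rfl, rfl⟩ | ⟨rfl, rfl, rfl⟩ | ⟨rfl, rfl, rfl⟩
  · exact (h.not_subset_pointGroup k hpq hqr hrp hk hl hm).elim
  · exact rainbow p q r hk hl hm h0
  · exact rainbow r p q hm hk hl h2
  · exact rainbow q r p hl hm hk h1

end Config

end classification

/-! ### Sorting the given points, and the final statement -/

section main

variable {i : Fin 2} {F X Y Z s : Plane} {A B C : Finset Plane}

theorem polylineCarrier_subset {l : List Plane} {S : Set Plane} (hS : Convex ℝ S)
    (hl : ∀ p ∈ l, p ∈ S) : polylineCarrier l ⊆ S := by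
  rintro x ⟨p, q, hpq, hx⟩
  exact hS.segment_subset (hl p (hpq.subset (by simp))) (hl q (hpq.subset (by simp))) hx

theorem mem_chain_iff {l : List Plane} {S : Finset Plane} (hl : ∀ s, s ∈ l ↔ s ∈ S)
    {p q : Plane} : s ∈ p :: (l ++ [q]) ↔ s ∈ S ∨ s = p ∨ s = q := by
  simp [hl]; tauto

/-- Fixes the orientation of the plane in which the given triangle is counterclockwise. -/
theorem exists_orient_pos (h : AffineIndependent ℝ ![X, Y, Z]) : ∃ i, 0 < orient i X Y Z := by
  rcases ((affineIndependent_iff_orient 0 X Y Z).1 h).lt_or_gt with h | h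
  · exact ⟨0 + 1, by rw [orient_flip]; linarith⟩
  · exact ⟨0, h⟩

theorem mem_subtriangle_iff (hXY : 0 < orient i F X Y) (hX : orient i F X s ≠ 0)
    (hY : orient i F Y s ≠ 0) (hs : 0 ≤ orient i X Y s) :
    s ∈ convexHull ℝ {F, X, Y} ↔ 0 < orient i F X s ∧ 0 < orient i F s Y := by
  rw [mem_triangle_iff hXY, ← orient_rotate i F s Y |>.trans (orient_rotate i s Y F)]
  rw [orient_swap_right, neg_ne_zero] at hY
  exact ⟨fun h => ⟨h.1.lt_of_ne' hX, h.2.2.lt_of_ne' hY⟩, fun h => ⟨h.1.le, hs, h.2.le⟩⟩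

/-- Points of the triangle `X Y Z` in general position, sorted into the three subtriangles. -/
theorem config_of_generalPosition (hXYZ : 0 < orient i X Y Z)
    (hF : F ∈ convexHull ℝ {X, Y, Z}) (hA : (A : Set Plane) ⊆ convexHull ℝ {X, Y, Z})
    (hdisj : Disjoint {X, Y, Z, F} (A : Set Plane))
    (hgen : InGeneralPosition ({X, Y, Z, F} ∪ (A : Set Plane)))
    (hXY : ((A : Set Plane) ∩ convexHull ℝ {F, X, Y}).Nonempty)
    (hYZ : ((A : Set Plane) ∩ convexHull ℝ {F, Y, Z}).Nonempty) :
    ∃ A₁ B C : Finset Plane, Config i F X Y Z A₁ B C ∧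
      (∀ s, s ∈ A ↔ s ∈ A₁ ∨ s ∈ B ∨ s ∈ C) ∧
      (A₁ : Set Plane) = (A : Set Plane) ∩ convexHull ℝ {F, Y, Z} ∧
      (B : Set Plane) = (A : Set Plane) ∩ convexHull ℝ {F, Z, X} ∧
      (C : Set Plane) = (A : Set Plane) ∩ convexHull ℝ {F, X, Y} := by
  classical
  have gen : ∀ a ∈ ({X, Y, Z, F} ∪ (A : Set Plane)), ∀ b ∈ ({X, Y, Z, F} ∪ (A : Set Plane)),
      ∀ c ∈ ({X, Y, Z, F} ∪ (A : Set Plane)), a ≠ b → b ≠ c → a ≠ c → orient i a b c ≠ 0 :=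
    fun a ha b hb c hc h1 h2 h3 h0 =>
      hgen a ha b hb c hc h1 h2 h3 ((collinear_iff_orient i a b c).2 h0)
  have nXY : X ≠ Y := by rintro rfl; simp at hXYZ
  have nYZ : Y ≠ Z := by rintro rfl; simp at hXYZ
  have nXZ : X ≠ Z := by rintro rfl; simp at hXYZ
  have hne : ∀ s ∈ A, X ≠ s ∧ Y ≠ s ∧ Z ≠ s ∧ F ≠ s := by
    intro s hs
    have := fun p (hp : p ∈ ({X, Y, Z, F} : Set Plane)) =>
      hdisj.ne_of_mem hp (Finset.mem_coe.2 hs)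
    exact ⟨this X (by simp), this Y (by simp), this Z (by simp), this F (by simp)⟩
  -- If `F` were a corner, one of the two subtriangles assumed to contain points of `A` would shrink
  -- to a side of `X Y Z`, which contains none by general position.
  have collapse : ∀ p ∈ ({X, Y, Z} : Set Plane), ∀ q ∈ ({X, Y, Z} : Set Plane), p ≠ q →
      ¬ ((A : Set Plane) ∩ convexHull ℝ {p, q}).Nonempty := by
    rintro p hp q hq hpq ⟨s, hs, hs'⟩
    rw [convexHull_pair] at hs'
    have hs := Finset.mem_coe.1 hs
    have h1 := hne s hs
    refine gen p ?_ q ?_ s (by simp [hs]) hpq ?_ ?_ (orient_eq_zero_of_mem_segment hs')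
    · left; simp only [Set.mem_insert_iff, Set.mem_singleton_iff] at hp ⊢; tauto
    · left; simp only [Set.mem_insert_iff, Set.mem_singleton_iff] at hq ⊢; tauto
    · rcases hq with rfl | rfl | rfl <;> tauto
    · rcases hp with rfl | rfl | rfl <;> tauto
  have nFX : F ≠ X := by
    rintro rfl; exact collapse F (by simp) Y (by simp) nXY (by simpa using hXY)
  have nFY : F ≠ Y := by
    rintro rfl
    exact collapse F (by simp) X (by simp) nXY.symm
      (by rwa [Set.pair_comm, Set.insert_eq_of_mem (by simp)] at hXY)
  have nFZ : F ≠ Z := by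
    rintro rfl
    exact collapse F (by simp) Y (by simp) nYZ.symm
      (by rwa [Set.pair_comm, Set.insert_eq_of_mem (by simp)] at hYZ)
  obtain ⟨f1, f2, f3⟩ := (mem_triangle_iff hXYZ).1 hF
  have pXY : 0 < orient i F X Y := by
    rw [orient_rotate]
    exact f1.lt_of_ne' (gen X (by simp) Y (by simp) F (by simp) nXY nFY.symm nFX.symm)
  have pYZ : 0 < orient i F Y Z := by
    rw [orient_rotate]
    exact f2.lt_of_ne' (gen Y (by simp) Z (by simp) F (by simp) nYZ nFZ.symm nFY.symm)
  have pZX : 0 < orient i F Z X := by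
    rw [orient_rotate]
    exact f3.lt_of_ne' (gen Z (by simp) X (by simp) F (by simp) nXZ.symm nFX.symm nFZ.symm)
  have genF : ∀ s ∈ A, orient i F X s ≠ 0 ∧ orient i F Y s ≠ 0 ∧ orient i F Z s ≠ 0 := by
    intro s hs
    obtain ⟨h1, h2, h3, h4⟩ := hne s hs
    exact ⟨gen F (by simp) X (by simp) s (by simp [hs]) nFX h1 h4,
      gen F (by simp) Y (by simp) s (by simp [hs]) nFY h2 h4,
      gen F (by simp) Z (by simp) s (by simp [hs]) nFZ h3 h4⟩
  have inner : ∀ s ∈ A, 0 < orient i X Y s ∧ 0 < orient i Y Z s ∧ 0 < orient i Z X s := by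
    intro s hs
    obtain ⟨h1, h2, h3, h4⟩ := hne s hs
    obtain ⟨k1, k2, k3⟩ := (mem_triangle_iff hXYZ).1 (hA (Finset.mem_coe.2 hs))
    exact ⟨k1.lt_of_ne' (gen X (by simp) Y (by simp) s (by simp [hs]) nXY h2 h1),
      k2.lt_of_ne' (gen Y (by simp) Z (by simp) s (by simp [hs]) nYZ h3 h2),
      k3.lt_of_ne' (gen Z (by simp) X (by simp) s (by simp [hs]) nXZ.symm h1 h3)⟩
  -- The rays from `F` to the corners divide the plane into three sectors: the Plücker relation
  -- excludes that `s` has the same sign with respect to all three.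
  have cover : ∀ s ∈ A, (0 < orient i F Y s ∧ 0 < orient i F s Z) ∨
      (0 < orient i F Z s ∧ 0 < orient i F s X) ∨ (0 < orient i F X s ∧ 0 < orient i F s Y) := by
    intro s hs
    obtain ⟨g1, g2, g3⟩ := genF s hs
    rw [orient_swap_right i F s X, orient_swap_right i F s Y, orient_swap_right i F s Z]
    simp only [Left.neg_pos_iff]
    have e := orient_plucker i F X Y Z s
    rcases g1.lt_or_gt with h1 | h1 <;> rcases g2.lt_or_gt with h2 | h2 <;>
      rcases g3.lt_or_gt with h3 | h3
    · nlinarith [mul_pos pXY (neg_pos.2 h3), mul_pos pYZ (neg_pos.2 h1), mul_pos pZX (neg_pos.2 h2)]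
    · tauto
    · tauto
    · tauto
    · tauto
    · tauto
    · tauto
    · nlinarith [mul_pos pXY h3, mul_pos pYZ h1, mul_pos pZX h2]
  refine ⟨A.filter fun s => 0 < orient i F Y s ∧ 0 < orient i F s Z,
    A.filter fun s => 0 < orient i F Z s ∧ 0 < orient i F s X,
    A.filter fun s => 0 < orient i F X s ∧ 0 < orient i F s Y, ⟨pXY, pYZ, pZX, ?_, ?_, ?_, ?_⟩,
    ?_, ?_, ?_, ?_⟩
  · intro s hs
    obtain ⟨h1, h2, h3⟩ := Finset.mem_filter.1 hs
    exact ⟨h2, h3, (inner s h1).2.1⟩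
  · intro s hs
    obtain ⟨h1, h2, h3⟩ := Finset.mem_filter.1 hs
    exact ⟨h2, h3, (inner s h1).2.2⟩
  · intro s hs
    obtain ⟨h1, h2, h3⟩ := Finset.mem_filter.1 hs
    exact ⟨h2, h3, (inner s h1).1⟩
  · have : ∀ S₁ S₂ S₃ : Finset Plane, S₁ ⊆ A → S₂ ⊆ A → S₃ ⊆ A →
        ({F, X, Y, Z} : Set Plane) ∪ (S₁ ∪ S₂ ∪ S₃) ⊆ {X, Y, Z, F} ∪ (A : Set Plane) := by
      rintro S₁ S₂ S₃ h1 h2 h3 s ((rfl | rfl | rfl | rfl) | (hs | hs) | hs)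
      · simp
      · simp
      · simp
      · simp
      · exact Or.inr (h1 hs)
      · exact Or.inr (h2 hs)
      · exact Or.inr (h3 hs)
    have hsub := this _ _ _ (A.filter_subset fun s => 0 < orient i F Y s ∧ 0 < orient i F s Z)
      (A.filter_subset fun s => 0 < orient i F Z s ∧ 0 < orient i F s X)
      (A.filter_subset fun s => 0 < orient i F X s ∧ 0 < orient i F s Y)
    exact fun a ha b hb c hc => gen a (hsub ha) b (hsub hb) c (hsub hc)
  · intro s
    simp only [Finset.mem_filter]
    constructor
    · intro hs; have := cover s hs; tauto
    · tauto
  · ext s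
    simp only [Finset.coe_filter, Set.mem_inter_iff, Finset.mem_coe, Set.mem_ofPred_eq]
    exact and_congr_right fun hs => (mem_subtriangle_iff pYZ (genF s hs).2.1 (genF s hs).2.2
      (inner s hs).2.1.le).symm
  · ext s
    simp only [Finset.coe_filter, Set.mem_inter_iff, Finset.mem_coe, Set.mem_ofPred_eq]
    exact and_congr_right fun hs => (mem_subtriangle_iff pZX (genF s hs).2.2 (genF s hs).1
      (inner s hs).2.2.le).symm
  · ext s
    simp only [Finset.coe_filter, Set.mem_inter_iff, Finset.mem_coe, Set.mem_ofPred_eq]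
    exact and_congr_right fun hs => (mem_subtriangle_iff pXY (genF s hs).1 (genF s hs).2.1
      (inner s hs).1.le).symm

/-- The pair `u`, `v` is not contained in one of the three chains. -/
def SplitPair (X Y Z : Plane) (A B C : Finset Plane) (u v : Plane) : Prop :=
  ¬ ((u ∈ C ∨ u = X ∨ u = Y) ∧ (v ∈ C ∨ v = X ∨ v = Y)) ∧
  ¬ ((u ∈ A ∨ u = Y ∨ u = Z) ∧ (v ∈ A ∨ v = Y ∨ v = Z)) ∧
  ¬ ((u ∈ B ∨ u = Z ∨ u = X) ∧ (v ∈ B ∨ v = Z ∨ v = X))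

theorem SplitPair.symm {u v : Plane} (h : SplitPair X Y Z A B C u v) :
    SplitPair X Y Z A B C v u := by
  unfold SplitPair at *; tauto

theorem SplitPair.rotate {u v : Plane} (h : SplitPair Y Z X B C A u v) :
    SplitPair X Y Z A B C u v := by
  unfold SplitPair at *; tauto

/-- Signs around `F` show that a point of `B` is on no chain but its own, and likewise for `C`. The
corner `Z` is only on the chains of `A` and `B`, and `Y` only on those of `C` and `A`. So the only
pair with a common chain is the excluded one. -/
theorem Config.splitPair (h : Config i F X Y Z A B C) {x z : Plane} (hx : x ∈ B ∨ x = Z)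
    (hz : z ∈ C ∨ z = Y) (hxz : ¬ (x = Z ∧ z = Y)) : SplitPair X Y Z A B C x z := by
  have bX : ∀ s, s ∈ B ∨ s = Z → ¬ (s ∈ C ∨ s = X ∨ s = Y) := by
    rintro s h1 h2
    have h3 := (h.pos_of_B h1).1
    rw [orient_swap_right] at h3
    rcases h2 with h2 | rfl | rfl
    · linarith [(h.hC s h2).1]
    · simp at h3
    · linarith [h.XY]
  have cX : ∀ s, s ∈ C ∨ s = Y → ¬ (s ∈ B ∨ s = Z ∨ s = X) := by
    rintro s h1 (h2 | h2 | h2)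
    · exact bX s (Or.inl h2) (by tauto)
    · exact bX s (Or.inr h2) (by tauto)
    · rw [h2] at h1
      have := (h.pos_of_C h1).1
      simp at this
  have bA : x ∈ B → ¬ (x ∈ A ∨ x = Y ∨ x = Z) := by
    rintro h1 h2
    have h3 := (h.hB x h1).1
    rcases h2 with h2 | rfl | rfl
    · linarith [(h.hA x h2).2.1, orient_swap_right i F x Z]
    · exact bX x (Or.inl h1) (by simp)
    · simp at h3
  have cA : z ∈ C → ¬ (z ∈ A ∨ z = Y ∨ z = Z) := by
    rintro h1 h2
    have h3 := (h.hC z h1).2.1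
    rcases h2 with h2 | rfl | rfl
    · linarith [(h.hA z h2).1, orient_swap_right i F z Y]
    · simp at h3
    · exact cX z (Or.inl h1) (by simp)
  have h1 := bX x hx
  have h2 := cX z hz
  unfold SplitPair
  tauto

theorem Config.exists_splitPair_tiling (h : Config i F X Y Z A B C) (hA : A.Nonempty)
    (hB : B.Nonempty) (hC : C.Nonempty) :
    ∃ (lA lB lC : List Plane) (K : Geometry.SimplicialComplex ℝ Plane), lA.Perm A.toList ∧
      lB.Perm B.toList ∧ lC.Perm C.toList ∧
      IsPolygonTiling (SplitPair X Y Z A B C) (X :: lC ++ Y :: lA ++ Z :: lB) K := by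
  refine h.exists_tiling hA hB hC (fun x hx z hz hxz => ?_) (fun x hx z hz hxz => ?_)
    fun x hx z hz hxz => ?_
  · have := h.splitPair hx hz hxz
    exact ⟨this, this.symm⟩
  · have := (h.rotate.splitPair hx hz hxz).rotate
    exact ⟨this, this.symm⟩
  · have := (h.rotate.rotate.splitPair hx hz hxz).rotate.rotate
    exact ⟨this, this.symm⟩

end main

theorem mainTheorem10 (X Y Z F : Plane) (A : Finset Plane)
    (hXYZ : AffineIndependent ℝ ![X, Y, Z])
    (hF : F ∈ convexHull ℝ {X, Y, Z})
    (hA : (A : Set Plane) ⊆ convexHull ℝ {X, Y, Z})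
    (hdisj : Disjoint {X, Y, Z, F} (A : Set Plane))
    (hgen : InGeneralPosition ({X, Y, Z, F} ∪ (A : Set Plane)))
    (P : Fin 3 → Plane) (hP : P = ![X, Y, Z])
    (c : Fin 3 → ℕ)
    (hc : ∀ i, c i = ((A : Set Plane) ∩ convexHull ℝ {F, P i, P (i + 1)}).ncard)
    (hpos : ∀ i, 0 < c i) :
    ∃ l : Fin 3 → List Plane,
      (∀ i, (l i).length = c i) ∧
      (l 0 ++ l 1 ++ l 2).Perm A.toList ∧
      (∀ i, polylineCarrier (P i :: (l i ++ [P (i + 1)])) ⊆ convexHull ℝ {F, P i, P (i + 1)}) ∧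
      (closedPolyline (P 0 :: l 0 ++ P 1 :: l 1 ++ P 2 :: l 2)).IsSimple ∧
      ∃ K : Geometry.SimplicialComplex ℝ Plane,
        (closedPolyline (P 0 :: l 0 ++ P 1 :: l 1 ++ P 2 :: l 2)).IsTriangulation K ∧
        ∀ a b : Plane,
          (closedPolyline (P 0 :: l 0 ++ P 1 :: l 1 ++ P 2 :: l 2)).IsDiagonalOf K a b →
            ∀ i, ¬ (a ∈ P i :: (l i ++ [P (i + 1)]) ∧ b ∈ P i :: (l i ++ [P (i + 1)])) := by
  subst hP
  obtain ⟨i, hi⟩ := exists_orient_pos hXYZ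
  have hne := fun k => Set.nonempty_of_ncard_ne_zero ((hc k).symm.trans_ne (hpos k).ne')
  obtain ⟨A₁, B, C, h, hmem, eA, eB, eC⟩ :=
    config_of_generalPosition hi hF hA hdisj hgen (hne 0) (hne 1)
  have cA : c 1 = A₁.card := (hc 1).trans (by rw [← Set.ncard_coe_finset, eA]; rfl)
  have cB : c 2 = B.card := (hc 2).trans (by rw [← Set.ncard_coe_finset, eB]; rfl)
  have cC : c 0 = C.card := (hc 0).trans (by rw [← Set.ncard_coe_finset, eC]; rfl)
  obtain ⟨lA, lB, lC, K, pA, pB, pC, hK⟩ := h.exists_splitPair_tiling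
    (Finset.card_pos.1 (cA ▸ hpos 1)) (Finset.card_pos.1 (cB ▸ hpos 2))
    (Finset.card_pos.1 (cC ▸ hpos 0))
  have mA : ∀ s, s ∈ lA ↔ s ∈ A₁ := fun s => by rw [pA.mem_iff, Finset.mem_toList]
  have mB : ∀ s, s ∈ lB ↔ s ∈ B := fun s => by rw [pB.mem_iff, Finset.mem_toList]
  have mC : ∀ s, s ∈ lC ↔ s ∈ C := fun s => by rw [pC.mem_iff, Finset.mem_toList]
  have carrier : ∀ (p q : Plane) (l : List Plane) (S : Finset Plane), (∀ s, s ∈ l ↔ s ∈ S) →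
      (S : Set Plane) = (A : Set Plane) ∩ convexHull ℝ {F, p, q} →
      polylineCarrier (p :: (l ++ [q])) ⊆ convexHull ℝ {F, p, q} := by
    intro p q l S hl hS
    refine polylineCarrier_subset (convex_convexHull ℝ _) fun s hs => ?_
    rcases (mem_chain_iff hl).1 hs with hs | rfl | rfl
    · exact (hS ▸ Finset.mem_coe.2 hs : s ∈ (A : Set Plane) ∩ _).2
    · exact subset_convexHull ℝ _ (by simp)
    · exact subset_convexHull ℝ _ (by simp)
  -- The chain with index 0 runs from `X` to `Y`, so its points are those of `C`.
  refine ⟨![lC, lA, lB], fun k => ?_, ?_, fun k => ?_, hK.isSimple, K, hK.isTriangulation,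
    fun a b hab k => ?_⟩
  · fin_cases k
    · exact (pC.length_eq.trans C.length_toList).trans cC.symm
    · exact (pA.length_eq.trans A₁.length_toList).trans cA.symm
    · exact (pB.length_eq.trans B.length_toList).trans cB.symm
  · refine perm_toList (l := lC ++ lA ++ lB) (hK.nodup.sublist
      (((List.sublist_cons_self X lC).append (List.sublist_cons_self Y lA)).append
        (List.sublist_cons_self Z lB))) fun s => ?_
    rw [hmem]
    simp only [List.mem_append, mA, mB, mC]
    tauto
  · fin_cases k
    · exact carrier X Y lC C mC eC
    · exact carrier Y Z lA A₁ mA eA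
    · exact carrier Z X lB B mB eB
  · obtain ⟨h1, h2, h3⟩ := hK.of_isDiagonalOf hab
    fin_cases k
    · exact fun hk => h1 ⟨(mem_chain_iff mC).1 hk.1, (mem_chain_iff mC).1 hk.2⟩
    · exact fun hk => h2 ⟨(mem_chain_iff mA).1 hk.1, (mem_chain_iff mA).1 hk.2⟩
    · exact fun hk => h3 ⟨(mem_chain_iff mB).1 hk.1, (mem_chain_iff mB).1 hk.2⟩
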